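/- For real $P\ge 1$ and $R\ge 1$ let $\mathcal A(P,R)$ be the set of integers $n\in[1,P]$ all of whose prime divisors are at most $R$, and put \[ g(\alpha;P,R)=\sum_{x\in\mathcal A(P,R)}e(\alpha x^4),\qquad e(z)=e^{2\pi i z}. \] A real number $\Delta_t$ is called an admissible exponent for the positive real number $t$ if there exist $\eta>0$ and $C$ such that \[ \int_0^1|g(\alpha;P,R)|^t\,d\alpha\le C\,P^{t-4+\Delta_t}\qquad\text{whenever } P\ge 1 \text{ and } 1\le R\le P^\eta . \] **Theorem 5.1.** Let $s\ge 8$ be real, let $\Delta_s$ be an admissible exponent for $s$ with $\Delta_s<1/8$, and let $u$ be a real number with $u>s+16\Delta_s>10$. Then there exist $\eta>0$ and $C$ such that \[ \int_0^1|g(\alpha;P,R)|^u\,d\alpha\le C\,P^{u-4}\qquad\text{whenever } P\ge 1\text{ and }1\le R\le P^\eta . \] In particular, the exponent $\Delta_w=0$ is admissible for every real $w\ge u$. -/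

import Mathlib

noncomputable section

namespace SmoothWeyl

/-- `e(z) = exp (2 π i z)` for real `z`. -/
def e (z : ℝ) : ℂ := Complex.exp (2 * Real.pi * Complex.I * z)

open Classical in
/-- `𝒜(P, R)`: the natural numbers `n ∈ [1, P]` all of whose prime divisors are at most `R`. -/
def smoothSet (P R : ℝ) : Finset ℕ :=
  (Finset.Icc 1 ⌊P⌋₊).filter fun n => ∀ p : ℕ, p.Prime → p ∣ n → (p : ℝ) ≤ R

/-- The quartic smooth Weyl sum `g(α; P, R) = ∑_{x ∈ 𝒜(P, R)} e(α x⁴)`. -/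
def g (P R α : ℝ) : ℂ := ∑ x ∈ smoothSet P R, e (α * (x : ℝ) ^ 4)

/-- `Δ` is an admissible exponent for the positive real number `t`: for some `η > 0` one has
`∫₀¹ |g(α; P, R)|^t dα ≪ P^(t - 4 + Δ)` whenever `1 ≤ R ≤ P^η`, with an implicit constant that is
uniform in `P` and `R`. (The clause `1 ≤ P` only serves to rule out the junk values of real powers
at a negative base; for `0 ≤ P < 1` no `R` satisfies `1 ≤ R ≤ P^η`.) -/
def Admissible (t Δ : ℝ) : Prop :=
  0 < t ∧ ∃ η : ℝ, 0 < η ∧ ∃ C : ℝ, ∀ P R : ℝ, 1 ≤ P → 1 ≤ R → R ≤ P ^ η →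
    ∫ α in (0 : ℝ)..1, ‖g P R α‖ ^ t ≤ C * P ^ (t - 4 + Δ)

end SmoothWeyl

end

/-! The moment splits at a threshold T of order N^(15/16+ε/2), where N = ⌊P⌋. Where |g| ≤ T one has
|g|^u ≤ T^(u-s)|g|^s, and the admissible exponent gives P^(u-4) times P^(Δ-(u-s)/16+ε(u-s)/2). The
condition u > s+16Δ says exactly that (u-s)/16 beats Δ. That u > s follows because admissible
exponents are never negative (`Admissible.nonneg`).

Where |g| > T smoothness plays no role: `exists_large_values_bound` treats the sum G over any subset
A of [1,N]. Let I be the integral of |G|^u over this set E. Writing I = ∫ G h with |h| = |G|^(u-1)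
on E, Cauchy–Schwarz over x, with the sum then enlarged from A to all of [1,N], gives I² ≤ N|∬
f(α-β) h(α) conj h(β)|, where f is the complete Weyl sum (`norm_sq_integral_mul_le`). Pointwise |f|
≤ C N^(7/8+ε) + M^(1/r) with r = u/2 (`exists_norm_weylSum_le`). The first term contributes at most
I²/2 by the choice of T. The second contributes at most N I^(2-1/r)(∫M)^(1/r) by a Young-type
inequality (`lintegral_convolution_le`). Since ∫M ≪ N^(r-4) (`exists_integral_majorant_le`), it
follows that I ≪ N^(2r-4) = N^(u-4).

The bound for f combines Weyl's inequality, when the Dirichlet denominator q is at least N, with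
completion modulo q when q < N. The integral of M is governed by a singular series whose terms at p
and p⁴ are O(p^(1-r/2)) and O(p^(4-r)); it converges because r > 5, that is u > 10. The complete
sums modulo q are estimated only by counting solutions of x⁴ = y⁴ modulo prime powers
(`numEqFourth_prime_pow_le`). -/

noncomputable section

namespace SmoothWeyl
open Finset

/-! ### The additive character and the Kusmin–Landau inequality. -/

lemma e_add (x y : ℝ) : e (x + y) = e x * e y := by
  simp only [e, ← Complex.exp_add]; congr 1; push_cast; ring

@[simp] lemma e_zero : e 0 = 1 := by simp [e]

@[simp] lemma norm_e (x : ℝ) : ‖e x‖ = 1 := by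
  have : e x = Complex.exp ((2 * Real.pi * x : ℝ) * Complex.I) := by
    simp only [e]; congr 1; push_cast; ring
  rw [this, Complex.norm_exp_ofReal_mul_I]

lemma e_eq_cos_add_sin (x : ℝ) :
    e x = (Real.cos (2 * Real.pi * x) : ℂ) + Real.sin (2 * Real.pi * x) * Complex.I := by
  have : e x = Complex.exp ((2 * Real.pi * x : ℝ) * Complex.I) := by
    simp only [e]; congr 1; push_cast; ring
  rw [this, Complex.exp_mul_I, Complex.ofReal_cos, Complex.ofReal_sin]

lemma conj_e (x : ℝ) : starRingEnd ℂ (e x) = e (-x) := by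
  simp only [e, ← Complex.exp_conj]; congr 1; simp; exact Or.inl (Complex.conj_ofNat 2)

lemma e_intCast (n : ℤ) : e n = 1 := by
  have := Complex.exp_int_mul_two_pi_mul_I n
  rw [← this]; simp only [e]; congr 1; push_cast; ring

lemma e_add_intCast (x : ℝ) (n : ℤ) : e (x + n) = e x := by
  rw [e_add, e_intCast, mul_one]

lemma e_sub (x y : ℝ) : e (x - y) = e x * starRingEnd ℂ (e y) := by
  rw [conj_e, ← e_add, sub_eq_add_neg]

lemma continuous_e : Continuous e := by unfold e; fun_prop

/-- The value `1 / (e δ - 1)` occurring in the Kusmin–Landau inequality. -/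
lemma e_sub_one_mul (δ : ℝ) (h : Real.sin (Real.pi * δ) ≠ 0) :
    (e δ - 1) * (-1 / 2 - Complex.I / 2 *
      (Real.cos (Real.pi * δ) / Real.sin (Real.pi * δ) : ℝ)) = 1 := by
  have h1 : 2 * Real.pi * δ = 2 * (Real.pi * δ) := by ring
  rw [e_eq_cos_add_sin, h1, Real.cos_two_mul, Real.sin_two_mul]
  have hs : (Real.sin (Real.pi * δ) : ℂ) ≠ 0 := by exact_mod_cast h
  have hq : (Real.sin (Real.pi * δ) : ℂ) ^ 2 + (Real.cos (Real.pi * δ) : ℂ) ^ 2 = 1 := by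
    exact_mod_cast Real.sin_sq_add_cos_sq (Real.pi * δ)
  push_cast
  set s : ℂ := Complex.sin (Real.pi * δ)
  set c : ℂ := Complex.cos (Real.pi * δ)
  have hs' : s ≠ 0 := by rwa [Complex.ofReal_sin, Complex.ofReal_mul] at hs
  have hq' : s ^ 2 + c ^ 2 = 1 := by simp [s, c]
  have hI : Complex.I ^ 2 = -1 := Complex.I_sq
  have hc : c ^ 2 = 1 - s ^ 2 := by linear_combination hq'
  field_simp
  ring_nf
  simp only [hI, show c ^ 3 = c * c ^ 2 by ring, hc]
  ring

lemma two_mul_le_sin_pi_mul {θ δ : ℝ} (hθ : 0 ≤ θ) (h1 : θ ≤ δ) (h2 : δ ≤ 1 - θ) :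
    2 * θ ≤ Real.sin (Real.pi * δ) := by
  have hpi := Real.pi_pos
  rcases le_total δ (1 / 2) with h | h
  · have := Real.mul_le_sin (x := Real.pi * δ) (by nlinarith) (by nlinarith)
    have e1 : 2 / Real.pi * (Real.pi * δ) = 2 * δ := by field_simp
    linarith
  · have := Real.mul_le_sin (x := Real.pi * (1 - δ)) (by nlinarith) (by nlinarith)
    have e1 : 2 / Real.pi * (Real.pi * (1 - δ)) = 2 * (1 - δ) := by field_simp
    have e2 : Real.sin (Real.pi * (1 - δ)) = Real.sin (Real.pi * δ) := by
      rw [mul_sub, mul_one, Real.sin_pi_sub]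
    linarith

/-- After cross-multiplication the claim is sin(π(b-a)) ≥ 0. -/
lemma cot_pi_mul_antitone {a b : ℝ} (ha : 0 < Real.sin (Real.pi * a))
    (hb : 0 < Real.sin (Real.pi * b)) (hab : a ≤ b) (hba : b - a ≤ 1) :
    Real.cos (Real.pi * b) / Real.sin (Real.pi * b) ≤
      Real.cos (Real.pi * a) / Real.sin (Real.pi * a) := by
  rw [div_le_div_iff₀ hb ha]
  have : 0 ≤ Real.sin (Real.pi * b - Real.pi * a) := by
    apply Real.sin_nonneg_of_nonneg_of_le_pi <;> nlinarith [Real.pi_pos]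
  rw [Real.sin_sub] at this
  linarith

/-- The **Kusmin–Landau inequality**, for nondecreasing differences. -/
lemma norm_sum_e_le_of_monotone {φ : ℕ → ℝ} {M : ℕ} {θ : ℝ} (hθ : 0 < θ)
    (hmono : ∀ n, n + 1 < M → φ (n + 1) - φ n ≤ φ (n + 2) - φ (n + 1))
    (h1 : ∀ n < M, θ ≤ φ (n + 1) - φ n) (h2 : ∀ n < M, φ (n + 1) - φ n ≤ 1 - θ) :
    ‖∑ n ∈ range M, e (φ n)‖ ≤ 1 / θ := by
  rcases Nat.eq_zero_or_pos M with rfl | hM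
  · simpa using hθ.le
  set k : ℕ → ℝ := fun n =>
    Real.cos (Real.pi * (φ (n + 1) - φ n)) / Real.sin (Real.pi * (φ (n + 1) - φ n)) with hk
  -- `c n` is 1/(e(δ) - 1) for the n-th difference δ. It lies on the line Re = -1/2, so its total
  -- variation is that of `k / 2`.
  set c : ℕ → ℂ := fun n => -1 / 2 - Complex.I / 2 * (k n : ℝ) with hc
  have hsin : ∀ n < M, 2 * θ ≤ Real.sin (Real.pi * (φ (n + 1) - φ n)) := fun n hn =>
    two_mul_le_sin_pi_mul hθ.le (h1 n hn) (h2 n hn)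
  have hE : ∀ n < M, e (φ n) = c n * (e (φ (n + 1)) - e (φ n)) := by
    intro n hn
    have := e_sub_one_mul (φ (n + 1) - φ n) (by linarith [hsin n hn])
    have h3 : e (φ (n + 1)) = e (φ (n + 1) - φ n) * e (φ n) := by rw [← e_add]; congr 1; ring
    rw [h3]
    calc e (φ n) = 1 * e (φ n) := by ring
      _ = _ := by rw [← this]; simp only [hc, hk]; ring
  have hkb : ∀ n < M, |k n| ≤ 1 / (2 * θ) := by
    intro n hn
    have hs := hsin n hn
    rw [hk, abs_div, abs_of_pos (by linarith : 0 < Real.sin (Real.pi * (φ (n + 1) - φ n)))]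
    exact div_le_div₀ zero_le_one (Real.abs_cos_le_one _) (by linarith) hs
  -- Summation by parts: since `k` is monotone, the variation of `c` telescopes to (k 0 - k m)/2.
  have key : ∀ m, m + 1 ≤ M →
      ‖∑ n ∈ range (m + 1), e (φ n) - c m * e (φ (m + 1)) + c 0 * e (φ 0)‖ ≤
        (k 0 - k m) / 2 := by
    intro m
    induction m with
    | zero =>
      intro h
      simp only [zero_add, range_one, sum_singleton, sub_self, zero_div, norm_le_zero_iff]
      have := hE 0 (by omega)
      simp only [zero_add] at this
      linear_combination this
    | succ m ih =>
      intro h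
      have h3 := ih (by omega)
      have h4 := hE (m + 1) (by omega)
      have h5 : ∑ n ∈ range (m + 1 + 1), e (φ n) - c (m + 1) * e (φ (m + 1 + 1)) + c 0 * e (φ 0) =
          (∑ n ∈ range (m + 1), e (φ n) - c m * e (φ (m + 1)) + c 0 * e (φ 0)) +
            (c m - c (m + 1)) * e (φ (m + 1)) := by
        rw [sum_range_succ]; linear_combination h4
      have h6 : k (m + 1) ≤ k m := by
        apply cot_pi_mul_antitone
        · linarith [hsin m (by omega)]
        · linarith [hsin (m + 1) (by omega)]
        · exact hmono m (by omega)
        · linarith [h1 m (by omega), h2 (m + 1) (by omega)]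
      have h7 : c m - c (m + 1) = -(Complex.I / 2) * ((k m - k (m + 1) : ℝ) : ℂ) := by
        simp only [hc]; push_cast; ring
      have h8 : ‖(c m - c (m + 1)) * e (φ (m + 1))‖ = (k m - k (m + 1)) / 2 := by
        rw [h7, norm_mul, norm_mul, norm_e, Complex.norm_real, Real.norm_of_nonneg (by linarith)]
        simp; ring
      rw [h5]
      refine (norm_add_le _ _).trans ?_
      rw [h8]; linarith
  -- |e(δ) - 1| = 2 sin(πδ) ≥ 4θ. The two boundary terms thus cost 1/(4θ) each and the variation at
  -- most 1/(2θ), in total exactly 1/θ.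
  have hcb : ∀ n < M, ‖c n‖ ≤ 1 / (4 * θ) := by
    intro n hn
    have h3 := e_sub_one_mul (φ (n + 1) - φ n) (by linarith [hsin n hn])
    have h4 : (2 * Real.sin (Real.pi * (φ (n + 1) - φ n))) ^ 2 = ‖e (φ (n + 1) - φ n) - 1‖ ^ 2 := by
      set x := Real.pi * (φ (n + 1) - φ n)
      rw [e_eq_cos_add_sin, show 2 * Real.pi * (φ (n + 1) - φ n) = 2 * x by simp only [x]; ring,
        ← Complex.normSq_eq_norm_sq, Complex.normSq_apply]
      simp only [Complex.sub_re, Complex.add_re, Complex.ofReal_re, Complex.mul_re, Complex.I_re,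
        Complex.ofReal_im, Complex.I_im, Complex.one_re, Complex.sub_im, Complex.add_im,
        Complex.mul_im, Complex.one_im]
      rw [Real.cos_two_mul, Real.sin_two_mul]
      nlinarith [Real.sin_sq_add_cos_sq x]
    have h5 : 4 * θ ≤ ‖e (φ (n + 1) - φ n) - 1‖ := by
      have := hsin n hn
      rw [← abs_of_nonneg (norm_nonneg _), ← abs_of_pos (by linarith : 0 < 4 * θ), ← sq_le_sq, ← h4]
      nlinarith
    have h6 : ‖e (φ (n + 1) - φ n) - 1‖ * ‖c n‖ = 1 := by
      rw [← norm_mul]; simp only [hc, hk, h3, norm_one]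
    rw [le_div_iff₀ (by positivity)]
    nlinarith [norm_nonneg (c n)]
  obtain ⟨m, rfl⟩ : ∃ m, M = m + 1 := ⟨M - 1, by omega⟩
  have h3 := key m le_rfl
  have h4 : ∑ n ∈ range (m + 1), e (φ n) =
      (∑ n ∈ range (m + 1), e (φ n) - c m * e (φ (m + 1)) + c 0 * e (φ 0)) +
        c m * e (φ (m + 1)) - c 0 * e (φ 0) := by ring
  rw [h4]
  refine (norm_sub_le _ _).trans ?_
  refine (add_le_add_left (norm_add_le _ _) _).trans ?_
  rw [norm_mul, norm_mul, norm_e, norm_e]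
  have h5 := hcb m (by omega)
  have h6 := hcb 0 (by omega)
  have h7 := abs_le.1 (hkb 0 (by omega))
  have h8 := abs_le.1 (hkb m (by omega))
  have h9 : 1 / (4 * θ) = (1 / θ) / 4 := by field_simp
  have h10 : 1 / (2 * θ) = (1 / θ) / 2 := by field_simp
  rw [h9] at h5 h6; rw [h10] at h7 h8
  linarith

/-- The **Kusmin–Landau inequality**, for nonincreasing differences. -/
lemma norm_sum_e_le_of_antitone {φ : ℕ → ℝ} {M : ℕ} {θ : ℝ} (hθ : 0 < θ)
    (hmono : ∀ n, n + 1 < M → φ (n + 2) - φ (n + 1) ≤ φ (n + 1) - φ n)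
    (h1 : ∀ n < M, θ ≤ φ (n + 1) - φ n) (h2 : ∀ n < M, φ (n + 1) - φ n ≤ 1 - θ) :
    ‖∑ n ∈ range M, e (φ n)‖ ≤ 1 / θ := by
  -- Conjugating and adding the integer n to the phase replaces each difference δ by 1 - δ, which
  -- reverses monotonicity and preserves [θ, 1-θ].
  have h := norm_sum_e_le_of_monotone (φ := fun n => -φ n + n) (M := M) hθ
    (fun n hn => by have := hmono n hn; push_cast; linarith)
    (fun n hn => by have := h2 n hn; push_cast; linarith)
    (fun n hn => by have := h1 n hn; push_cast; linarith)
  have h3 : ∑ n ∈ range M, e (-φ n + n) = starRingEnd ℂ (∑ n ∈ range M, e (φ n)) := by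
    rw [map_sum]
    refine sum_congr rfl fun n _ => ?_
    rw [conj_e]; exact_mod_cast e_add_intCast (-φ n) n
  rwa [h3, RCLike.norm_conj] at h

/-! ### Linear exponential sums and the divisor bound. -/

/-- Distance to the nearest integer. -/
def nd (x : ℝ) : ℝ := |x - round x|

lemma nd_nonneg (x : ℝ) : 0 ≤ nd x := abs_nonneg _

lemma nd_le (x : ℝ) (n : ℤ) : nd x ≤ |x - n| := round_le x n

lemma nd_neg (x : ℝ) : nd (-x) = nd x := by
  apply le_antisymm
  · refine (nd_le (-x) (-round x)).trans (le_of_eq ?_)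
    rw [nd, ← abs_neg]; congr 1; push_cast; ring
  · refine (nd_le x (-round (-x))).trans (le_of_eq ?_)
    rw [nd, ← abs_neg]; congr 1; push_cast; ring

lemma norm_sum_e_linear_le (γ c : ℝ) (M : ℕ) (h : 0 < nd γ) :
    ‖∑ n ∈ range M, e (γ * n + c)‖ ≤ 1 / nd γ := by
  have h3 : ∀ n : ℕ, e (γ * n + c) = e (Int.fract γ * n + c) := by
    intro n
    rw [← e_add_intCast (Int.fract γ * n + c) (⌊γ⌋ * n)]
    congr 1; push_cast
    linear_combination (-(n : ℝ)) * Int.fract_add_floor γ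
  simp only [h3]
  have h4 : nd γ ≤ Int.fract γ := by
    refine (nd_le γ ⌊γ⌋).trans (le_of_eq ?_)
    rw [← Int.fract, abs_of_nonneg (Int.fract_nonneg _)]
  have h5 : nd γ ≤ 1 - Int.fract γ := by
    refine (nd_le γ (⌊γ⌋ + 1)).trans (le_of_eq ?_)
    rw [abs_of_nonpos] <;> push_cast <;> linarith [Int.fract_add_floor γ, Int.fract_lt_one γ]
  apply norm_sum_e_le_of_monotone h
  · intro n _; push_cast; linarith
  · intro n _; push_cast; linarith
  · intro n _; push_cast; linarith

lemma norm_sum_e_linear_le' (γ c : ℝ) (M : ℕ) {N : ℝ} (hMN : M ≤ N) :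
    ‖∑ n ∈ range M, e (γ * n + c)‖ ≤ 2 * (N / (1 + N * nd γ)) := by
  have hM : ‖∑ n ∈ range M, e (γ * n + c)‖ ≤ M := by
    refine (norm_sum_le _ _).trans ?_
    simp
  have hN : 0 ≤ N := (Nat.cast_nonneg M).trans hMN
  have hnd := nd_nonneg γ
  rw [mul_div_assoc', le_div_iff₀ (by positivity)]
  rcases hnd.eq_or_lt with h | h
  · rw [← h]; linarith
  · have h1 := norm_sum_e_linear_le γ c M h
    rw [le_div_iff₀ h] at h1
    nlinarith

lemma norm_sum_Ico_e_linear_le (γ c : ℝ) (a b : ℤ) {N : ℝ} (hN : 0 ≤ N) (hab : b - a ≤ N) :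
    ‖∑ n ∈ Ico a b, e (γ * n + c)‖ ≤ 2 * (N / (1 + N * nd γ)) := by
  have h : ∑ n ∈ Ico a b, e (γ * n + c) =
      ∑ n ∈ range (b - a).toNat, e (γ * n + (γ * a + c)) := by
    symm
    apply sum_nbij (fun n : ℕ => a + n)
    · intro n hn; simp at hn ⊢; omega
    · intro m _ n _ h; simpa using h
    · intro n hn; simp at hn ⊢; exact ⟨(n - a).toNat, by omega, by omega⟩
    · intro n _; congr 1; push_cast; ring
  rw [h]
  apply norm_sum_e_linear_le'
  rcases le_total a b with h | h
  · have : (((b - a).toNat : ℤ) : ℝ) = ((b - a : ℤ) : ℝ) := by rw [Int.toNat_of_nonneg (by omega)]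
    push_cast at this ⊢
    linarith
  · rw [Int.toNat_of_nonpos (by omega)]; simpa using hN

/-- The divisor bound. -/
lemma exists_card_divisors_le {ε : ℝ} (hε : 0 < ε) :
    ∃ C : ℝ, 1 ≤ C ∧ ∀ n : ℕ, n ≠ 0 → ((n.divisors.card : ℕ) : ℝ) ≤ C * (n : ℝ) ^ ε := by
  set K : ℝ := 1 + 1 / (ε * Real.log 2) with hK
  set B : ℕ := ⌈(2 : ℝ) ^ (1 / ε)⌉₊ with hB
  have hlog : 0 < Real.log 2 := Real.log_pos (by norm_num)
  have hK1 : 1 ≤ K := by rw [hK]; have : 0 < 1 / (ε * Real.log 2) := by positivity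
                         linarith
  refine ⟨K ^ B, one_le_pow₀ hK1, fun n hn => ?_⟩
  -- If p ≥ B then p^ε ≥ 2, so v + 1 ≤ 2^v ≤ p^(εv) without loss. Each of the fewer than B smaller
  -- primes costs at most a factor `K`.
  have hfac : ∀ p ∈ n.primeFactors, ((n.factorization p + 1 : ℕ) : ℝ) ≤
      (if p < B then K else 1) * ((p : ℝ) ^ n.factorization p) ^ ε := by
    intro p hp
    have hp2 : (2 : ℝ) ≤ p := by exact_mod_cast (Nat.prime_of_mem_primeFactors hp).two_le
    set v := n.factorization p
    have hswap : ((p : ℝ) ^ v) ^ ε = ((p : ℝ) ^ ε) ^ v := by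
      rw [← Real.rpow_natCast, ← Real.rpow_mul (by linarith), mul_comm, Real.rpow_mul (by linarith),
        Real.rpow_natCast]
    rw [hswap]
    split_ifs with h
    · have h1 : 1 + ε * Real.log 2 ≤ (p : ℝ) ^ ε := by
        calc 1 + ε * Real.log 2 ≤ Real.exp (ε * Real.log 2) := by
              linarith [Real.add_one_le_exp (ε * Real.log 2)]
          _ = (2 : ℝ) ^ ε := by rw [Real.rpow_def_of_pos (by norm_num), mul_comm]
          _ ≤ _ := by gcongr
      have h2 : 1 + v * (ε * Real.log 2) ≤ ((p : ℝ) ^ ε) ^ v := by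
        refine (one_add_mul_le_pow (by nlinarith [mul_pos hε hlog]) v).trans ?_
        gcongr
      have h3 : ((v + 1 : ℕ) : ℝ) ≤ K * (1 + v * (ε * Real.log 2)) := by
        have : 1 / (ε * Real.log 2) * (v * (ε * Real.log 2)) = v := by field_simp
        have h4 : 0 < 1 / (ε * Real.log 2) := by positivity
        have h5 : 0 ≤ v * (ε * Real.log 2) := by positivity
        rw [hK]; push_cast; nlinarith
      exact h3.trans (by gcongr)
    · have h1 : (2 : ℝ) ≤ (p : ℝ) ^ ε := by
        have h2 : (2 : ℝ) ^ (1 / ε) ≤ p := (Nat.le_ceil _).trans (by exact_mod_cast not_lt.1 h)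
        calc (2 : ℝ) = ((2 : ℝ) ^ (1 / ε)) ^ ε := by
              rw [← Real.rpow_mul (by norm_num), one_div_mul_cancel hε.ne', Real.rpow_one]
          _ ≤ _ := by gcongr
      rw [one_mul]
      calc ((v + 1 : ℕ) : ℝ) ≤ 2 ^ v := by exact_mod_cast Nat.lt_two_pow_self
        _ ≤ _ := by gcongr
  have hprod : (n : ℝ) ^ ε = ∏ p ∈ n.primeFactors, ((p : ℝ) ^ n.factorization p) ^ ε := by
    rw [Real.finsetProd_rpow _ _ (fun _ _ => by positivity)]
    congr 1
    conv_lhs => rw [← Nat.prod_factorization_pow_eq_self hn]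
    rw [Finsupp.prod]; push_cast; rfl
  rw [Nat.card_divisors hn, Nat.cast_prod, hprod]
  refine (prod_le_prod (fun _ _ => by positivity) hfac).trans ?_
  rw [prod_mul_distrib]
  gcongr
  rw [prod_ite, prod_const, prod_const_one, mul_one]
  apply pow_le_pow_right₀ hK1
  calc _ ≤ (range B).card := card_le_card fun p hp => by simpa using (mem_filter.1 hp).2
    _ = B := card_range B

end SmoothWeyl

/-! ### Weyl differencing for quartic phases. -/

namespace SmoothWeyl
open Finset

/-- Weyl differencing. -/
lemma norm_sq_sum_e_le (φ : ℤ → ℝ) (a b : ℤ) (N : ℕ) (hab : b - a ≤ N) :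
    ‖∑ x ∈ Ico a b, e (φ x)‖ ^ 2 ≤ ∑ h ∈ Ioo (-(N : ℤ)) N,
      ‖∑ x ∈ Ico (max a (a - h)) (min b (b - h)), e (φ (x + h) - φ x)‖ := by
  have h1 : ((‖∑ x ∈ Ico a b, e (φ x)‖ ^ 2 : ℝ) : ℂ) =
      ∑ h ∈ Ioo (-(N : ℤ)) N,
        ∑ x ∈ Ico (max a (a - h)) (min b (b - h)), e (φ (x + h) - φ x) := by
    push_cast
    rw [← Complex.mul_conj', map_sum, sum_mul_sum, ← sum_product', sum_sigma']
    apply sum_bij' (fun p _ => (⟨p.1 - p.2, p.2⟩ : (_ : ℤ) × ℤ)) (fun p _ => (p.2 + p.1, p.2))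
    · intro p hp; simp at hp ⊢; omega
    · intro p hp; simp at hp ⊢; omega
    · intro p hp; simp
    · intro p hp; simp
    · intro p hp; simp [e_sub]
  calc ‖∑ x ∈ Ico a b, e (φ x)‖ ^ 2 = ‖((‖∑ x ∈ Ico a b, e (φ x)‖ ^ 2 : ℝ) : ℂ)‖ := by
        rw [Complex.norm_real, Real.norm_of_nonneg (by positivity)]
    _ ≤ _ := by rw [h1]; exact norm_sum_le _ _

lemma card_Ioo_neg_le (N : ℕ) : ((Ioo (-(N : ℤ)) N).card : ℝ) ≤ 2 * N := by
  rw [Int.card_Ioo]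
  have : ((N : ℤ) - -(N : ℤ) - 1).toNat ≤ 2 * N := by omega
  exact_mod_cast this

/-- The weight `N / (1 + N ‖γ‖)`, of the order of `min (N, 1 / ‖γ‖)`. -/
def minRecip (N : ℕ) (γ : ℝ) : ℝ := N / (1 + N * nd γ)

lemma minRecip_nonneg (N : ℕ) (γ : ℝ) : 0 ≤ minRecip N γ := by
  have := nd_nonneg γ
  unfold minRecip; positivity

lemma minRecip_le (N : ℕ) (γ : ℝ) : minRecip N γ ≤ N := by
  have := nd_nonneg γ
  exact div_le_self (by positivity) (by linarith [mul_nonneg (Nat.cast_nonneg (α := ℝ) N) this])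

lemma minRecip_neg (N : ℕ) (γ : ℝ) : minRecip N (-γ) = minRecip N γ := by
  rw [minRecip, minRecip, nd_neg]

/-- Weyl differencing carried out three times for a quartic phase. -/
lemma norm_quartic_sum_pow_eight_le (α θ : ℝ) (a b : ℤ) (N : ℕ) (hab : b - a ≤ N) :
    ‖∑ x ∈ Ico a b, e (α * (x : ℝ) ^ 4 + θ * x)‖ ^ 8 ≤ 32 * (N : ℝ) ^ 4 *
      ∑ h ∈ Ioo (-(N : ℤ)) N, ∑ k ∈ Ioo (-(N : ℤ)) N, ∑ l ∈ Ioo (-(N : ℤ)) N,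
        minRecip N (24 * α * h * k * l) := by
  set I := Ioo (-(N : ℤ)) N with hI
  have hcard : (I.card : ℝ) ≤ 2 * N := card_Ioo_neg_le N
  have cs : ∀ F : ℤ → ℝ, (∑ h ∈ I, F h) ^ 2 ≤ 2 * N * ∑ h ∈ I, F h ^ 2 := fun F =>
    (sq_sum_le_card_mul_sum_sq (s := I) (f := F)).trans
      (mul_le_mul_of_nonneg_right hcard (sum_nonneg fun _ _ => sq_nonneg _))
  set φ : ℤ → ℝ := fun x => α * (x : ℝ) ^ 4 + θ * x with hφ
  set φ₁ : ℤ → ℤ → ℝ := fun h x => φ (x + h) - φ x with hφ₁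
  set φ₂ : ℤ → ℤ → ℤ → ℝ := fun h k x => φ₁ h (x + k) - φ₁ h x with hφ₂
  set A : ℤ → ℝ := fun h => ‖∑ x ∈ Ico (max a (a - h)) (min b (b - h)), e (φ₁ h x)‖ with hA
  have h1 : ‖∑ x ∈ Ico a b, e (φ x)‖ ^ 2 ≤ ∑ h ∈ I, A h := norm_sq_sum_e_le φ a b N hab
  have h2 : ∀ h ∈ I, A h ^ 4 ≤ 2 * N * ∑ k ∈ I, ∑ l ∈ I, 2 * minRecip N (24 * α * h * k * l) := by
    intro h _
    set a₁ := max a (a - h)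
    set b₁ := min b (b - h)
    have hab₁ : b₁ - a₁ ≤ N := by omega
    have h3 := norm_sq_sum_e_le (φ₁ h) a₁ b₁ N hab₁
    have h4 : ∀ k ∈ I, ‖∑ x ∈ Ico (max a₁ (a₁ - k)) (min b₁ (b₁ - k)), e (φ₂ h k x)‖ ^ 2 ≤
        ∑ l ∈ I, 2 * minRecip N (24 * α * h * k * l) := by
      intro k _
      set a₂ := max a₁ (a₁ - k)
      set b₂ := min b₁ (b₁ - k)
      have hab₂ : b₂ - a₂ ≤ N := by omega
      refine (norm_sq_sum_e_le (φ₂ h k) a₂ b₂ N hab₂).trans ?_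
      refine sum_le_sum fun l _ => ?_
      set a₃ := max a₂ (a₂ - l)
      set b₃ := min b₂ (b₂ - l)
      have hab₃ : b₃ - a₃ ≤ N := by omega
      -- Three differencings leave a phase linear in x, of slope 24αhkl; the term θx is already gone
      -- after two.
      have h5 : ∀ x : ℤ, φ₂ h k (x + l) - φ₂ h k x =
          (24 * α * h * k * l) * x + 12 * α * h * k * l * (h + k + l) := by
        intro x
        simp only [hφ₂, hφ₁, hφ]; push_cast; ring
      simp only [h5]
      exact norm_sum_Ico_e_linear_le _ _ a₃ b₃ (Nat.cast_nonneg N) (by exact_mod_cast hab₃)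
    calc A h ^ 4 = (A h ^ 2) ^ 2 := by ring
      _ ≤ (∑ k ∈ I, ‖∑ x ∈ Ico (max a₁ (a₁ - k)) (min b₁ (b₁ - k)), e (φ₂ h k x)‖) ^ 2 := by
        gcongr
      _ ≤ _ := (cs _).trans (by gcongr with k hk; exact h4 k hk)
  calc ‖∑ x ∈ Ico a b, e (φ x)‖ ^ 8 = ((‖∑ x ∈ Ico a b, e (φ x)‖ ^ 2) ^ 2) ^ 2 := by ring
    _ ≤ ((∑ h ∈ I, A h) ^ 2) ^ 2 := by gcongr
    _ ≤ (2 * N * ∑ h ∈ I, A h ^ 2) ^ 2 := by gcongr; exact cs A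
    _ = (2 * N) ^ 2 * (∑ h ∈ I, A h ^ 2) ^ 2 := by ring
    _ ≤ (2 * N) ^ 2 * (2 * N * ∑ h ∈ I, (A h ^ 2) ^ 2) := by gcongr; exact cs _
    _ = (2 * N) ^ 2 * (2 * N * ∑ h ∈ I, A h ^ 4) := by simp only [← pow_mul]
    _ ≤ (2 * N) ^ 2 * (2 * N * ∑ h ∈ I,
          (2 * N * ∑ k ∈ I, ∑ l ∈ I, 2 * minRecip N (24 * α * h * k * l))) := by
        gcongr with h hh
        exact h2 h hh
    _ = _ := by simp only [← mul_sum]; ring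

lemma sum_Ioo_natAbs_le (N : ℕ) (F : ℕ → ℝ) (hF : ∀ n, 0 ≤ F n) :
    ∑ h ∈ Ioo (-(N : ℤ)) N, F h.natAbs ≤ 2 * ∑ n ∈ range N, F n := by
  rw [← sum_fiberwise_of_maps_to (t := range N) (g := Int.natAbs)
    (fun h hh => by simp at hh ⊢; omega), mul_sum]
  refine sum_le_sum fun n _ => ?_
  rw [sum_congr rfl (g := fun _ => F n) (fun h hh => by rw [(mem_filter.1 hh).2]), sum_const,
    nsmul_eq_mul]
  refine mul_le_mul_of_nonneg_right ?_ (hF n)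
  have : ((Ioo (-(N : ℤ)) N).filter (fun h => h.natAbs = n)) ⊆ {(n : ℤ), -(n : ℤ)} := by
    intro h hh
    have := (mem_filter.1 hh).2
    simp only [mem_insert, mem_singleton]; omega
  exact_mod_cast (card_le_card this).trans card_le_two

/-- Both h and k divide m, and since m ≠ 0 the pair (h, k) determines l. -/
lemma card_filter_triple_mul_eq_le (N m : ℕ) (hm : m ≠ 0) :
    ((range N ×ˢ range N ×ˢ range N).filter fun p => p.1 * p.2.1 * p.2.2 = m).card ≤
      m.divisors.card ^ 2 := by
  rw [sq, ← card_product]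
  apply card_le_card_of_injOn (fun p => (p.1, p.2.1))
  · rintro ⟨h, k, l⟩ hp
    simp only [coe_filter, Set.mem_ofPred_eq] at hp
    simp only [coe_product, Set.mem_prod, mem_coe, Nat.mem_divisors]
    exact ⟨⟨⟨k * l, by rw [← hp.2]; ring⟩, hm⟩, ⟨⟨h * l, by rw [← hp.2]; ring⟩, hm⟩⟩
  · rintro ⟨h, k, l⟩ hp ⟨h', k', l'⟩ hp' heq
    simp only [coe_filter, Set.mem_ofPred_eq] at hp hp'
    simp only [Prod.mk.injEq] at heq ⊢
    obtain ⟨rfl, rfl⟩ := heq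
    refine ⟨rfl, rfl, ?_⟩
    have h0 : h * k ≠ 0 := fun h0 => hm (by rw [← hp.2, h0, zero_mul])
    exact Nat.eq_of_mul_eq_mul_left (Nat.pos_of_ne_zero h0) (hp.2.trans hp'.2.symm)

lemma card_filter_triple_mul_eq_zero_le (N : ℕ) :
    ((range N ×ˢ range N ×ˢ range N).filter fun p => p.1 * p.2.1 * p.2.2 = 0).card ≤
      3 * N ^ 2 := by
  have : ((range N ×ˢ range N ×ˢ range N).filter fun p => p.1 * p.2.1 * p.2.2 = 0) ⊆
      ({0} ×ˢ range N ×ˢ range N) ∪ ((range N ×ˢ {0} ×ˢ range N) ∪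
        (range N ×ˢ range N ×ˢ {0})) := by
    rintro ⟨h, k, l⟩ hp
    simp only [mem_filter, mem_product, mul_eq_zero, mem_union, mem_singleton] at hp ⊢
    tauto
  refine (card_le_card this).trans ((card_union_le _ _).trans ?_)
  refine (Nat.add_le_add_left (card_union_le _ _) _).trans ?_
  simp only [card_product, card_range, card_singleton]
  apply le_of_eq; ring

/-- Triples are grouped by m = |hkl|; the 8 accounts for signs. The value m = 0 comes from at most
3N² triples with weight at most N each, any other m from at most K². Reading 24αm as αn with n = 24m
and enlarging to all n ≤ 24N³ leaves consecutive multiples of α itself, so the approximation to α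
can be used unchanged. -/
lemma sum_minRecip_triple_le (N : ℕ) (α : ℝ) (K : ℝ)
    (hK : ∀ m : ℕ, m ≠ 0 → m ≤ N ^ 3 → ((m.divisors.card : ℕ) : ℝ) ≤ K) :
    ∑ h ∈ Ioo (-(N : ℤ)) N, ∑ k ∈ Ioo (-(N : ℤ)) N, ∑ l ∈ Ioo (-(N : ℤ)) N,
        minRecip N (24 * α * h * k * l) ≤
      8 * (3 * (N : ℝ) ^ 3 + K ^ 2 * ∑ n ∈ range (24 * N ^ 3 + 1), minRecip N (α * n)) := by
  set D : ℕ → ℝ := fun m => minRecip N (24 * α * m) with hD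
  have hD0 : ∀ m, 0 ≤ D m := fun m => minRecip_nonneg _ _
  have habs : ∀ h k l : ℤ, minRecip N (24 * α * h * k * l) =
      D (h.natAbs * k.natAbs * l.natAbs) := by
    intro h k l
    have h1 : ((h.natAbs * k.natAbs * l.natAbs : ℕ) : ℝ) = |(h * k * l : ℝ)| := by
      push_cast
      rw [abs_mul, abs_mul, Nat.cast_natAbs, Nat.cast_natAbs, Nat.cast_natAbs]
      push_cast; rfl
    simp only [hD, h1]
    rcases abs_choice (h * k * l : ℝ) with h2 | h2 <;> rw [h2]
    · congr 1; ring
    · rw [← minRecip_neg]; congr 1; ring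
  simp only [habs]
  have step : ∑ h ∈ Ioo (-(N : ℤ)) N, ∑ k ∈ Ioo (-(N : ℤ)) N, ∑ l ∈ Ioo (-(N : ℤ)) N,
      D (h.natAbs * k.natAbs * l.natAbs) ≤
      8 * ∑ h ∈ range N, ∑ k ∈ range N, ∑ l ∈ range N, D (h * k * l) := by
    calc _ ≤ 2 * ∑ h ∈ range N, ∑ k ∈ Ioo (-(N : ℤ)) N, ∑ l ∈ Ioo (-(N : ℤ)) N,
          D (h * k.natAbs * l.natAbs) := sum_Ioo_natAbs_le N (fun h => ∑ k ∈ Ioo (-(N : ℤ)) N,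
            ∑ l ∈ Ioo (-(N : ℤ)) N, D (h * k.natAbs * l.natAbs))
            (fun n => sum_nonneg fun _ _ => sum_nonneg fun _ _ => hD0 _)
      _ ≤ 2 * ∑ h ∈ range N, 2 * ∑ k ∈ range N, ∑ l ∈ Ioo (-(N : ℤ)) N, D (h * k * l.natAbs) := by
          gcongr with h _
          exact sum_Ioo_natAbs_le N (fun k => ∑ l ∈ Ioo (-(N : ℤ)) N, D (h * k * l.natAbs))
            (fun n => sum_nonneg fun _ _ => hD0 _)
      _ ≤ 2 * ∑ h ∈ range N, 2 * ∑ k ∈ range N, 2 * ∑ l ∈ range N, D (h * k * l) := by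
          gcongr with h _ k _
          exact sum_Ioo_natAbs_le N (fun l => D (h * k * l)) (fun n => hD0 _)
      _ = _ := by simp only [← mul_sum]; ring
  refine step.trans (mul_le_mul_of_nonneg_left ?_ (by norm_num))
  have hprod : ∑ h ∈ range N, ∑ k ∈ range N, ∑ l ∈ range N, D (h * k * l) =
      ∑ p ∈ range N ×ˢ range N ×ˢ range N, D (p.1 * p.2.1 * p.2.2) := by
    rw [sum_product]; simp only [sum_product]
  rw [hprod, ← sum_fiberwise_of_maps_to (t := range (N ^ 3 + 1))
    (g := fun p : ℕ × ℕ × ℕ => p.1 * p.2.1 * p.2.2)]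
  swap
  · rintro ⟨h, k, l⟩ hp
    simp only [mem_product, mem_range] at hp ⊢
    have : h * k * l ≤ N * N * N := by gcongr <;> omega
    nlinarith
  have hterm : ∀ m ∈ range (N ^ 3 + 1),
      ∑ p ∈ (range N ×ˢ range N ×ˢ range N) with p.1 * p.2.1 * p.2.2 = m,
        D (p.1 * p.2.1 * p.2.2) ≤ (if m = 0 then 3 * (N : ℝ) ^ 3 else 0) + K ^ 2 * D m := by
    intro m hm
    rw [sum_congr rfl (g := fun _ => D m) (fun h hh => by rw [(mem_filter.1 hh).2]), sum_const,
      nsmul_eq_mul]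
    split_ifs with h
    · subst h
      have h1 : (((range N ×ˢ range N ×ˢ range N).filter
          fun p => p.1 * p.2.1 * p.2.2 = 0).card : ℝ) ≤ 3 * N ^ 2 := by
        exact_mod_cast card_filter_triple_mul_eq_zero_le N
      have h2 : D 0 ≤ N := minRecip_le _ _
      have h3 : 0 ≤ K ^ 2 * D 0 := mul_nonneg (sq_nonneg _) (hD0 0)
      have h4 := mul_le_mul h1 h2 (hD0 0) (by positivity)
      linarith
    · rw [zero_add]
      refine mul_le_mul_of_nonneg_right ?_ (hD0 m)
      have h1 := card_filter_triple_mul_eq_le N m h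
      have h2 := hK m h (by simp at hm; omega)
      calc _ ≤ ((m.divisors.card ^ 2 : ℕ) : ℝ) := by exact_mod_cast h1
        _ ≤ _ := by push_cast; gcongr
  refine (sum_le_sum hterm).trans ?_
  rw [sum_add_distrib, ← mul_sum, sum_ite_eq' ]
  simp only [mem_range, Nat.succ_pos, if_true]
  gcongr
  have h24 : ∑ m ∈ range (N ^ 3 + 1), D m = ∑ n ∈ (range (N ^ 3 + 1)).image (fun m : ℕ => 24 * m),
      minRecip N (α * n) := by
    rw [sum_image (by intro x _ y _ h; simpa using h)]
    refine sum_congr rfl fun m _ => ?_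
    simp only [hD]; congr 1; push_cast; ring
  rw [h24]
  apply sum_le_sum_of_subset_of_nonneg
  · intro n hn
    simp only [mem_image, mem_range] at hn ⊢
    obtain ⟨m, hm, rfl⟩ := hn
    omega
  · intro _ _ _; exact minRecip_nonneg _ _

end SmoothWeyl

/-! ### Sums of reciprocal distances and Weyl's inequality. -/

namespace SmoothWeyl
open Finset

lemma nd_ge_min_fract (x : ℝ) : min (Int.fract x) (1 - Int.fract x) ≤ nd x := by
  rw [nd, abs_sub_round_eq_min]

lemma sum_inv_Ico_le (q : ℕ) : ∑ r ∈ Ico 1 q, (1 : ℝ) / r ≤ 1 + Real.log q := by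
  have h := harmonic_le_one_add_log q
  refine le_trans ?_ h
  rw [harmonic_eq_sum_Icc]
  push_cast
  simp only [one_div]
  apply sum_le_sum_of_subset_of_nonneg
  · intro r hr; simp at hr ⊢; omega
  · intros; positivity

lemma sum_range_div_one_add_le (N : ℝ) (hN : 0 ≤ N) (q : ℕ) (hq : 0 < q) :
    ∑ r ∈ range q, N / (1 + N * (r / q)) ≤ N + q * (1 + Real.log q) := by
  rw [range_eq_Ico, sum_eq_sum_Ico_succ_bot hq]
  have h1 : ∑ r ∈ Ico (0 + 1) q, N / (1 + N * (r / q)) ≤ ∑ r ∈ Ico 1 q, q * ((1 : ℝ) / r) := by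
    refine sum_le_sum fun r hr => ?_
    have hr1 : (1 : ℝ) ≤ r := by exact_mod_cast (mem_Ico.1 hr).1
    have hq1 : (0 : ℝ) < q := by exact_mod_cast hq
    rw [mul_one_div, div_le_div_iff₀ (by positivity) (by linarith)]
    have : (q : ℝ) * (1 + N * (r / q)) = q + N * r := by field_simp
    rw [this]; linarith
  rw [← mul_sum] at h1
  have h2 := mul_le_mul_of_nonneg_left (sum_inv_Ico_le q) (Nat.cast_nonneg (α := ℝ) q)
  simp only [Nat.cast_zero, zero_div, mul_zero, add_zero, div_one]
  linarith

/-- At most three among `q` consecutive multiples of `α` have fractional part in a given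
interval `[r / q, (r + 1) / q)`. -/
lemma card_filter_floor_fract_le {α : ℝ} {a : ℤ} {q : ℕ} (hq : 0 < q) (haq : IsCoprime a (q : ℤ))
    (hα : |α - a / q| ≤ 1 / (q : ℝ) ^ 2) (A r : ℕ) :
    ((Ico A (A + q)).filter fun n : ℕ => ⌊q * Int.fract (α * n)⌋₊ = r).card ≤ 3 := by
  classical
  have hq1 : (0 : ℝ) < q := by exact_mod_cast hq
  set F := (Ico A (A + q)).filter fun n : ℕ => ⌊q * Int.fract (α * n)⌋₊ = r with hF
  rcases F.eq_empty_or_nonempty with h | ⟨n₀, hn₀⟩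
  · rw [h]; simp
  have hcard : ({0, 1, -1} : Finset (ZMod q)).card ≤ 3 := card_le_three
  refine le_trans ?_ hcard
  -- Coprimality makes n ↦ a(n - n₀) injective modulo q on q consecutive integers. Two points in the
  -- same cell differ by less than 1/q modulo 1, and replacing α by a/q costs at most another 1/q,
  -- so the residue is 0, 1 or -1.
  apply card_le_card_of_injOn (fun n : ℕ => ((a * ((n : ℤ) - n₀) : ℤ) : ZMod q))
  · intro n hn
    simp only [hF, coe_filter, mem_filter, mem_Ico, Set.mem_ofPred_eq] at hn hn₀
    obtain ⟨⟨hn1, hn2⟩, hn3⟩ := hn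
    obtain ⟨⟨hm1, hm2⟩, hm3⟩ := hn₀
    have f1 := Nat.floor_le (a := q * Int.fract (α * n)) (by positivity)
    have f2 := Nat.lt_floor_add_one (q * Int.fract (α * n))
    have f3 := Nat.floor_le (a := q * Int.fract (α * n₀)) (by positivity)
    have f4 := Nat.lt_floor_add_one (q * Int.fract (α * n₀))
    rw [hn3] at f1 f2; rw [hm3] at f3 f4
    set d : ℝ := (n : ℝ) - n₀ with hd
    have hdq : |d| < q := by
      have e1 : (n : ℝ) < A + q := by exact_mod_cast hn2
      have e2 : (n₀ : ℝ) < A + q := by exact_mod_cast hm2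
      have e3 : (A : ℝ) ≤ n := by exact_mod_cast hn1
      have e4 : (A : ℝ) ≤ n₀ := by exact_mod_cast hm1
      rw [abs_lt]; constructor <;> linarith
    set k : ℤ := ⌊α * n⌋ - ⌊α * n₀⌋ with hk
    have hη : |q * (α * d - k)| < 1 := by
      have e1 : q * (α * d - k) = q * Int.fract (α * n) - q * Int.fract (α * n₀) := by
        rw [Int.fract, Int.fract, hk, hd]; push_cast; ring
      rw [e1, abs_lt]; constructor <;> linarith
    have hθ : |q * ((α - a / q) * d)| ≤ 1 := by
      rw [abs_mul, abs_mul, abs_of_pos hq1]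
      calc q * (|α - a / q| * |d|) ≤ q * (1 / (q : ℝ) ^ 2 * q) := by gcongr
        _ = 1 := by field_simp
    have hint : |((a * ((n : ℤ) - n₀) - k * q : ℤ) : ℝ)| < 2 := by
      have e1 : ((a * ((n : ℤ) - n₀) - k * q : ℤ) : ℝ) =
          q * (α * d - k) - q * ((α - a / q) * d) := by
        push_cast
        rw [← hd]
        field_simp
        ring
      rw [e1]
      refine (abs_sub _ _).trans_lt (by linarith)
    have hint' : |a * ((n : ℤ) - n₀) - k * q| < 2 := by exact_mod_cast hint
    have hmod : ((a * ((n : ℤ) - n₀) : ℤ) : ZMod q) =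
        ((a * ((n : ℤ) - n₀) - k * q : ℤ) : ZMod q) := by push_cast; simp
    beta_reduce
    rw [hmod]
    obtain ⟨h1, h2⟩ := abs_lt.1 hint'
    generalize a * ((n : ℤ) - n₀) - k * q = z at h1 h2
    have : z = 0 ∨ z = 1 ∨ z = -1 := by omega
    rcases this with rfl | rfl | rfl <;> simp
  · intro n hn m hm h
    simp only [hF, coe_filter, mem_Ico, Set.mem_ofPred_eq] at hn hm
    have h1 := (ZMod.intCast_eq_intCast_iff_dvd_sub _ _ _).1 h
    have h2 : (q : ℤ) ∣ a * ((m : ℤ) - n) := by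
      convert h1 using 1; ring
    have h3 : (q : ℤ) ∣ (m : ℤ) - n := haq.symm.dvd_of_dvd_mul_left h2
    have h4 : (m : ℤ) - n = 0 := by
      apply Int.eq_zero_of_abs_lt_dvd h3
      rw [abs_lt]; constructor <;> omega
    omega

lemma sum_minRecip_block_le {α : ℝ} {a : ℤ} {q : ℕ} (hq : 0 < q) (haq : IsCoprime a (q : ℤ))
    (hα : |α - a / q| ≤ 1 / (q : ℝ) ^ 2) (N A : ℕ) :
    ∑ n ∈ Ico A (A + q), minRecip N (α * n) ≤ 6 * (N + q * (1 + Real.log q)) := by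
  have hq1 : (0 : ℝ) < q := by exact_mod_cast hq
  set w : ℕ → ℝ := fun r => N / (1 + N * (r / q)) with hw
  have hw0 : ∀ r, 0 ≤ w r := fun r => by simp only [hw]; positivity
  -- The distance to the nearest integer is at least x or at least 1 - x, with x the fractional
  -- part. Cell r covers the first case, the mirrored cell q-1-r the second.
  set v : ℕ → ℝ := fun r => w r + w (q - 1 - r) with hv
  have hterm : ∀ n ∈ Ico A (A + q),
      minRecip N (α * n) ≤ v ⌊q * Int.fract (α * n)⌋₊ := by
    intro n _
    set x := Int.fract (α * n) with hx
    have hx0 : 0 ≤ x := Int.fract_nonneg _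
    have hx1 : x < 1 := Int.fract_lt_one _
    set r := ⌊q * x⌋₊ with hr
    have f1 : (r : ℝ) ≤ q * x := Nat.floor_le (by positivity)
    have f2 : q * x < r + 1 := Nat.lt_floor_add_one _
    have hrq : r < q := by
      have : (r : ℝ) < q := by nlinarith
      exact_mod_cast this
    have hnd := nd_ge_min_fract (α * n)
    rw [← hx] at hnd
    rcases min_le_iff.1 hnd with h | h
    · have : minRecip N (α * n) ≤ w r := by
        apply div_le_div_of_nonneg_left (by positivity) (by positivity)
        gcongr
        rw [div_le_iff₀ hq1]; nlinarith
      exact this.trans (le_add_of_nonneg_right (hw0 _))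
    · have : minRecip N (α * n) ≤ w (q - 1 - r) := by
        apply div_le_div_of_nonneg_left (by positivity) (by positivity)
        gcongr
        have : ((q - 1 - r : ℕ) : ℝ) = q - 1 - r := by
          rw [Nat.cast_sub (by omega), Nat.cast_sub (by omega)]; simp
        rw [div_le_iff₀ hq1, this]; nlinarith
      exact this.trans (le_add_of_nonneg_left (hw0 _))
  refine (sum_le_sum hterm).trans ?_
  rw [← sum_fiberwise_of_maps_to (t := range q) (g := fun n : ℕ => ⌊q * Int.fract (α * n)⌋₊)]
  swap
  · intro n _
    rw [mem_range, Nat.floor_lt (by positivity)]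
    nlinarith [Int.fract_lt_one (α * n)]
  have h1 : ∀ r ∈ range q, ∑ n ∈ (Ico A (A + q)).filter fun n : ℕ => ⌊q * Int.fract (α * n)⌋₊ = r,
      v ⌊q * Int.fract (α * n)⌋₊ ≤ 3 * v r := by
    intro r _
    rw [sum_congr rfl (g := fun _ => v r) (fun n hn => by rw [(mem_filter.1 hn).2]), sum_const,
      nsmul_eq_mul]
    refine mul_le_mul_of_nonneg_right ?_ (add_nonneg (hw0 _) (hw0 _))
    exact_mod_cast card_filter_floor_fract_le hq haq hα A r
  refine (sum_le_sum h1).trans ?_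
  rw [← mul_sum]
  simp only [hv]
  rw [sum_add_distrib, sum_range_reflect]
  have := sum_range_div_one_add_le N (Nat.cast_nonneg N) q hq
  simp only [hw]
  linarith

lemma sum_minRecip_le {α : ℝ} {a : ℤ} {q : ℕ} (hq : 0 < q) (haq : IsCoprime a (q : ℤ))
    (hα : |α - a / q| ≤ 1 / (q : ℝ) ^ 2) (N M : ℕ) :
    ∑ n ∈ range M, minRecip N (α * n) ≤
      (M / q + 1) * (6 * (N + q * (1 + Real.log q))) := by
  have hq1 : (0 : ℝ) < q := by exact_mod_cast hq
  have hblocks : ∀ k : ℕ, ∑ n ∈ range (k * q), minRecip N (α * n) ≤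
      k * (6 * (N + q * (1 + Real.log q))) := by
    intro k
    induction k with
    | zero => simp
    | succ k ih =>
      rw [range_eq_Ico] at ih ⊢
      rw [← sum_Ico_consecutive _ (Nat.zero_le (k * q)) (Nat.mul_le_mul_right q (Nat.le_succ k))]
      have := sum_minRecip_block_le hq haq hα N (k * q)
      rw [show (k + 1) * q = k * q + q by ring]
      push_cast
      linarith
  have hM : M ≤ (M / q + 1) * q := by
    have := Nat.lt_div_mul_add (a := M) hq
    linarith
  calc ∑ n ∈ range M, minRecip N (α * n) ≤ ∑ n ∈ range ((M / q + 1) * q), minRecip N (α * n) :=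
        sum_le_sum_of_subset_of_nonneg (by simpa using hM) (fun _ _ _ => minRecip_nonneg _ _)
    _ ≤ _ := hblocks _
    _ ≤ _ := by
      have := Real.log_natCast_nonneg q
      push_cast
      gcongr
      exact Nat.cast_div_le

lemma exists_log_le_rpow {ε : ℝ} (hε : 0 < ε) :
    ∃ C : ℝ, 1 ≤ C ∧ ∀ N q : ℕ, 1 ≤ N → 1 ≤ q → (q : ℝ) ≤ 8 * (N : ℝ) ^ 3 →
      1 + Real.log q ≤ C * (N : ℝ) ^ ε := by
  refine ⟨1 + Real.log 8 + 3 / ε, ?_, fun N q hN hq hqN => ?_⟩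
  · have : 0 ≤ Real.log 8 := Real.log_nonneg (by norm_num)
    have : 0 ≤ 3 / ε := by positivity
    linarith
  have hN1 : (1 : ℝ) ≤ N := by exact_mod_cast hN
  have hq1 : (1 : ℝ) ≤ q := by exact_mod_cast hq
  have h1 : Real.log q ≤ Real.log 8 + 3 * Real.log N := by
    calc Real.log q ≤ Real.log (8 * (N : ℝ) ^ 3) := Real.log_le_log (by linarith) hqN
      _ = _ := by rw [Real.log_mul (by norm_num) (by positivity), Real.log_pow]; ring
  have h2 : Real.log N ≤ (N : ℝ) ^ ε / ε := Real.log_le_rpow_div (by linarith) hε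
  have h3 : (1 : ℝ) ≤ (N : ℝ) ^ ε := Real.one_le_rpow hN1 hε.le
  have h4 : 0 ≤ Real.log 8 := Real.log_nonneg (by norm_num)
  have h5 : 3 / ε * (N : ℝ) ^ ε = 3 * ((N : ℝ) ^ ε / ε) := by ring
  nlinarith

/-- **Weyl's inequality** for quartic exponential sums, in the range of the denominator in which
it yields the full saving. -/
theorem exists_weyl_bound {ε : ℝ} (hε : 0 < ε) :
    ∃ C : ℝ, 1 ≤ C ∧ ∀ (N q : ℕ) (a : ℤ) (α θ : ℝ), 1 ≤ N → N ≤ q → (q : ℝ) ≤ 8 * (N : ℝ) ^ 3 →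
      IsCoprime a (q : ℤ) → |α - a / q| ≤ 1 / (q : ℝ) ^ 2 →
      ‖∑ x ∈ Ico 1 (N + 1), e (α * (x : ℝ) ^ 4 + θ * x)‖ ≤ C * (N : ℝ) ^ (7 / 8 + ε) := by
  obtain ⟨C₁, hC₁, hdiv⟩ := exists_card_divisors_le hε
  obtain ⟨C₂, hC₂, hlog⟩ := exists_log_le_rpow hε
  refine ⟨32 * 8 * (3 + C₁ ^ 2 * (360 * C₂)), by
    nlinarith [mul_nonneg (sq_nonneg C₁) (by linarith : 0 ≤ C₂)], ?_⟩
  intro N q a α θ hN hNq hqN haq hα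
  have hN1 : (1 : ℝ) ≤ N := by exact_mod_cast hN
  have hN0 : (0 : ℝ) < N := by linarith
  have hNq1 : (N : ℝ) ≤ q := by exact_mod_cast hNq
  have hq : 0 < q := by omega
  have hq1 : (0 : ℝ) < q := by exact_mod_cast hq
  set X := ‖∑ x ∈ Ico 1 (N + 1), e (α * (x : ℝ) ^ 4 + θ * x)‖ with hX
  have hcast : X = ‖∑ x ∈ Ico (1 : ℤ) (N + 1), e (α * (x : ℝ) ^ 4 + θ * x)‖ := by
    rw [hX]; congr 1
    apply sum_nbij (fun n : ℕ => (n : ℤ))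
    · intro n hn; simp at hn ⊢; omega
    · intro m _ n _ h; simpa using h
    · intro n hn; simp at hn ⊢; exact ⟨n.toNat, by omega, by omega⟩
    · intro n _; simp
  have h1 := norm_quartic_sum_pow_eight_le α θ 1 (N + 1) N (by linarith)
  rw [← hcast] at h1
  set E : ℝ := (N : ℝ) ^ ε with hE
  have hE1 : 1 ≤ E := Real.one_le_rpow hN1 hε.le
  have h2 := sum_minRecip_triple_le N α (C₁ * E ^ 3) (by
    intro m hm hmN
    refine (hdiv m hm).trans ?_
    have h3 : (m : ℝ) ≤ (N : ℝ) ^ 3 := by exact_mod_cast hmN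
    have h4 : E ^ 3 = ((N : ℝ) ^ 3) ^ ε := by
      rw [hE, ← Real.rpow_natCast, ← Real.rpow_mul hN0.le, mul_comm, Real.rpow_mul hN0.le,
        Real.rpow_natCast]
    rw [h4]
    gcongr)
  have h3 := sum_minRecip_le hq haq hα N (24 * N ^ 3 + 1)
  set L := 1 + Real.log q with hL
  have hL1 : 1 ≤ L := by have := Real.log_natCast_nonneg q; linarith
  have hLE : L ≤ C₂ * E := hlog N q hN hq hqN
  -- Both bounds on q enter here: N ≤ q controls N⁴/q, and q ≤ 8N³ controls qL.
  have h4 : (((24 * N ^ 3 + 1 : ℕ) : ℝ) / q + 1) * (6 * (N + q * L)) ≤ 360 * (N : ℝ) ^ 3 * L := by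
    have e0 : ((24 * N ^ 3 + 1 : ℕ) : ℝ) ≤ 25 * (N : ℝ) ^ 3 := by
      push_cast; nlinarith [one_le_pow₀ hN1 (n := 3)]
    have e1 : (((24 * N ^ 3 + 1 : ℕ) : ℝ) / q + 1) * (6 * (N + q * L)) =
        6 * (((24 * N ^ 3 + 1 : ℕ) : ℝ) * (N / q + L) + N + q * L) := by
      field_simp
      ring
    rw [e1]
    have e2 : (N : ℝ) / q ≤ 1 := (div_le_one hq1).2 hNq1
    have e3 : ((24 * N ^ 3 + 1 : ℕ) : ℝ) * (N / q + L) ≤ 25 * (N : ℝ) ^ 3 * (L + L) := by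
      gcongr; linarith
    have e4 : (N : ℝ) ≤ (N : ℝ) ^ 3 * L := by
      have := le_self_pow₀ hN1 (n := 3) (by norm_num)
      nlinarith [pow_pos hN0 3]
    have e5 : q * L ≤ 8 * (N : ℝ) ^ 3 * L := by gcongr
    nlinarith [mul_pos (pow_pos hN0 3) (by linarith : 0 < L)]
  have h5 : X ^ 8 ≤ 32 * 8 * (3 + C₁ ^ 2 * (360 * C₂)) * ((N : ℝ) ^ 7 * E ^ 7) := by
    calc X ^ 8 ≤ 32 * (N : ℝ) ^ 4 * (8 * (3 * (N : ℝ) ^ 3 +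
          (C₁ * E ^ 3) ^ 2 * (360 * (N : ℝ) ^ 3 * (C₂ * E)))) := by
          refine h1.trans ?_
          gcongr
          refine h2.trans ?_
          gcongr
          refine (h3.trans h4).trans ?_
          gcongr
      _ = 32 * 8 * (3 * 1 + C₁ ^ 2 * (360 * C₂) * E ^ 7) * (N : ℝ) ^ 7 := by ring
      _ ≤ 32 * 8 * (3 * E ^ 7 + C₁ ^ 2 * (360 * C₂) * E ^ 7) * (N : ℝ) ^ 7 := by
          gcongr
          exact one_le_pow₀ hE1
      _ = _ := by ring
  set K : ℝ := 32 * 8 * (3 + C₁ ^ 2 * (360 * C₂)) with hK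
  have hK1 : 1 ≤ K := by
    have : 0 ≤ C₁ ^ 2 * (360 * C₂) := by positivity
    rw [hK]; linarith
  have h6 : X ^ 8 ≤ (K * (N : ℝ) ^ (7 / 8 + ε)) ^ 8 := by
    have e1 : ((N : ℝ) ^ (7 / 8 + ε)) ^ 8 = (N : ℝ) ^ 7 * E ^ 8 := by
      rw [hE, ← Real.rpow_natCast, ← Real.rpow_mul hN0.le, ← Real.rpow_natCast _ 8,
        ← Real.rpow_mul hN0.le, ← Real.rpow_natCast _ 7, ← Real.rpow_add hN0]
      congr 1; push_cast; ring
    rw [mul_pow, e1]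
    refine h5.trans ?_
    gcongr
    · exact le_self_pow₀ hK1 (by norm_num)
    · norm_num
  exact le_of_pow_le_pow_left₀ (by norm_num) (by positivity) h6

end SmoothWeyl

/-! ### Counting equal fourth powers and fourth roots of unity modulo prime powers. -/

namespace SmoothWeyl
open Finset

/-- The number of pairs with equal fourth powers in a ring. -/
def numEqFourth (R : Type*) [CommRing R] : ℕ := Nat.card {p : R × R // p.1 ^ 4 = p.2 ^ 4}

/-- The number of fourth roots of unity in a ring. -/
def numFourthRoots (R : Type*) [CommRing R] : ℕ := Nat.card {u : R // u ^ 4 = 1}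

lemma numEqFourth_congr {R S : Type*} [CommRing R] [CommRing S] (f : R ≃+* S) :
    numEqFourth R = numEqFourth S := by
  refine Nat.card_congr ((f.toEquiv.prodCongr f.toEquiv).subtypeEquiv fun p => ?_)
  simp [← map_pow]

lemma numEqFourth_prod (R S : Type*) [CommRing R] [CommRing S] :
    numEqFourth (R × S) = numEqFourth R * numEqFourth S := by
  unfold numEqFourth
  rw [← Nat.card_prod]
  refine Nat.card_congr
    { toFun := fun p => (⟨(p.1.1.1, p.1.2.1), congrArg Prod.fst p.2⟩,
        ⟨(p.1.1.2, p.1.2.2), congrArg Prod.snd p.2⟩)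
      invFun := fun p => ⟨((p.1.1.1, p.2.1.1), (p.1.1.2, p.2.1.2)), Prod.ext p.1.2 p.2.2⟩
      left_inv := fun p => rfl
      right_inv := fun p => rfl }

lemma numFourthRoots_congr {R S : Type*} [CommRing R] [CommRing S] (f : R ≃+* S) :
    numFourthRoots R = numFourthRoots S := by
  refine Nat.card_congr (f.toEquiv.subtypeEquiv fun p => ?_)
  rw [← f.injective.eq_iff, map_pow, map_one]
  rfl

lemma numFourthRoots_prod (R S : Type*) [CommRing R] [CommRing S] :
    numFourthRoots (R × S) = numFourthRoots R * numFourthRoots S := by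
  unfold numFourthRoots
  rw [← Nat.card_prod]
  refine Nat.card_congr
    { toFun := fun p => (⟨p.1.1, congrArg Prod.fst p.2⟩, ⟨p.1.2, congrArg Prod.snd p.2⟩)
      invFun := fun p => ⟨(p.1.1, p.2.1), Prod.ext p.1.2 p.2.2⟩
      left_inv := fun p => rfl
      right_inv := fun p => rfl }

lemma numEqFourth_zmod_mul {m n : ℕ} (h : m.Coprime n) :
    numEqFourth (ZMod (m * n)) = numEqFourth (ZMod m) * numEqFourth (ZMod n) := by
  rw [numEqFourth_congr (ZMod.chineseRemainder h), numEqFourth_prod]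

lemma numFourthRoots_zmod_mul {m n : ℕ} (h : m.Coprime n) :
    numFourthRoots (ZMod (m * n)) = numFourthRoots (ZMod m) * numFourthRoots (ZMod n) := by
  rw [numFourthRoots_congr (ZMod.chineseRemainder h), numFourthRoots_prod]

lemma card_two_mul_eq_zero_le (n : ℕ) [NeZero n] :
    (univ.filter fun w : ZMod n => 2 * w = 0).card ≤ 2 := by
  refine le_trans ?_ (card_le_two (a := 0) (b := n / 2))
  apply card_le_card_of_injOn (fun w : ZMod n => w.val)
  · intro w hw
    simp only [coe_filter, mem_univ, true_and, Set.mem_ofPred_eq] at hw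
    have h1 : ((2 * w.val : ℕ) : ZMod n) = 0 := by push_cast; rw [ZMod.natCast_zmod_val]; exact hw
    rw [ZMod.natCast_eq_zero_iff] at h1
    have h2 := ZMod.val_lt w
    obtain ⟨k, hk⟩ := h1
    have : k < 2 := by
      by_contra h
      have : n * 2 ≤ n * k := Nat.mul_le_mul_left n (by omega)
      omega
    simp only [coe_insert, coe_singleton, Set.mem_insert_iff, Set.mem_singleton_iff]
    interval_cases k <;> omega
  · intro x _ y _ h
    exact ZMod.val_injective n h

/-- In `ℤ/pˡ` two units with the same square agree up to sign and a `2`-torsion element. -/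
lemma two_mul_sub_eq_zero_or {p l : ℕ} (hp : p.Prime) {u v : ZMod (p ^ l)} (hv : IsUnit v)
    (h : u ^ 2 = v ^ 2) : 2 * (u - v) = 0 ∨ 2 * (u + v) = 0 := by
  obtain ⟨U, rfl⟩ := ZMod.intCast_surjective u
  obtain ⟨V, rfl⟩ := ZMod.intCast_surjective v
  have hV : IsCoprime ((p : ℤ) ^ l) V := by
    have := (ZMod.coe_int_isUnit_iff_isCoprime V (p ^ l)).1 hv
    exact_mod_cast this
  have h1 : ((p : ℤ) ^ l) ∣ (U - V) * (U + V) := by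
    have : (((U - V) * (U + V) : ℤ) : ZMod (p ^ l)) = 0 := by
      push_cast; linear_combination h
    have := (ZMod.intCast_zmod_eq_zero_iff_dvd _ _).1 this
    exact_mod_cast this
  -- Up to sign d₁ and d₂ are powers of p with product p^l, dividing U-V and U+V respectively. The
  -- one that divides the other divides both factors, hence 2V, hence 2; so p^l divides twice the
  -- remaining factor. This treats p = 2 together with odd p.
  obtain ⟨d₁, d₂, hd₁, hd₂, hd⟩ := exists_dvd_and_dvd_of_dvd_mul h1
  have hp' : Prime (p : ℤ) := Nat.prime_iff_prime_int.1 hp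
  have key : ∀ {x y z d d' : ℤ}, d ∣ x → d' ∣ y → d ∣ d' → (p : ℤ) ^ l = d * d' → y - x = z →
      (z = 2 * V ∨ z = -(2 * V)) → (p : ℤ) ^ l ∣ 2 * y := by
    intro x y z d d' hx hy hdd hpl hz hz'
    have h2 : d ∣ 2 * V := by
      have : d ∣ z := hz ▸ dvd_sub (hdd.trans hy) hx
      rcases hz' with h | h <;> rw [h] at this
      · exact this
      · exact (dvd_neg).1 this
    have h3 : IsCoprime d V := hV.of_isCoprime_of_dvd_left ⟨d', hpl⟩
    have h4 : d ∣ 2 := h3.dvd_of_dvd_mul_right h2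
    rw [hpl]
    exact mul_dvd_mul h4 hy
  have hdvd : d₁ ∣ d₂ ∨ d₂ ∣ d₁ := by
    obtain ⟨i, _, hi⟩ := (dvd_prime_pow hp' l).1 (⟨d₂, hd⟩ : d₁ ∣ (p : ℤ) ^ l)
    obtain ⟨j, _, hj⟩ := (dvd_prime_pow hp' l).1 (⟨d₁, by rw [hd, mul_comm]⟩ : d₂ ∣ (p : ℤ) ^ l)
    rcases le_total i j with hij | hij
    · left; exact hi.dvd.trans ((pow_dvd_pow _ hij).trans hj.symm.dvd)
    · right; exact hj.dvd.trans ((pow_dvd_pow _ hij).trans hi.symm.dvd)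
  rcases hdvd with hdd | hdd
  · right
    have := key hd₁ hd₂ hdd hd rfl (Or.inl (by ring))
    have := (ZMod.intCast_zmod_eq_zero_iff_dvd (2 * (U + V)) (p ^ l)).2 (by exact_mod_cast this)
    exact_mod_cast this
  · left
    have := key hd₂ hd₁ hdd (by rw [hd, mul_comm]) rfl (Or.inr (by ring))
    have := (ZMod.intCast_zmod_eq_zero_iff_dvd (2 * (U - V)) (p ^ l)).2 (by exact_mod_cast this)
    exact_mod_cast this

lemma card_sq_eq_le {p l : ℕ} [NeZero (p ^ l)] (hp : p.Prime) {c : ZMod (p ^ l)} (hc : IsUnit c) :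
    (univ.filter fun u : ZMod (p ^ l) => u ^ 2 = c).card ≤ 4 := by
  rcases (univ.filter fun u : ZMod (p ^ l) => u ^ 2 = c).eq_empty_or_nonempty with h | ⟨v, hv⟩
  · rw [h]; simp
  rw [mem_filter] at hv
  have hvu : IsUnit v := by
    rw [← hv.2] at hc; exact (isUnit_pow_iff (by norm_num)).1 hc
  set T := univ.filter fun w : ZMod (p ^ l) => 2 * w = 0 with hT
  have hsub : (univ.filter fun u : ZMod (p ^ l) => u ^ 2 = c) ⊆
      T.image (fun w => w + v) ∪ T.image (fun w => w - v) := by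
    intro u hu
    rw [mem_filter, ← hv.2] at hu
    rw [mem_union, mem_image, mem_image]
    rcases two_mul_sub_eq_zero_or hp hvu hu.2 with h | h
    · exact Or.inl ⟨u - v, by simp [hT, h], by ring⟩
    · exact Or.inr ⟨u + v, by simp [hT, h], by ring⟩
  have hT2 : T.card ≤ 2 := card_two_mul_eq_zero_le (p ^ l)
  calc _ ≤ _ := card_le_card hsub
    _ ≤ _ := card_union_le _ _
    _ ≤ T.card + T.card := add_le_add card_image_le card_image_le
    _ ≤ 4 := by omega

lemma card_fourth_eq_le {p l : ℕ} [NeZero (p ^ l)] (hp : p.Prime) {c : ZMod (p ^ l)}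
    (hc : IsUnit c) : (univ.filter fun u : ZMod (p ^ l) => u ^ 4 = c).card ≤ 16 := by
  have h : ∀ u ∈ univ.filter fun u : ZMod (p ^ l) => u ^ 4 = c,
      u ^ 2 ∈ univ.filter fun u : ZMod (p ^ l) => u ^ 2 = c := by
    intro u hu
    simp only [mem_filter, mem_univ, true_and] at hu ⊢
    rw [← hu]; ring
  have := card_le_mul_card_image_of_maps_to h 4 (by
    intro z hz
    simp only [mem_filter, mem_univ, true_and] at hz
    have hz' : IsUnit z := by
      rw [← hz] at hc; exact (isUnit_pow_iff (by norm_num)).1 hc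
    refine le_trans (card_le_card ?_) (card_sq_eq_le hp hz')
    intro u hu
    simp only [mem_filter, mem_univ, true_and] at hu ⊢
    exact hu.2)
  have := card_sq_eq_le hp hc
  omega

lemma numFourthRoots_prime_pow_le {p : ℕ} (hp : p.Prime) (l : ℕ) :
    numFourthRoots (ZMod (p ^ l)) ≤ 16 := by
  have : NeZero (p ^ l) := ⟨(pow_pos hp.pos l).ne'⟩
  rw [numFourthRoots, Nat.card_eq_fintype_card, Fintype.card_subtype]
  exact card_fourth_eq_le hp isUnit_one

lemma isUnit_zmod_prime_pow_iff {p l : ℕ} (hp : p.Prime) (hl : l ≠ 0) (x : ZMod (p ^ l))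
    [NeZero (p ^ l)] : IsUnit x ↔ ¬ p ∣ x.val := by
  conv_lhs => rw [← ZMod.natCast_zmod_val x]
  rw [ZMod.isUnit_iff_coprime, Nat.coprime_pow_right_iff (Nat.pos_of_ne_zero hl), Nat.coprime_comm,
    hp.coprime_iff_not_dvd]

/-- Pairs of nonunits with equal fourth powers. -/
def nonunitPairs (p l : ℕ) [NeZero (p ^ l)] : Finset (ZMod (p ^ l) × ZMod (p ^ l)) :=
  univ.filter fun x => x.1 ^ 4 = x.2 ^ 4 ∧ ¬ IsUnit x.1

/-- If the first coordinate is a unit, the second is one of at most 16 fourth roots of its fourth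
power. -/
lemma numEqFourth_le_add {p l : ℕ} [NeZero (p ^ l)] (hp : p.Prime) :
    numEqFourth (ZMod (p ^ l)) ≤ 16 * p ^ l + (nonunitPairs p l).card := by
  classical
  rw [numEqFourth, Nat.card_eq_fintype_card, Fintype.card_subtype]
  rw [← card_filter_add_card_filter_not (fun x : ZMod (p ^ l) × ZMod (p ^ l) => IsUnit x.1)]
  apply add_le_add
  · have := card_le_mul_card_image_of_maps_to (s := (univ.filter
      fun x : ZMod (p ^ l) × ZMod (p ^ l) => x.1 ^ 4 = x.2 ^ 4).filter fun x => IsUnit x.1)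
      (f := Prod.fst) (t := univ.filter fun x : ZMod (p ^ l) => IsUnit x) (by
        intro x hx; simp only [mem_filter, mem_univ, true_and] at hx ⊢; exact hx.2) 16 (by
        intro c hc
        rw [mem_filter] at hc
        refine le_trans ?_ (card_fourth_eq_le hp (hc.2.pow 4))
        apply card_le_card_of_injOn Prod.snd
        · rintro ⟨x, y⟩ hx
          simp only [coe_filter, mem_filter, mem_univ, true_and, Set.mem_ofPred_eq] at hx ⊢
          rw [← hx.2]; exact hx.1.1.symm
        · rintro ⟨x, y⟩ hx ⟨x', y'⟩ hx' h
          simp only [coe_filter, mem_filter, mem_univ, true_and, Set.mem_ofPred_eq] at hx hx' h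
          rw [Prod.mk.injEq]; exact ⟨hx.2.trans hx'.2.symm, h⟩)
    refine this.trans (Nat.mul_le_mul_left 16 ?_)
    exact (card_le_univ _).trans (by rw [ZMod.card])
  · rw [filter_filter]; rfl

lemma dvd_val_of_mem_nonunitPairs {p l : ℕ} [NeZero (p ^ l)] (hp : p.Prime) (hl : l ≠ 0)
    {x : ZMod (p ^ l) × ZMod (p ^ l)} (hx : x ∈ nonunitPairs p l) :
    p ∣ x.1.val ∧ p ∣ x.2.val := by
  rw [nonunitPairs, mem_filter] at hx
  have h1 := hx.2.2
  have h2 : ¬ IsUnit x.2 := fun h => h1 <| by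
    have := h.pow 4
    rw [← hx.2.1] at this
    exact (isUnit_pow_iff (by norm_num)).1 this
  rw [isUnit_zmod_prime_pow_iff hp hl, not_not] at h1 h2
  exact ⟨h1, h2⟩

lemma val_div_lt {p l : ℕ} [NeZero (p ^ l)] (hp : p.Prime) (hl : l ≠ 0) (x : ZMod (p ^ l)) :
    x.val / p < p ^ (l - 1) := by
  rw [Nat.div_lt_iff_lt_mul hp.pos, ← pow_succ, Nat.sub_add_cancel (Nat.pos_of_ne_zero hl)]
  exact ZMod.val_lt x

/-- Only divisibility of both coordinates by p is used. For l ≤ 4 nothing is lost, since then every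
fourth power of a nonunit vanishes. -/
lemma card_nonunitPairs_le_pow {p l : ℕ} [NeZero (p ^ l)] (hp : p.Prime) (hl : l ≠ 0) :
    (nonunitPairs p l).card ≤ p ^ (2 * l - 2) := by
  have : p ^ (2 * l - 2) = (range (p ^ (l - 1)) ×ˢ range (p ^ (l - 1))).card := by
    rw [card_product, card_range, ← pow_add]; congr 1; omega
  rw [this]
  apply card_le_card_of_injOn (fun x => (x.1.val / p, x.2.val / p))
  · intro x _
    simp only [coe_product, Set.mem_prod, mem_coe, mem_range]
    exact ⟨val_div_lt hp hl _, val_div_lt hp hl _⟩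
  · intro x hx y hy h
    have h1 := dvd_val_of_mem_nonunitPairs hp hl hx
    have h2 := dvd_val_of_mem_nonunitPairs hp hl hy
    simp only [Prod.mk.injEq] at h
    apply Prod.ext <;> apply ZMod.val_injective
    · rw [← Nat.div_mul_cancel h1.1, h.1, Nat.div_mul_cancel h2.1]
    · rw [← Nat.div_mul_cancel h1.2, h.2, Nat.div_mul_cancel h2.2]

/-- Write the coordinates as pa and pb. Cancelling p⁴ gives a⁴ ≡ b⁴ modulo p^l, while a and b range
below p^(l+3), so each residue modulo p^l has p³ lifts. -/
lemma card_nonunitPairs_le_mul {p l : ℕ} [NeZero (p ^ (l + 4))] (hp : p.Prime) :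
    (nonunitPairs p (l + 4)).card ≤ p ^ 6 * numEqFourth (ZMod (p ^ l)) := by
  classical
  have : NeZero (p ^ l) := ⟨(pow_pos hp.pos l).ne'⟩
  have hl : l + 4 ≠ 0 := by omega
  set S : Finset (ZMod (p ^ l) × ZMod (p ^ l)) := univ.filter fun x => x.1 ^ 4 = x.2 ^ 4 with hS
  have : p ^ 6 * numEqFourth (ZMod (p ^ l)) = ((range (p ^ 3) ×ˢ range (p ^ 3)) ×ˢ S).card := by
    rw [numEqFourth, Nat.card_eq_fintype_card, Fintype.card_subtype, card_product, card_product,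
      card_range, ← pow_add]
  rw [this]
  apply card_le_card_of_injOn (fun x => ((x.1.val / p / p ^ l, x.2.val / p / p ^ l),
    (((x.1.val / p : ℕ) : ZMod (p ^ l)), ((x.2.val / p : ℕ) : ZMod (p ^ l)))))
  · intro x hx
    have hd := dvd_val_of_mem_nonunitPairs hp hl hx
    simp only [coe_product, Set.mem_prod, mem_coe, mem_range]
    have hlt : ∀ z : ZMod (p ^ (l + 4)), z.val / p / p ^ l < p ^ 3 := by
      intro z
      rw [Nat.div_lt_iff_lt_mul (pow_pos hp.pos l), ← pow_add]
      refine (val_div_lt hp hl z).trans_le (le_of_eq ?_)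
      congr 1; omega
    refine ⟨⟨hlt _, hlt _⟩, ?_⟩
    rw [hS, mem_filter]
    refine ⟨mem_univ _, ?_⟩
    have h1 : x.1 ^ 4 = x.2 ^ 4 := by
      have := hx
      simp only [nonunitPairs, coe_filter, Set.mem_ofPred_eq] at this
      exact this.2.1
    obtain ⟨a, ha⟩ := hd.1
    obtain ⟨b, hb⟩ := hd.2
    have h2 : (((x.1.val : ℤ) ^ 4 - (x.2.val : ℤ) ^ 4 : ℤ) : ZMod (p ^ (l + 4))) = 0 := by
      push_cast
      rw [ZMod.natCast_zmod_val, ZMod.natCast_zmod_val, h1, sub_self]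
    rw [ZMod.intCast_zmod_eq_zero_iff_dvd, ha, hb] at h2
    have h3 : ((p : ℤ) ^ 4) * (p : ℤ) ^ l ∣ (p : ℤ) ^ 4 * ((a : ℤ) ^ 4 - (b : ℤ) ^ 4) := by
      convert h2 using 1 <;> push_cast <;> ring
    have h4 := (mul_dvd_mul_iff_left (pow_ne_zero 4 (by exact_mod_cast hp.ne_zero))).1 h3
    rw [ha, hb, Nat.mul_div_cancel_left _ hp.pos, Nat.mul_div_cancel_left _ hp.pos]
    have h5 := (ZMod.intCast_zmod_eq_zero_iff_dvd ((a : ℤ) ^ 4 - (b : ℤ) ^ 4) (p ^ l)).2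
      (by exact_mod_cast h4)
    push_cast at h5
    exact sub_eq_zero.1 h5
  · intro x hx y hy h
    have h1 := dvd_val_of_mem_nonunitPairs hp hl hx
    have h2 := dvd_val_of_mem_nonunitPairs hp hl hy
    simp only [Prod.mk.injEq] at h
    have hrec : ∀ m n : ℕ, m / p ^ l = n / p ^ l →
        ((m : ℕ) : ZMod (p ^ l)) = ((n : ℕ) : ZMod (p ^ l)) →
        m = n := by
      intro m n hmn hmod
      rw [ZMod.natCast_eq_natCast_iff'] at hmod
      rw [← Nat.div_add_mod m (p ^ l), ← Nat.div_add_mod n (p ^ l), hmn, hmod]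
    apply Prod.ext <;> apply ZMod.val_injective
    · rw [← Nat.div_mul_cancel h1.1, hrec _ _ h.1.1 h.2.1, Nat.div_mul_cancel h2.1]
    · rw [← Nat.div_mul_cancel h1.2, hrec _ _ h.1.2 h.2.2, Nat.div_mul_cancel h2.2]

/-- The exponent of `p` in the order of magnitude of `numEqFourth (ZMod (p ^ l))`. -/
def eqFourthExp (l : ℕ) : ℕ := 2 * l - 2 * ((l + 3) / 4) + if l % 4 = 1 then 1 else 0

lemma eqFourthExp_add_four (l : ℕ) : eqFourthExp (l + 4) = eqFourthExp l + 6 := by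
  unfold eqFourthExp
  have h1 : (l + 4) % 4 = l % 4 := by omega
  rw [h1]; split_ifs <;> omega

lemma numEqFourth_prime_pow_le {p : ℕ} (hp : p.Prime) (l : ℕ) (hl : l ≠ 0) :
    numEqFourth (ZMod (p ^ l)) ≤ 23 * p ^ eqFourthExp l := by
  -- The extra 6p^l makes the induction close. For l < 5 the total is at most 22p^l + p^(2l-2). In
  -- passing from k to k+4 the new 22p^(k+4) is absorbed by 6p^6·p^k, since p² ≥ 4.
  suffices h : numEqFourth (ZMod (p ^ l)) + 6 * p ^ l ≤ 23 * p ^ eqFourthExp l by omega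
  induction l using Nat.strong_induction_on with
  | _ l ih =>
    have : NeZero (p ^ l) := ⟨(pow_pos hp.pos l).ne'⟩
    have h1 := numEqFourth_le_add (p := p) (l := l) hp
    rcases lt_or_ge l 5 with h5 | h5
    · have h2 := card_nonunitPairs_le_pow hp hl
      have h3 : p ^ (2 * l - 2) ≤ p ^ eqFourthExp l :=
        Nat.pow_le_pow_right hp.pos (by unfold eqFourthExp; interval_cases l <;> simp at *)
      have h4 : p ^ l ≤ p ^ eqFourthExp l :=
        Nat.pow_le_pow_right hp.pos (by unfold eqFourthExp; interval_cases l <;> simp at *)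
      omega
    · obtain ⟨k, rfl⟩ : ∃ k, l = k + 4 := ⟨l - 4, by omega⟩
      have h2 := card_nonunitPairs_le_mul (p := p) (l := k) hp
      have h3 := ih k (by omega) (by omega)
      rw [eqFourthExp_add_four, pow_add p (eqFourthExp k)]
      have h4 : p ^ 6 * (numEqFourth (ZMod (p ^ k)) + 6 * p ^ k) ≤
          p ^ 6 * (23 * p ^ eqFourthExp k) := Nat.mul_le_mul_left _ h3
      have h6 : p ^ (k + 4) * 4 ≤ p ^ 6 * p ^ k := by
        have : 2 ^ 2 ≤ p ^ 2 := Nat.pow_le_pow_left hp.two_le 2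
        calc p ^ (k + 4) * 4 ≤ p ^ (k + 4) * p ^ 2 := Nat.mul_le_mul_left _ this
          _ = _ := by ring
      have h7 : p ^ 6 * (numEqFourth (ZMod (p ^ k)) + 6 * p ^ k) =
          p ^ 6 * numEqFourth (ZMod (p ^ k)) + 6 * (p ^ 6 * p ^ k) := by ring
      have h8 : p ^ 6 * (23 * p ^ eqFourthExp k) = 23 * (p ^ eqFourthExp k * p ^ 6) := by ring
      omega

end SmoothWeyl

/-! ### Complete exponential sums and the singular series. -/

namespace SmoothWeyl
open Finset

/-- The complete quartic exponential sum over `ZMod q`. -/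
def quarticSum (q : ℕ) [NeZero q] (c : ZMod q) : ℂ :=
  ∑ x : ZMod q, ZMod.stdAddChar (c * x ^ 4)

lemma sum_norm_sq_quarticSum (q : ℕ) [NeZero q] :
    ∑ c : ZMod q, ‖quarticSum q c‖ ^ 2 = q * numEqFourth (ZMod q) := by
  have h1 : ((∑ c : ZMod q, ‖quarticSum q c‖ ^ 2 : ℝ) : ℂ) = q * numEqFourth (ZMod q) := by
    push_cast
    have h2 : ∀ c : ZMod q, ((‖quarticSum q c‖ : ℂ)) ^ 2 = ∑ x : ZMod q, ∑ y : ZMod q,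
        ZMod.stdAddChar (c * (x ^ 4 - y ^ 4)) := by
      intro c
      rw [← Complex.mul_conj', quarticSum, map_sum, sum_mul_sum]
      refine sum_congr rfl fun x _ => sum_congr rfl fun y _ => ?_
      rw [← AddChar.map_neg_eq_conj, ← AddChar.map_add_eq_mul]
      congr 1; ring
    simp only [h2]
    rw [sum_comm]
    have h3 : ∀ x : ZMod q, ∑ c : ZMod q, ∑ y : ZMod q,
        (ZMod.stdAddChar (c * (x ^ 4 - y ^ 4)) : ℂ) =
        ∑ y : ZMod q, if x ^ 4 = y ^ 4 then (q : ℂ) else 0 := by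
      intro x
      rw [sum_comm]
      refine sum_congr rfl fun y _ => ?_
      rw [AddChar.sum_mulShift _ (ZMod.isPrimitive_stdAddChar q)]
      simp [sub_eq_zero, ZMod.card]
    simp only [h3]
    rw [← sum_product' (univ : Finset (ZMod q)) (univ : Finset (ZMod q))
      (fun x y => if x ^ 4 = y ^ 4 then (q : ℂ) else 0), ← sum_filter, sum_const, nsmul_eq_mul,
      mul_comm, numEqFourth, Nat.card_eq_fintype_card, Fintype.card_subtype]
    rfl
  exact_mod_cast h1

lemma quarticSum_mul_pow_four (q : ℕ) [NeZero q] (c : ZMod q) (u : (ZMod q)ˣ) :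
    quarticSum q (c * (u : ZMod q) ^ 4) = quarticSum q c := by
  unfold quarticSum
  rw [← Equiv.sum_comp u.mulLeft (fun x => (ZMod.stdAddChar (c * x ^ 4) : ℂ))]
  refine sum_congr rfl fun x _ => ?_
  congr 1
  simp only [Units.mulLeft_apply]; ring

/-- The sum at a depends only on the class of a modulo fourth powers of units. Summing its square
over all a·u⁴ gives φ(q) copies, and each residue c arises from at most `numFourthRoots` units u.
The mean square over all c, which is a solution count, therefore bounds the individual value. -/
lemma norm_sq_quarticSum_mul_totient_le (q : ℕ) [NeZero q] {a : ZMod q} (ha : IsUnit a) :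
    ‖quarticSum q a‖ ^ 2 * q.totient ≤
      q * (numEqFourth (ZMod q) * numFourthRoots (ZMod q)) := by
  classical
  have h1 : ‖quarticSum q a‖ ^ 2 * q.totient =
      ∑ u : (ZMod q)ˣ, ‖quarticSum q (a * (u : ZMod q) ^ 4)‖ ^ 2 := by
    simp only [quarticSum_mul_pow_four, sum_const, card_univ, ZMod.card_units_eq_totient,
      nsmul_eq_mul]
    ring
  rw [h1, ← sum_fiberwise_of_maps_to (t := univ) (g := fun u : (ZMod q)ˣ => a * (u : ZMod q) ^ 4)
    (fun _ _ => mem_univ _)]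
  have h2 : ∀ c ∈ (univ : Finset (ZMod q)),
      ∑ u ∈ univ.filter (fun u : (ZMod q)ˣ => a * (u : ZMod q) ^ 4 = c),
        ‖quarticSum q (a * (u : ZMod q) ^ 4)‖ ^ 2 ≤
        numFourthRoots (ZMod q) * ‖quarticSum q c‖ ^ 2 := by
    intro c _
    rw [sum_congr rfl (g := fun _ => ‖quarticSum q c‖ ^ 2)
      (fun u hu => by rw [(mem_filter.1 hu).2]), sum_const, nsmul_eq_mul]
    refine mul_le_mul_of_nonneg_right ?_ (sq_nonneg _)
    rcases (univ.filter (fun u : (ZMod q)ˣ => a * (u : ZMod q) ^ 4 = c)).eq_empty_or_nonempty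
      with h | ⟨v, hv⟩
    · rw [h]; simp
    rw [numFourthRoots, Nat.card_eq_fintype_card, Fintype.card_subtype]
    norm_cast
    apply card_le_card_of_injOn (fun u => ((u * v⁻¹ : (ZMod q)ˣ) : ZMod q))
    · intro u hu
      simp only [coe_filter, mem_filter, mem_univ, true_and, Set.mem_ofPred_eq] at hu hv ⊢
      rw [← hv] at hu
      have h3 : u ^ 4 = v ^ 4 := by
        apply Units.ext
        push_cast
        exact ha.mul_left_cancel hu
      rw [← Units.val_pow_eq_pow_val, mul_pow, h3, ← mul_pow, mul_inv_cancel, one_pow,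
        Units.val_one]
    · intro u _ w _ h
      exact mul_right_cancel (Units.ext h)
  refine (sum_le_sum h2).trans (le_of_eq ?_)
  rw [← mul_sum, sum_norm_sq_quarticSum]
  ring

/-- An upper bound for the square of `|S(q, a)| / q`. -/
def localBound (q : ℕ) : ℝ :=
  (numEqFourth (ZMod q) * numFourthRoots (ZMod q) : ℝ) / (q * q.totient)

lemma localBound_nonneg (q : ℕ) : 0 ≤ localBound q := by unfold localBound; positivity

lemma localBound_mul {m n : ℕ} (h : m.Coprime n) :
    localBound (m * n) = localBound m * localBound n := by
  unfold localBound
  rw [numEqFourth_zmod_mul h, numFourthRoots_zmod_mul h, Nat.totient_mul h]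
  push_cast
  rw [div_mul_div_comm]
  congr 1 <;> ring

lemma localBound_one : localBound 1 = 1 := by
  have h1 : numEqFourth (ZMod 1) = 1 := by
    rw [numEqFourth, Nat.card_eq_one_iff_unique]
    exact ⟨⟨fun x y => Subsingleton.elim _ _⟩, ⟨⟨(0, 0), rfl⟩⟩⟩
  have h2 : numFourthRoots (ZMod 1) = 1 := by
    rw [numFourthRoots, Nat.card_eq_one_iff_unique]
    exact ⟨⟨fun x y => Subsingleton.elim _ _⟩, ⟨⟨0, Subsingleton.elim _ _⟩⟩⟩
  simp [localBound, h1, h2]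

lemma norm_quarticSum_div_rpow_le {r : ℝ} (hr : 0 ≤ r) (q : ℕ) [NeZero q] {a : ZMod q}
    (ha : IsUnit a) : (‖quarticSum q a‖ / q) ^ r ≤ localBound q ^ (r / 2) := by
  have hq : (0 : ℝ) < q := by exact_mod_cast Nat.pos_of_ne_zero (NeZero.ne q)
  have ht : (0 : ℝ) < q.totient := by
    exact_mod_cast Nat.totient_pos.2 (Nat.pos_of_ne_zero (NeZero.ne q))
  have h1 := norm_sq_quarticSum_mul_totient_le q ha
  have h2 : (‖quarticSum q a‖ / q) ^ 2 ≤ localBound q := by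
    rw [localBound, le_div_iff₀ (by positivity)]
    have : (‖quarticSum q a‖ / q) ^ 2 * (q * q.totient) =
        (‖quarticSum q a‖ ^ 2 * q.totient) / q := by field_simp
    rw [this, div_le_iff₀ hq]
    linarith
  calc (‖quarticSum q a‖ / q) ^ r = ((‖quarticSum q a‖ / q) ^ 2) ^ (r / 2) := by
        rw [← Real.rpow_natCast, ← Real.rpow_mul (by positivity)]
        congr 1; push_cast; ring
    _ ≤ _ := by gcongr

/-- The constant is 736 = 23·16·2, the last factor from p^l ≤ 2φ(p^l). -/
lemma localBound_prime_pow_le {p : ℕ} (hp : p.Prime) {l : ℕ} (hl : l ≠ 0) :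
    localBound (p ^ l) ≤ 736 * ((p : ℝ) ^ eqFourthExp l / (p : ℝ) ^ (2 * l)) := by
  have h1 : (numEqFourth (ZMod (p ^ l)) : ℝ) ≤ 23 * (p : ℝ) ^ eqFourthExp l := by
    exact_mod_cast numEqFourth_prime_pow_le hp l hl
  have h2 : (numFourthRoots (ZMod (p ^ l)) : ℝ) ≤ 16 := by
    exact_mod_cast numFourthRoots_prime_pow_le hp l
  have hp0 : (0 : ℝ) < p := by exact_mod_cast hp.pos
  have h3 : (p : ℝ) ^ l ≤ 2 * ((p ^ l).totient : ℝ) := by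
    rw [Nat.totient_prime_pow hp (Nat.pos_of_ne_zero hl)]
    obtain ⟨k, rfl⟩ := Nat.exists_eq_succ_of_ne_zero hl
    have : p ^ (k + 1) ≤ 2 * (p ^ k * (p - 1)) := by
      have := hp.two_le
      calc p ^ (k + 1) = p ^ k * p := pow_succ _ _
        _ ≤ p ^ k * (2 * (p - 1)) := Nat.mul_le_mul_left _ (by omega)
        _ = _ := by ring
    exact_mod_cast this
  have hpl : (0 : ℝ) < (p : ℝ) ^ l := by positivity
  rw [localBound, mul_div_assoc', div_le_div_iff₀ (by push_cast; nlinarith) (by positivity)]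
  push_cast
  have h4 : (numEqFourth (ZMod (p ^ l)) : ℝ) * numFourthRoots (ZMod (p ^ l)) ≤
      23 * (p : ℝ) ^ eqFourthExp l * 16 := by gcongr
  calc (numEqFourth (ZMod (p ^ l)) : ℝ) * numFourthRoots (ZMod (p ^ l)) * (p : ℝ) ^ (2 * l) ≤
        23 * (p : ℝ) ^ eqFourthExp l * 16 * (p : ℝ) ^ (2 * l) := by gcongr
    _ = 23 * (p : ℝ) ^ eqFourthExp l * 16 * ((p : ℝ) ^ l * (p : ℝ) ^ l) := by ring
    _ ≤ 23 * (p : ℝ) ^ eqFourthExp l * 16 * ((p : ℝ) ^ l * (2 * ((p ^ l).totient : ℝ))) := by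
        gcongr
    _ = _ := by ring

/-- The contribution of the denominator `q` to the majorant of the singular series. -/
def seriesTerm (r : ℝ) (q : ℕ) : ℝ := q * localBound q ^ (r / 2)

lemma seriesTerm_nonneg (r : ℝ) (q : ℕ) : 0 ≤ seriesTerm r q :=
  mul_nonneg (Nat.cast_nonneg _) (Real.rpow_nonneg (localBound_nonneg q) _)

lemma seriesTerm_mul (r : ℝ) {m n : ℕ} (h : m.Coprime n) :
    seriesTerm r (m * n) = seriesTerm r m * seriesTerm r n := by
  unfold seriesTerm
  rw [localBound_mul h, Real.mul_rpow (localBound_nonneg m) (localBound_nonneg n)]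
  push_cast; ring

lemma seriesTerm_one (r : ℝ) : seriesTerm r 1 = 1 := by
  simp [seriesTerm, localBound_one]

/-- Put c + 1 = ⌈l/4⌉. The exponent of p is -c(r-4) - (r/2-1) when l = 4c+1, and at most -(c+1)(r-4)
otherwise. In both cases it is at most -κ(c+1), and r > 5 gives κ > 1, as convergence over primes
requires. -/
lemma seriesTerm_prime_pow_le {r : ℝ} (hr : 5 < r) {p : ℕ} (hp : p.Prime) {l : ℕ} (hl : l ≠ 0) :
    seriesTerm r (p ^ l) ≤
      4 * 736 ^ (r / 2) * (p : ℝ) ^ (-min (r - 4) (r / 2 - 1)) * (7 / 8 : ℝ) ^ l := by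
  set κ := min (r - 4) (r / 2 - 1) with hκ
  have hκ1 : 1 ≤ κ := le_min (by linarith) (by linarith)
  have hκa : κ ≤ r - 4 := min_le_left _ _
  have hκb : κ ≤ r / 2 - 1 := min_le_right _ _
  have hp2 : (2 : ℝ) ≤ p := by exact_mod_cast hp.two_le
  have hp0 : (0 : ℝ) < p := by linarith
  obtain ⟨c, hc, hlc⟩ : ∃ c : ℕ, (l + 3) / 4 = c + 1 ∧ l ≤ 4 * (c + 1) :=
    ⟨(l + 3) / 4 - 1, by omega, by omega⟩
  have h1 : seriesTerm r (p ^ l) ≤ 736 ^ (r / 2) * (p : ℝ) ^ (-(κ * (c + 1))) := by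
    have h2 : localBound (p ^ l) ^ (r / 2) ≤
        736 ^ (r / 2) * (p : ℝ) ^ (((eqFourthExp l : ℝ) - 2 * l) * (r / 2)) := by
      calc localBound (p ^ l) ^ (r / 2) ≤
          (736 * ((p : ℝ) ^ eqFourthExp l / (p : ℝ) ^ (2 * l))) ^ (r / 2) := by
            have := localBound_nonneg (p ^ l)
            gcongr
            exact localBound_prime_pow_le hp hl
        _ = _ := by
            rw [Real.mul_rpow (by norm_num) (by positivity), Real.rpow_mul hp0.le,
              Real.rpow_sub hp0, Real.rpow_natCast]
            rw [show (2 * (l : ℝ)) = ((2 * l : ℕ) : ℝ) by push_cast; rfl, Real.rpow_natCast]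
    calc seriesTerm r (p ^ l) ≤ (p : ℝ) ^ (l : ℝ) *
          (736 ^ (r / 2) * (p : ℝ) ^ (((eqFourthExp l : ℝ) - 2 * l) * (r / 2))) := by
          unfold seriesTerm
          push_cast
          rw [Real.rpow_natCast]
          gcongr
      _ = 736 ^ (r / 2) * (p : ℝ) ^ (l + ((eqFourthExp l : ℝ) - 2 * l) * (r / 2)) := by
          rw [Real.rpow_add hp0]; ring
      _ ≤ _ := by
          gcongr
          · linarith
          have hcr : (0 : ℝ) ≤ c := Nat.cast_nonneg c
          by_cases h4 : l % 4 = 1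
          · have hl4 : l = 4 * c + 1 := by omega
            have hE : (eqFourthExp l : ℝ) = 2 * l - 2 * (c + 1) + 1 := by
              have : eqFourthExp l + 2 * (c + 1) = 2 * l + 1 := by
                unfold eqFourthExp; rw [if_pos h4, hc]; omega
              have : (eqFourthExp l : ℝ) + 2 * (c + 1) = 2 * l + 1 := by exact_mod_cast this
              linarith
            have hl' : (l : ℝ) = 4 * c + 1 := by exact_mod_cast hl4
            rw [hE, hl']
            nlinarith
          · have hE : (eqFourthExp l : ℝ) = 2 * l - 2 * (c + 1) := by
              have : eqFourthExp l + 2 * (c + 1) = 2 * l := by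
                unfold eqFourthExp; rw [if_neg h4, hc]; omega
              have : (eqFourthExp l : ℝ) + 2 * (c + 1) = 2 * l := by exact_mod_cast this
              linarith
            have hl' : (l : ℝ) ≤ 4 * (c + 1) := by exact_mod_cast hlc
            rw [hE]
            nlinarith
  refine h1.trans ?_
  have h5 : (p : ℝ) ^ (-(κ * (c + 1))) = (p : ℝ) ^ (-κ) * ((p : ℝ) ^ (-κ)) ^ c := by
    rw [← Real.rpow_natCast, ← Real.rpow_mul hp0.le, ← Real.rpow_add hp0]
    congr 1; ring
  have h6 : (p : ℝ) ^ (-κ) ≤ 1 / 2 := by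
    calc (p : ℝ) ^ (-κ) ≤ (p : ℝ) ^ (-1 : ℝ) := by gcongr; linarith
      _ = 1 / p := by rw [Real.rpow_neg_one, one_div]
      _ ≤ 1 / 2 := by gcongr
  -- The ratio 7/8 is chosen so that (7/8)⁴ ≥ 1/2, turning decay in ⌈l/4⌉ into geometric decay in l.
  have h7 : ((p : ℝ) ^ (-κ)) ^ c ≤ 2 * (7 / 8 : ℝ) ^ l := by
    calc ((p : ℝ) ^ (-κ)) ^ c ≤ (1 / 2 : ℝ) ^ c := by gcongr
      _ = 2 * (1 / 2 : ℝ) ^ (c + 1) := by rw [pow_succ]; ring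
      _ ≤ 2 * ((7 / 8 : ℝ) ^ 4) ^ (c + 1) := by gcongr; norm_num
      _ = 2 * (7 / 8 : ℝ) ^ (4 * (c + 1)) := by rw [← pow_mul]
      _ ≤ _ := by
        gcongr 2 * ?_
        exact pow_le_pow_of_le_one (by norm_num) (by norm_num) hlc
  rw [h5]
  calc _ ≤ 736 ^ (r / 2) * ((p : ℝ) ^ (-κ) * (2 * (7 / 8 : ℝ) ^ l)) := by gcongr
    _ ≤ 2 * (736 ^ (r / 2) * ((p : ℝ) ^ (-κ) * (2 * (7 / 8 : ℝ) ^ l))) :=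
        le_mul_of_one_le_left (by positivity) (by norm_num)
    _ = _ := by ring

/-- The majorant of the singular series converges. -/
lemma exists_sum_seriesTerm_le {r : ℝ} (hr : 5 < r) :
    ∃ C : ℝ, ∀ Q : ℕ, ∑ q ∈ Icc 1 Q, seriesTerm r q ≤ C := by
  set κ := min (r - 4) (r / 2 - 1) with hκ
  have hκ1 : 1 < κ := lt_min (by linarith) (by linarith)
  set K : ℝ := 4 * 736 ^ (r / 2) with hK
  have hK0 : 0 < K := by positivity
  have hgeom : Summable fun l : ℕ => (7 / 8 : ℝ) ^ l :=
    summable_geometric_of_lt_one (by norm_num) (by norm_num)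
  have hps : Summable fun n : ℕ => (n : ℝ) ^ (-κ) := Real.summable_nat_rpow.2 (by linarith)
  have hloc : ∀ {p : ℕ}, p.Prime → Summable (fun l => ‖seriesTerm r (p ^ l)‖) := by
    intro p hp
    rw [← summable_nat_add_iff 1]
    refine Summable.of_nonneg_of_le (fun _ => norm_nonneg _) (fun l => ?_)
      (((summable_nat_add_iff 1).2 hgeom).mul_left (K * (p : ℝ) ^ (-κ)))
    rw [Real.norm_of_nonneg (seriesTerm_nonneg _ _)]
    exact seriesTerm_prime_pow_le hr hp (Nat.succ_ne_zero l)
  have hlocsum : ∀ p : ℕ, p.Prime →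
      ∑' l, seriesTerm r (p ^ l) ≤ Real.exp (K * 8 * (p : ℝ) ^ (-κ)) := by
    intro p hp
    have hs : Summable fun l => seriesTerm r (p ^ l) := (hloc hp).of_norm
    rw [hs.tsum_eq_zero_add, pow_zero, seriesTerm_one]
    have h1 : ∑' l, seriesTerm r (p ^ (l + 1)) ≤
        ∑' l : ℕ, K * (p : ℝ) ^ (-κ) * (7 / 8 : ℝ) ^ l := by
      refine ((summable_nat_add_iff 1).2 hs).tsum_le_tsum (fun l => ?_) (hgeom.mul_left _)
      refine (seriesTerm_prime_pow_le hr hp (Nat.succ_ne_zero l)).trans ?_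
      refine mul_le_mul_of_nonneg_left ?_ (by positivity)
      exact pow_le_pow_of_le_one (by norm_num) (by norm_num) (Nat.le_succ l)
    rw [tsum_mul_left, tsum_geometric_of_lt_one (by norm_num) (by norm_num)] at h1
    have h2 := Real.add_one_le_exp (K * 8 * (p : ℝ) ^ (-κ))
    norm_num at h1
    linarith
  refine ⟨Real.exp (K * 8 * ∑' n : ℕ, (n : ℝ) ^ (-κ)), fun Q => ?_⟩
  -- All q ≤ Q are composed of primes up to Q, so the partial sum is at most a finite Euler product,
  -- each factor of which is at most exp(8K p^(-κ)).
  obtain ⟨hs1, hs2⟩ := EulerProduct.summable_and_hasSum_factoredNumbers_prod_filter_prime_tsum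
    (seriesTerm_one r) (seriesTerm_mul r) hloc (range (Q + 1))
  have hmem : ∀ q ∈ Icc 1 Q, q ∈ Nat.factoredNumbers (range (Q + 1)) := by
    intro q hq
    rw [mem_Icc] at hq
    refine Nat.mem_factoredNumbers_of_primeFactors_subset (by omega) fun p hp => ?_
    rw [mem_range]
    have := Nat.le_of_mem_primeFactors hp
    omega
  classical
  calc ∑ q ∈ Icc 1 Q, seriesTerm r q =
        ∑ q ∈ (Icc 1 Q).subtype (· ∈ Nat.factoredNumbers (range (Q + 1))), seriesTerm r q :=
        (sum_subtype_of_mem _ hmem).symm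
    _ ≤ ∏ p ∈ range (Q + 1) with p.Prime, ∑' n : ℕ, seriesTerm r (p ^ n) :=
        sum_le_hasSum _ (fun _ _ => seriesTerm_nonneg _ _) hs2
    _ ≤ ∏ p ∈ range (Q + 1) with p.Prime, Real.exp (K * 8 * (p : ℝ) ^ (-κ)) :=
        prod_le_prod (fun _ _ => tsum_nonneg fun _ => seriesTerm_nonneg _ _)
          fun p hp => hlocsum p (mem_filter.1 hp).2
    _ = Real.exp (K * 8 * ∑ p ∈ range (Q + 1) with p.Prime, (p : ℝ) ^ (-κ)) := by
        rw [← Real.exp_sum, mul_sum]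
    _ ≤ _ := by
        gcongr
        exact hps.sum_le_tsum _ fun _ _ => by positivity

end SmoothWeyl

/-! ### Weyl sums near zero and completion modulo q. -/

namespace SmoothWeyl
open Finset MeasureTheory

/-- The complete quartic Weyl sum over `[1, N]`. -/
def weylSum (N : ℕ) (γ : ℝ) : ℂ := ∑ x ∈ Ico 1 (N + 1), e (γ * (x : ℝ) ^ 4)

lemma norm_sum_e_neg {ι : Type*} (s : Finset ι) (φ : ι → ℝ) :
    ‖∑ x ∈ s, e (-φ x)‖ = ‖∑ x ∈ s, e (φ x)‖ := by
  rw [← RCLike.norm_conj, map_sum]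
  congr 1
  exact sum_congr rfl fun x _ => by rw [conj_e, neg_neg]

lemma norm_sum_e_le_card {ι : Type*} (s : Finset ι) (φ : ι → ℝ) :
    ‖∑ x ∈ s, e (φ x)‖ ≤ s.card := by
  refine (norm_sum_le _ _).trans ?_
  simp

lemma four_mul_pow_three_le {x : ℝ} (hx : 0 ≤ x) : 4 * x ^ 3 ≤ (x + 1) ^ 4 - x ^ 4 := by
  nlinarith [pow_nonneg hx 2, pow_nonneg hx 3]

lemma sub_le_four_mul_pow_three {x : ℝ} (hx : 0 ≤ x) : (x + 1) ^ 4 - x ^ 4 ≤ 4 * (x + 1) ^ 3 := by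
  nlinarith [pow_nonneg hx 2, pow_nonneg hx 3]

lemma diff_pow_four_mono {x : ℝ} (hx : 0 ≤ x) :
    (x + 1) ^ 4 - x ^ 4 ≤ (x + 2) ^ 4 - (x + 1) ^ 4 := by
  nlinarith [pow_nonneg hx 2, pow_nonneg hx 3]

/-- If N⁴β ≤ 1 the trivial bound suffices. Otherwise the sum is cut near t = β^(-1/4): the shorter
part is trivially at most t, and beyond it the phase differences are at least 4βt³ = 4/t, so
Kusmin–Landau gives O(t) again. The bound on β keeps these differences at most 1/2. -/
lemma norm_weylSum_near_zero_of_pos {N : ℕ} (hN : 1 ≤ N) {β : ℝ} (hβ0 : 0 < β)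
    (hβ : β ≤ 1 / (8 * (N : ℝ) ^ 3)) :
    ‖weylSum N β‖ ≤ 6 * N * (1 + (N : ℝ) ^ 4 * β) ^ (-(1 / 4) : ℝ) := by
  have hN1 : (1 : ℝ) ≤ N := by exact_mod_cast hN
  set y : ℝ := (1 + (N : ℝ) ^ 4 * β) ^ (1 / 4 : ℝ) with hy
  have hz : 0 < 1 + (N : ℝ) ^ 4 * β := by positivity
  have hy0 : 0 < y := by positivity
  have hy4 : y ^ 4 = 1 + (N : ℝ) ^ 4 * β := by
    rw [hy, ← Real.rpow_natCast, ← Real.rpow_mul hz.le]; norm_num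
  rw [Real.rpow_neg hz.le, ← hy, ← div_eq_mul_inv]
  have hcard : ‖weylSum N β‖ ≤ N := by
    refine (norm_sum_e_le_card _ _).trans ?_
    simp
  rcases le_or_gt ((N : ℝ) ^ 4 * β) 1 with h1 | h1
  · have hy2 : y ≤ 2 := by
      refine le_of_pow_le_pow_left₀ (n := 4) (by norm_num) (by norm_num) ?_
      rw [hy4]; linarith
    rw [le_div_iff₀ hy0]
    nlinarith
  set t : ℝ := β ^ (-(1 / 4) : ℝ) with ht
  have ht0 : 0 < t := by positivity
  have ht4 : t ^ 4 * β = 1 := by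
    rw [ht, ← Real.rpow_natCast, ← Real.rpow_mul hβ0.le]
    norm_num
    rw [Real.rpow_neg_one]; field_simp
  have hN3 : 1 ≤ (N : ℝ) ^ 3 := one_le_pow₀ hN1
  have hβN : β * (8 * (N : ℝ) ^ 3) ≤ 1 := by rwa [le_div_iff₀ (by positivity)] at hβ
  have ht1 : 1 ≤ t := by
    by_contra h
    have : t ^ 4 < 1 := pow_lt_one₀ ht0.le (not_le.1 h) (by norm_num)
    nlinarith
  have htN : t < N := by
    refine lt_of_pow_lt_pow_left₀ 4 (by positivity) ?_
    nlinarith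
  have hyt : y * t ≤ 2 * N := by
    refine le_of_pow_le_pow_left₀ (n := 4) (by norm_num) (by positivity) ?_
    have : (y * t) ^ 4 = t ^ 4 + (N : ℝ) ^ 4 * (t ^ 4 * β) := by rw [mul_pow, hy4]; ring
    rw [this, ht4, mul_pow]
    have : t ^ 4 ≤ (N : ℝ) ^ 4 := by gcongr
    nlinarith
  set X := ⌈t⌉₊ with hX
  have hX1 : 1 ≤ X := Nat.one_le_ceil_iff.2 ht0
  have hXN : X ≤ N := Nat.ceil_le.2 htN.le
  have hXt : t ≤ X := Nat.le_ceil t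
  have hXt2 : (X : ℝ) < t + 1 := Nat.ceil_lt_add_one ht0.le
  have hsplit : weylSum N β = (∑ x ∈ Ico 1 X, e (β * (x : ℝ) ^ 4)) +
      (∑ n ∈ range (N - X), e (β * ((n : ℝ) + X) ^ 4)) + e (β * (N : ℝ) ^ 4) := by
    rw [weylSum, sum_Ico_succ_top hN, ← sum_Ico_consecutive _ hX1 hXN,
      sum_Ico_eq_sum_range _ X N]
    congr 3
    funext n; push_cast; ring_nf
  have hmid : ‖∑ n ∈ range (N - X), e (β * ((n : ℝ) + X) ^ 4)‖ ≤ 1 / (4 * β * (X : ℝ) ^ 3) := by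
    have hX3 : (0 : ℝ) < X := by positivity
    apply norm_sum_e_le_of_monotone (φ := fun n : ℕ => β * ((n : ℝ) + X) ^ 4) (by positivity)
    · intro n _
      have := mul_le_mul_of_nonneg_left
        (diff_pow_four_mono (x := (n : ℝ) + X) (by positivity)) hβ0.le
      push_cast
      have e1 : ((n : ℝ) + 1 + X) = n + X + 1 := by ring
      have e2 : ((n : ℝ) + 2 + X) = n + X + 2 := by ring
      rw [e1, e2]; linarith
    · intro n _
      have h3 := four_mul_pow_three_le (x := (n : ℝ) + X) (by positivity)
      have h4 : (X : ℝ) ^ 3 ≤ ((n : ℝ) + X) ^ 3 := by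
        gcongr; linarith [Nat.cast_nonneg (α := ℝ) n]
      have e1 : (((n + 1 : ℕ) : ℝ) + X) = n + X + 1 := by push_cast; ring
      rw [e1]
      nlinarith
    · intro n hn
      have h3 := sub_le_four_mul_pow_three (x := (n : ℝ) + X) (by positivity)
      have h5 : (n : ℝ) + X + 1 ≤ N := by
        have : n + X + 1 ≤ N := by omega
        exact_mod_cast this
      have h4 : ((n : ℝ) + X + 1) ^ 3 ≤ (N : ℝ) ^ 3 := by gcongr
      have h6 : (X : ℝ) ^ 3 ≤ (N : ℝ) ^ 3 := by gcongr
      have e1 : (((n + 1 : ℕ) : ℝ) + X) = n + X + 1 := by push_cast; ring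
      rw [e1]
      nlinarith
  have hmid2 : 1 / (4 * β * (X : ℝ) ^ 3) ≤ t := by
    rw [div_le_iff₀ (by positivity)]
    have : t ^ 3 ≤ (X : ℝ) ^ 3 := by gcongr
    have h7 : t * (4 * β * t ^ 3) = 4 := by linear_combination 4 * ht4
    have : t * (4 * β * t ^ 3) ≤ t * (4 * β * (X : ℝ) ^ 3) := by gcongr
    linarith
  have hfirst : ‖∑ x ∈ Ico 1 X, e (β * (x : ℝ) ^ 4)‖ ≤ t := by
    refine (norm_sum_e_le_card _ _).trans ?_
    rw [Nat.card_Ico, Nat.cast_sub hX1]; push_cast; linarith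
  have htot : ‖weylSum N β‖ ≤ 3 * t := by
    rw [hsplit]
    refine (norm_add₃_le).trans ?_
    rw [norm_e]; linarith
  rw [le_div_iff₀ hy0]
  nlinarith

lemma norm_weylSum_near_zero {N : ℕ} (hN : 1 ≤ N) {β : ℝ} (hβ : |β| ≤ 1 / (8 * (N : ℝ) ^ 3)) :
    ‖weylSum N β‖ ≤ 6 * N * (1 + (N : ℝ) ^ 4 * |β|) ^ (-(1 / 4) : ℝ) := by
  rcases lt_trichotomy β 0 with h | h | h
  · have h1 := norm_weylSum_near_zero_of_pos hN (neg_pos.2 h) (by rwa [abs_of_neg h] at hβ)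
    rw [abs_of_neg h]
    refine le_trans (le_of_eq ?_) h1
    rw [weylSum, weylSum, ← norm_sum_e_neg]
    simp only [neg_mul]
  · subst h
    refine (norm_sum_e_le_card _ _).trans ?_
    simp
    linarith [Nat.cast_nonneg (α := ℝ) N]
  · have := norm_weylSum_near_zero_of_pos hN h (by rwa [abs_of_pos h] at hβ)
    rwa [abs_of_pos h]

/-- The quartic part moves each phase difference by at most 1/(2q), half the least distance of b/q
from the integers. The differences therefore stay at least min(b, q-b)/(2q) away from integers, and
Kusmin–Landau applies to the negated phase. -/
lemma norm_sum_twisted_le {N q b : ℕ} (hN : 1 ≤ N) (hb : 1 ≤ b) (hbq : b < q) {β : ℝ}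
    (hβ : |β| ≤ 1 / (8 * q * (N : ℝ) ^ 3)) :
    ‖∑ x ∈ Ico 1 (N + 1), e (β * (x : ℝ) ^ 4 - b / q * x)‖ ≤
      3 * q * (1 / (b : ℝ) + 1 / ((q - b : ℕ) : ℝ)) := by
  have hN1 : (1 : ℝ) ≤ N := by exact_mod_cast hN
  have hb1 : (1 : ℝ) ≤ b := by exact_mod_cast hb
  have hqb : (b : ℝ) + 1 ≤ q := by exact_mod_cast hbq
  have hq0 : (0 : ℝ) < q := by linarith
  have hsub : ((q - b : ℕ) : ℝ) = q - b := Nat.cast_sub hbq.le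
  rw [hsub]
  have hqb0 : (0 : ℝ) < q - b := by linarith
  set θ : ℝ := min (b : ℝ) (q - b) / (2 * q) with hθ
  have hθ0 : 0 < θ := by
    have : 0 < min (b : ℝ) (q - b) := lt_min (by linarith) hqb0
    positivity
  have hsplit : ∑ x ∈ Ico 1 (N + 1), e (β * (x : ℝ) ^ 4 - b / q * x) =
      (∑ n ∈ range (N - 1), e (-(b / q * ((n : ℝ) + 1) - β * ((n : ℝ) + 1) ^ 4))) +
        e (β * (N : ℝ) ^ 4 - b / q * N) := by
    rw [sum_Ico_succ_top hN, sum_Ico_eq_sum_range]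
    congr 2
    funext n; push_cast; ring_nf
  set φ : ℕ → ℝ := fun n => b / q * ((n : ℝ) + 1) - β * ((n : ℝ) + 1) ^ 4 with hφ
  have hδ : ∀ n, φ (n + 1) - φ n = b / q - β * (((n : ℝ) + 1 + 1) ^ 4 - ((n : ℝ) + 1) ^ 4) := by
    intro n; simp only [hφ]; push_cast; ring
  have hsmall : ∀ n < N - 1,
      |β * (((n : ℝ) + 1 + 1) ^ 4 - ((n : ℝ) + 1) ^ 4)| ≤ 1 / (2 * (q : ℝ)) := by
    intro n hn
    have h1 := sub_le_four_mul_pow_three (x := (n : ℝ) + 1) (by positivity)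
    have h2 := four_mul_pow_three_le (x := (n : ℝ) + 1) (by positivity)
    have h0 : 0 ≤ ((n : ℝ) + 1 + 1) ^ 4 - ((n : ℝ) + 1) ^ 4 := le_trans (by positivity) h2
    have h5 : (n : ℝ) + 1 + 1 ≤ N := by
      have : n + 1 + 1 ≤ N := by omega
      exact_mod_cast this
    have h4 : ((n : ℝ) + 1 + 1) ^ 3 ≤ (N : ℝ) ^ 3 := by gcongr
    rw [abs_mul, abs_of_nonneg h0]
    calc |β| * (((n : ℝ) + 1 + 1) ^ 4 - ((n : ℝ) + 1) ^ 4) ≤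
          1 / (8 * q * (N : ℝ) ^ 3) * (4 * (N : ℝ) ^ 3) := by gcongr; linarith
      _ = 1 / (2 * (q : ℝ)) := by field_simp; norm_num
  have h1 : ∀ n < N - 1, θ ≤ φ (n + 1) - φ n := by
    intro n hn
    rw [hδ]
    have h2 := (abs_le.1 (hsmall n hn)).2
    have h3 : θ ≤ b / q - 1 / (2 * q) := by
      rw [hθ, div_sub_div _ _ hq0.ne' (by positivity),
        div_le_div_iff₀ (by positivity) (by positivity)]
      have : min (b : ℝ) (q - b) ≤ b := min_le_left _ _
      have h4 : min (b : ℝ) (q - b) * (2 * q) ≤ b * (2 * q) := by gcongr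
      nlinarith [mul_pos hq0 hq0]
    linarith
  have h2 : ∀ n < N - 1, φ (n + 1) - φ n ≤ 1 - θ := by
    intro n hn
    rw [hδ]
    have h2 := (abs_le.1 (hsmall n hn)).1
    have h3 : θ ≤ 1 - b / q - 1 / (2 * q) := by
      have e1 : 1 - (b : ℝ) / q - 1 / (2 * q) = (2 * (q - b) - 1) / (2 * q) := by field_simp
      rw [hθ, e1]
      have : min (b : ℝ) (q - b) ≤ q - b := min_le_right _ _
      gcongr; linarith
    linarith
  have hKL : ‖∑ n ∈ range (N - 1), e (φ n)‖ ≤ 1 / θ := by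
    rcases le_total 0 β with h | h
    · refine norm_sum_e_le_of_antitone hθ0 (fun n _ => ?_) h1 h2
      have h3 := mul_le_mul_of_nonneg_left
        (diff_pow_four_mono (x := (n : ℝ) + 1) (by positivity)) h
      rw [show n + 2 = (n + 1) + 1 by ring, hδ, hδ]
      push_cast
      rw [show (n : ℝ) + 1 + 1 + 1 = n + 1 + 2 by ring]
      linarith
    · refine norm_sum_e_le_of_monotone hθ0 (fun n _ => ?_) h1 h2
      have h3 := mul_le_mul_of_nonpos_left
        (diff_pow_four_mono (x := (n : ℝ) + 1) (by positivity)) h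
      rw [show n + 2 = (n + 1) + 1 by ring, hδ, hδ]
      push_cast
      rw [show (n : ℝ) + 1 + 1 + 1 = n + 1 + 2 by ring]
      linarith
  have hθ2 : 1 / θ ≤ 2 * q * (1 / (b : ℝ) + 1 / (q - b)) := by
    rw [hθ, one_div_div, div_eq_mul_one_div]
    gcongr
    rcases min_choice (b : ℝ) (q - b) with h | h <;> rw [h]
    · exact le_add_of_nonneg_right (by positivity)
    · exact le_add_of_nonneg_left (by positivity)
  have hone : 1 ≤ q * (1 / (b : ℝ) + 1 / (q - b)) := by
    have : (q : ℝ) * (1 / b) ≤ q * (1 / (b : ℝ) + 1 / (q - b)) := by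
      gcongr; exact le_add_of_nonneg_right (by positivity)
    refine le_trans ?_ this
    rw [mul_one_div, le_div_iff₀ (by linarith)]; linarith
  rw [hsplit]
  refine (norm_add_le _ _).trans ?_
  rw [norm_e, norm_sum_e_neg]
  linarith

lemma sum_zmod_val {A : Type*} [AddCommMonoid A] (q : ℕ) [NeZero q] (F : ℕ → A) :
    ∑ x : ZMod q, F x.val = ∑ n ∈ range q, F n := by
  apply sum_nbij' ZMod.val (fun n => (n : ZMod q))
  · intro x _; simpa using ZMod.val_lt x
  · intro n _; exact mem_univ _
  · intro x _; exact ZMod.natCast_zmod_val x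
  · intro n hn; exact ZMod.val_natCast_of_lt (mem_range.1 hn)
  · intro x _; rfl

lemma sum_zmod_Ico {A : Type*} [AddCommMonoid A] (q : ℕ) [NeZero q] (F : ZMod q → A) :
    ∑ x : ZMod q, F x = ∑ n ∈ Ico 1 (q + 1), F (n : ZMod q) := by
  rw [sum_Ico_eq_sum_range, Nat.add_sub_cancel, ← Equiv.sum_comp (Equiv.addLeft (1 : ZMod q)),
    ← sum_zmod_val q (fun n => F ((1 + n : ℕ) : ZMod q))]
  refine sum_congr rfl fun x _ => ?_
  simp

lemma stdAddChar_intCast_eq_e (q : ℕ) [NeZero q] (j : ℤ) :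
    (ZMod.stdAddChar (j : ZMod q) : ℂ) = e (j / q) := by
  rw [ZMod.stdAddChar_coe, e]
  congr 1; push_cast; ring

lemma stdAddChar_eq_e (q : ℕ) [NeZero q] {z : ZMod q} {j : ℤ} {x : ℝ} (h : z = (j : ZMod q))
    (hx : x = j / q) : (ZMod.stdAddChar z : ℂ) = e x := by
  rw [h, hx, stdAddChar_intCast_eq_e]

/-- Fourier expansion of a function on `ZMod q`. -/
lemma zmod_fourier (q : ℕ) [NeZero q] (Φ : ZMod q → ℂ) (x : ZMod q) :
    q * Φ x = ∑ b : ZMod q, (∑ m : ZMod q, Φ m * ZMod.stdAddChar (b * m)) *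
      ZMod.stdAddChar (-(b * x)) := by
  have h1 : ∀ b : ZMod q, (∑ m : ZMod q, Φ m * ZMod.stdAddChar (b * m)) *
      ZMod.stdAddChar (-(b * x)) = ∑ m : ZMod q, Φ m * ZMod.stdAddChar (b * (m - x)) := by
    intro b
    rw [sum_mul]
    refine sum_congr rfl fun m _ => ?_
    rw [mul_assoc, ← AddChar.map_add_eq_mul]
    congr 2; ring
  simp only [h1]
  rw [sum_comm]
  simp only [← mul_sum, AddChar.sum_mulShift _ (ZMod.isPrimitive_stdAddChar q), sub_eq_zero,
    ZMod.card]
  simp [mul_comm]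

/-- The factor e(ax⁴/q) is expanded in additive characters modulo q. Frequency 0 gives the main
term; the other frequencies pair an incomplete twisted sum with a complete sum bounded by `D`. -/
lemma norm_sum_completed_le (q N : ℕ) [NeZero q] (a : ℤ) (β : ℝ) {D : ℝ}
    (hD : ∀ b : ℕ, ‖∑ m ∈ Ico 1 (q + 1), e (a / q * (m : ℝ) ^ 4 + b / q * m)‖ ≤ D) :
    q * ‖weylSum N (a / q + β)‖ ≤ ‖quarticSum q (a : ZMod q)‖ * ‖weylSum N β‖ +
      D * ∑ b ∈ Ico 1 q, ‖∑ x ∈ Ico 1 (N + 1), e (β * (x : ℝ) ^ 4 - b / q * x)‖ := by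
  have hq : 0 < q := Nat.pos_of_ne_zero (NeZero.ne q)
  set Φ : ZMod q → ℂ := fun x => ZMod.stdAddChar ((a : ZMod q) * x ^ 4) with hΦ
  have h1 : (q : ℂ) * weylSum N (a / q + β) = ∑ b : ZMod q,
      (∑ m : ZMod q, Φ m * ZMod.stdAddChar (b * m)) *
        ∑ x ∈ Ico 1 (N + 1), e (β * (x : ℝ) ^ 4 - b.val / q * x) := by
    rw [weylSum, mul_sum]
    simp only [mul_sum (s := Ico 1 (N + 1))]
    rw [sum_comm]
    refine sum_congr rfl fun x _ => ?_
    have h2 : e ((a / q + β) * (x : ℝ) ^ 4) = Φ (x : ZMod q) * e (β * (x : ℝ) ^ 4) := by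
      simp only [hΦ]
      rw [stdAddChar_eq_e q (j := a * x ^ 4) (x := a / q * (x : ℝ) ^ 4) (by push_cast; rfl)
        (by push_cast; ring), ← e_add]
      congr 1; ring
    rw [h2, ← mul_assoc, zmod_fourier q Φ (x : ZMod q), sum_mul]
    refine sum_congr rfl fun b _ => ?_
    rw [mul_assoc]
    congr 1
    rw [stdAddChar_eq_e q (j := -(b.val * x)) (x := -(b.val / q * x)) (by push_cast; simp)
        (by push_cast; ring), ← e_add]
    congr 1; ring
  have h3 : ∀ b : ZMod q, ‖∑ m : ZMod q, Φ m * ZMod.stdAddChar (b * m)‖ ≤ D := by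
    intro b
    refine le_trans (le_of_eq ?_) (hD b.val)
    rw [sum_zmod_Ico]
    congr 1
    refine sum_congr rfl fun m _ => ?_
    simp only [hΦ]
    rw [← AddChar.map_add_eq_mul, stdAddChar_eq_e q (j := a * m ^ 4 + b.val * m)
      (by push_cast; simp)]
    push_cast; ring
  have h4 : ‖(q : ℂ) * weylSum N (a / q + β)‖ = q * ‖weylSum N (a / q + β)‖ := by
    rw [norm_mul, Complex.norm_natCast]
  rw [← h4, h1, ← add_sum_erase univ _ (mem_univ (0 : ZMod q))]
  refine (norm_add_le _ _).trans ?_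
  apply add_le_add
  · rw [norm_mul]
    apply le_of_eq
    simp [hΦ, quarticSum, weylSum]
  · refine (norm_sum_le _ _).trans ?_
    have h5 : ∑ b ∈ univ.erase (0 : ZMod q),
        ‖∑ x ∈ Ico 1 (N + 1), e (β * (x : ℝ) ^ 4 - (b.val : ℕ) / q * x)‖ =
        ∑ b ∈ Ico 1 q, ‖∑ x ∈ Ico 1 (N + 1), e (β * (x : ℝ) ^ 4 - b / q * x)‖ := by
      apply sum_nbij' ZMod.val (fun n : ℕ => (n : ZMod q))
      · intro x hx
        rw [mem_Ico]
        exact ⟨Nat.one_le_iff_ne_zero.2 fun h => (mem_erase.1 hx).1 ((ZMod.val_eq_zero x).1 h),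
          ZMod.val_lt x⟩
      · intro n hn
        rw [mem_Ico] at hn
        refine mem_erase.2 ⟨fun h => ?_, mem_univ _⟩
        have := ZMod.val_natCast_of_lt hn.2
        rw [h, ZMod.val_zero] at this
        omega
      · intro x _; exact ZMod.natCast_zmod_val x
      · intro n hn; exact ZMod.val_natCast_of_lt (mem_Ico.1 hn).2
      · intro x _; rfl
    rw [← h5, mul_sum]
    refine sum_le_sum fun b _ => ?_
    rw [norm_mul]
    exact mul_le_mul_of_nonneg_right (h3 b) (norm_nonneg _)

end SmoothWeyl

/-! ### The major arc approximation and its integrable majorant. -/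

namespace SmoothWeyl
open Finset MeasureTheory

lemma sum_recip_le {q : ℕ} :
    ∑ b ∈ Ico 1 q, (1 / (b : ℝ) + 1 / ((q - b : ℕ) : ℝ)) ≤ 2 * (1 + Real.log q) := by
  rw [sum_add_distrib]
  have h : ∑ b ∈ Ico 1 q, 1 / ((q - b : ℕ) : ℝ) = ∑ b ∈ Ico 1 q, 1 / (b : ℝ) := by
    apply sum_nbij' (fun b => q - b) (fun b => q - b)
    · intro b hb; simp at hb ⊢; omega
    · intro b hb; simp at hb ⊢; omega
    · intro b hb; simp at hb ⊢; omega
    · intro b hb; simp at hb ⊢; omega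
    · intro b _; rfl
  rw [h]
  linarith [sum_inv_Ico_le q]

/-- Approximation to the Weyl sum on the major arcs. -/
lemma exists_norm_weylSum_major_le {ε : ℝ} (hε : 0 < ε) :
    ∃ C : ℝ, 1 ≤ C ∧ ∀ (N q : ℕ) [NeZero q] (a : ℤ) (β : ℝ), 1 ≤ N → q ≤ N →
      IsCoprime a (q : ℤ) → |β| ≤ 1 / (8 * q * (N : ℝ) ^ 3) →
      ‖weylSum N (a / q + β)‖ ≤ ‖quarticSum q (a : ZMod q)‖ / q *
        (6 * N * (1 + (N : ℝ) ^ 4 * |β|) ^ (-(1 / 4) : ℝ)) + C * (N : ℝ) ^ (7 / 8 + ε) := by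
  obtain ⟨C₁, hC₁, hW⟩ := exists_weyl_bound (half_pos hε)
  obtain ⟨C₂, hC₂, hlog⟩ := exists_log_le_rpow (half_pos hε)
  refine ⟨C₁ * (6 * C₂), by nlinarith, ?_⟩
  intro N q _ a β hN hqN haq hβ
  have hq : 1 ≤ q := Nat.pos_of_ne_zero (NeZero.ne q)
  have hq1 : (1 : ℝ) ≤ q := by exact_mod_cast hq
  have hq0 : (0 : ℝ) < q := by linarith
  have hN1 : (1 : ℝ) ≤ N := by exact_mod_cast hN
  have hN0 : (0 : ℝ) < N := by linarith
  have hqN1 : (q : ℝ) ≤ N := by exact_mod_cast hqN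
  -- A complete sum modulo q is a Weyl sum of length q with denominator q, so Weyl's inequality
  -- itself provides `D`.
  have h1 := norm_sum_completed_le q N a β (D := C₁ * (q : ℝ) ^ (7 / 8 + ε / 2)) (by
    intro b
    refine hW q q a (a / q) (b / q) hq le_rfl ?_ haq ?_
    · have := le_self_pow₀ hq1 (n := 3) (by norm_num); linarith
    · simp)
  have h2 : ∑ b ∈ Ico 1 q, ‖∑ x ∈ Ico 1 (N + 1), e (β * (x : ℝ) ^ 4 - b / q * x)‖ ≤
      3 * q * (2 * (1 + Real.log q)) := by
    calc _ ≤ ∑ b ∈ Ico 1 q, 3 * q * (1 / (b : ℝ) + 1 / ((q - b : ℕ) : ℝ)) :=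
          sum_le_sum fun b hb => norm_sum_twisted_le hN (mem_Ico.1 hb).1 (mem_Ico.1 hb).2 hβ
      _ ≤ _ := by
          rw [← mul_sum]
          gcongr
          exact sum_recip_le
  have h3 : 1 + Real.log q ≤ C₂ * (N : ℝ) ^ (ε / 2) := by
    refine hlog N q hN hq (hqN1.trans ?_)
    have := le_self_pow₀ hN1 (n := 3) (by norm_num); linarith
  have h4 : ‖weylSum N β‖ ≤ 6 * N * (1 + (N : ℝ) ^ 4 * |β|) ^ (-(1 / 4) : ℝ) := by
    refine norm_weylSum_near_zero hN (hβ.trans ?_)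
    apply one_div_le_one_div_of_le (by positivity)
    have : (8 : ℝ) * 1 ≤ 8 * q := by linarith
    calc 8 * (N : ℝ) ^ 3 = 8 * 1 * (N : ℝ) ^ 3 := by ring
      _ ≤ _ := by gcongr
  have h5 : C₁ * (q : ℝ) ^ (7 / 8 + ε / 2) * (3 * q * (2 * (1 + Real.log q))) ≤
      q * (C₁ * (6 * C₂) * (N : ℝ) ^ (7 / 8 + ε)) := by
    have e1 : (N : ℝ) ^ (7 / 8 + ε) = (N : ℝ) ^ (7 / 8 + ε / 2) * (N : ℝ) ^ (ε / 2) := by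
      rw [← Real.rpow_add hN0]; congr 1; ring
    calc _ ≤ C₁ * (N : ℝ) ^ (7 / 8 + ε / 2) * (3 * q * (2 * (C₂ * (N : ℝ) ^ (ε / 2)))) := by
          have := Real.log_natCast_nonneg q
          gcongr
      _ = _ := by rw [e1]; ring
  have h6 : q * ‖weylSum N (a / q + β)‖ ≤ ‖quarticSum q (a : ZMod q)‖ *
      (6 * N * (1 + (N : ℝ) ^ 4 * |β|) ^ (-(1 / 4) : ℝ)) +
      q * (C₁ * (6 * C₂) * (N : ℝ) ^ (7 / 8 + ε)) := by
    refine h1.trans (add_le_add (by gcongr) (le_trans ?_ h5))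
    gcongr
  rw [← mul_le_mul_iff_right₀ hq0]
  refine h6.trans (le_of_eq ?_)
  field_simp

/-- The majorant of `|f(γ)|^r` on the major arcs. -/
def majorant (r : ℝ) (N : ℕ) (γ : ℝ) : ℝ :=
  ∑ q ∈ Icc 1 N, ∑ a ∈ Icc (-(q : ℤ)) q, localBound q ^ (r / 2) * (6 * N) ^ r *
    (1 + ‖(N : ℝ) ^ 4 * (γ - a / q)‖) ^ (-(r / 4))

lemma majorant_term_nonneg (r : ℝ) (N q : ℕ) (a : ℤ) (γ : ℝ) :
    0 ≤ localBound q ^ (r / 2) * (6 * N) ^ r *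
      (1 + ‖(N : ℝ) ^ 4 * (γ - a / q)‖) ^ (-(r / 4)) := by
  have := localBound_nonneg q
  positivity

lemma majorant_nonneg (r : ℝ) (N : ℕ) (γ : ℝ) : 0 ≤ majorant r N γ :=
  sum_nonneg fun q _ => sum_nonneg fun a _ => majorant_term_nonneg r N q a γ

lemma integrable_japanese {r : ℝ} (hr : 4 < r) (N : ℕ) (hN : 1 ≤ N) (t : ℝ) :
    Integrable fun γ : ℝ => (1 + ‖(N : ℝ) ^ 4 * (γ - t)‖) ^ (-(r / 4)) := by
  have h1 : Integrable fun x : ℝ => (1 + ‖x‖) ^ (-(r / 4)) :=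
    integrable_one_add_norm (by simp; linarith)
  have hN0 : (N : ℝ) ^ 4 ≠ 0 := by positivity
  exact (h1.comp_mul_left' hN0).comp_sub_right t

lemma integral_japanese {r : ℝ} (N : ℕ) (t : ℝ) :
    ∫ γ : ℝ, (1 + ‖(N : ℝ) ^ 4 * (γ - t)‖) ^ (-(r / 4)) =
      ((N : ℝ) ^ 4)⁻¹ * ∫ x : ℝ, (1 + ‖x‖) ^ (-(r / 4)) := by
  rw [integral_sub_right_eq_self (fun γ : ℝ => (1 + ‖(N : ℝ) ^ 4 * γ‖) ^ (-(r / 4))) t,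
    Measure.integral_comp_mul_left (fun x : ℝ => (1 + ‖x‖) ^ (-(r / 4))), abs_of_nonneg
    (by positivity), smul_eq_mul]

lemma integrable_majorant {r : ℝ} (hr : 4 < r) (N : ℕ) (hN : 1 ≤ N) :
    Integrable (majorant r N) := by
  unfold majorant
  refine integrable_finsetSum _ fun q _ => integrable_finsetSum _ fun a _ => ?_
  exact (integrable_japanese hr N hN _).const_mul _

/-- Each term integrates to N^(-4) times a fixed integral, finite as r > 4. The at most 3q
numerators a supply the factor q in `seriesTerm`. -/
lemma exists_integral_majorant_le {r : ℝ} (hr : 5 < r) :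
    ∃ C : ℝ, 0 < C ∧ ∀ N : ℕ, 1 ≤ N → ∫ γ : ℝ, majorant r N γ ≤ C * (N : ℝ) ^ (r - 4) := by
  obtain ⟨C₀, hC₀⟩ := exists_sum_seriesTerm_le hr
  set J : ℝ := ∫ x : ℝ, (1 + ‖x‖) ^ (-(r / 4)) with hJ
  have hJ0 : 0 ≤ J := integral_nonneg fun x => by positivity
  refine ⟨3 * 6 ^ r * J * |C₀| + 1, by positivity, fun N hN => ?_⟩
  have hN0 : (0 : ℝ) < N := by exact_mod_cast hN
  have h1 : ∫ γ : ℝ, majorant r N γ = ∑ q ∈ Icc 1 N, ∑ a ∈ Icc (-(q : ℤ)) q,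
      localBound q ^ (r / 2) * (6 * N) ^ r * (((N : ℝ) ^ 4)⁻¹ * J) := by
    unfold majorant
    rw [integral_finsetSum _ fun q _ => integrable_finsetSum _ fun a _ =>
      (integrable_japanese (by linarith) N hN _).const_mul _]
    refine sum_congr rfl fun q _ => ?_
    rw [integral_finsetSum _ fun a _ => (integrable_japanese (by linarith) N hN _).const_mul _]
    refine sum_congr rfl fun a _ => ?_
    rw [integral_const_mul, integral_japanese]
  have h2 : ∀ q ∈ Icc 1 N, ∑ a ∈ Icc (-(q : ℤ)) q,
      localBound q ^ (r / 2) * (6 * N) ^ r * (((N : ℝ) ^ 4)⁻¹ * J) ≤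
      3 * (6 * N) ^ r * (((N : ℝ) ^ 4)⁻¹ * J) * seriesTerm r q := by
    intro q hq
    have hq1 := (mem_Icc.1 hq).1
    have hloc := localBound_nonneg q
    rw [sum_const, nsmul_eq_mul, seriesTerm]
    have : ((Icc (-(q : ℤ)) q).card : ℝ) ≤ 3 * q := by
      rw [Int.card_Icc]
      have : ((q : ℤ) + 1 - -(q : ℤ)).toNat ≤ 3 * q := by omega
      exact_mod_cast this
    calc _ ≤ 3 * q * (localBound q ^ (r / 2) * (6 * N) ^ r * (((N : ℝ) ^ 4)⁻¹ * J)) := by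
          gcongr
      _ = _ := by ring
  rw [h1]
  refine (sum_le_sum h2).trans ?_
  rw [← mul_sum]
  have h3 : (6 * (N : ℝ)) ^ r * ((N : ℝ) ^ 4)⁻¹ = 6 ^ r * (N : ℝ) ^ (r - 4) := by
    rw [Real.mul_rpow (by norm_num) hN0.le, Real.rpow_sub hN0, mul_assoc, div_eq_mul_inv]
    norm_num
  calc 3 * (6 * N) ^ r * (((N : ℝ) ^ 4)⁻¹ * J) * ∑ q ∈ Icc 1 N, seriesTerm r q ≤
        3 * (6 * N) ^ r * (((N : ℝ) ^ 4)⁻¹ * J) * |C₀| := by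
        gcongr
        exact (hC₀ N).trans (le_abs_self _)
    _ = 3 * ((6 * (N : ℝ)) ^ r * ((N : ℝ) ^ 4)⁻¹) * J * |C₀| := by ring
    _ = 3 * 6 ^ r * J * |C₀| * (N : ℝ) ^ (r - 4) := by rw [h3]; ring
    _ ≤ _ := by gcongr; linarith

/-- Dirichlet approximation with denominators up to 8N³: q ≥ N falls under Weyl's inequality, q < N
under the major arc estimate. The error in the latter is as small as Weyl's bound, so one estimate
covers every γ. -/
lemma exists_norm_weylSum_le {r ε : ℝ} (hr : 5 < r) (hε : 0 < ε) :
    ∃ C : ℝ, 1 ≤ C ∧ ∀ (N : ℕ) (γ : ℝ), 1 ≤ N → |γ| ≤ 1 →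
      ‖weylSum N γ‖ ≤ C * (N : ℝ) ^ (7 / 8 + ε) + majorant r N γ ^ (1 / r) := by
  obtain ⟨C₁, hC₁, hminor⟩ := exists_weyl_bound hε
  obtain ⟨C₂, hC₂, hmajor⟩ := exists_norm_weylSum_major_le hε
  refine ⟨C₁ + C₂, by linarith, fun N γ hN hγ => ?_⟩
  have hN1 : (1 : ℝ) ≤ N := by exact_mod_cast hN
  have hN0 : (0 : ℝ) < N := by linarith
  have hr0 : 0 < r := by linarith
  have hM := Real.rpow_nonneg (majorant_nonneg r N γ) (1 / r)
  have hNp : 0 < (N : ℝ) ^ (7 / 8 + ε) := by positivity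
  obtain ⟨x, hx, hxd⟩ := Real.exists_rat_abs_sub_le_and_den_le γ (n := 8 * N ^ 3) (by positivity)
  set q := x.den with hq
  set a := x.num with ha
  have hxa : (x : ℝ) = a / q := by rw [hq, ha]; exact_mod_cast (Rat.num_div_den x).symm
  rw [hxa] at hx
  have hcop : IsCoprime a (q : ℤ) := by
    rw [Int.isCoprime_iff_gcd_eq_one]
    exact x.reduced
  have hqpos : 0 < q := x.den_pos
  have hq0 : (0 : ℝ) < q := by exact_mod_cast hqpos
  have hxd' : (q : ℝ) ≤ 8 * (N : ℝ) ^ 3 := by exact_mod_cast hxd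
  push_cast at hx
  rcases le_or_gt N q with h | h
  · have h1 := hminor N q a γ 0 hN h hxd' hcop (hx.trans (by
      apply one_div_le_one_div_of_le (by positivity)
      rw [sq]; gcongr; linarith))
    simp only [zero_mul, add_zero] at h1
    rw [weylSum]
    nlinarith
  · have : NeZero q := ⟨hqpos.ne'⟩
    set β := γ - a / q with hβ
    have hβ1 : |β| ≤ 1 / (8 * q * (N : ℝ) ^ 3) := by
      refine hx.trans (one_div_le_one_div_of_le (by positivity) ?_)
      nlinarith
    have h1 := hmajor N q a β hN h.le hcop hβ1
    rw [show (a : ℝ) / q + β = γ by rw [hβ]; ring] at h1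
    refine h1.trans ?_
    have h2 : ‖quarticSum q (a : ZMod q)‖ / q *
        (6 * N * (1 + (N : ℝ) ^ 4 * |β|) ^ (-(1 / 4) : ℝ)) ≤ majorant r N γ ^ (1 / r) := by
      have hu : IsUnit ((a : ℤ) : ZMod q) := (ZMod.coe_int_isUnit_iff_isCoprime a q).2 hcop.symm
      rw [one_div r, Real.le_rpow_inv_iff_of_pos (by positivity) (majorant_nonneg r N γ) hr0,
        Real.mul_rpow (by positivity) (by positivity),
        Real.mul_rpow (by positivity) (by positivity),
        ← Real.rpow_mul (by positivity)]
      -- From |γ| ≤ 1 and q|β| ≤ 1/8 one gets |a| < q + 1, so the numerator is among those summed in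
      -- `majorant`.
      have ha_mem : a ∈ Icc (-(q : ℤ)) q := by
        have h3 : |(a : ℝ)| < q + 1 := by
          have e1 : (a : ℝ) = q * γ - q * β := by rw [hβ]; field_simp; ring
          rw [e1]
          refine (abs_sub _ _).trans_lt ?_
          rw [abs_mul, abs_mul, abs_of_pos hq0]
          have e2 : q * |β| ≤ 1 / 8 := by
            calc q * |β| ≤ q * (1 / (8 * q * (N : ℝ) ^ 3)) := by gcongr
              _ = 1 / (8 * (N : ℝ) ^ 3) := by field_simp
              _ ≤ 1 / 8 := by
                apply one_div_le_one_div_of_le (by norm_num)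
                linarith [one_le_pow₀ hN1 (n := 3)]
          nlinarith
        have h4 : |a| < (q : ℤ) + 1 := by exact_mod_cast h3
        rw [mem_Icc]
        obtain ⟨h5, h6⟩ := abs_lt.1 h4
        constructor <;> omega
      have hq_mem : q ∈ Icc 1 N := mem_Icc.2 ⟨hqpos, h.le⟩
      calc (‖quarticSum q (a : ZMod q)‖ / q) ^ r *
            ((6 * (N : ℝ)) ^ r * (1 + (N : ℝ) ^ 4 * |β|) ^ (-(1 / 4) * r)) ≤
            localBound q ^ (r / 2) * ((6 * (N : ℝ)) ^ r *
              (1 + (N : ℝ) ^ 4 * |β|) ^ (-(1 / 4) * r)) := by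
            gcongr
            exact norm_quarticSum_div_rpow_le hr0.le q hu
        _ = localBound q ^ (r / 2) * (6 * N) ^ r *
            (1 + ‖(N : ℝ) ^ 4 * (γ - a / q)‖) ^ (-(r / 4)) := by
            rw [norm_mul, Real.norm_of_nonneg (by positivity : 0 ≤ (N : ℝ) ^ 4), ← hβ,
              Real.norm_eq_abs, mul_assoc]
            congr 3; ring
        _ ≤ majorant r N γ := by
            unfold majorant
            refine le_trans ?_ (single_le_sum (f := fun q : ℕ => ∑ a ∈ Icc (-(q : ℤ)) q,
              localBound q ^ (r / 2) * (6 * N) ^ r *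
                (1 + ‖(N : ℝ) ^ 4 * (γ - a / q)‖) ^ (-(r / 4)))
              (fun q _ => sum_nonneg fun a _ => majorant_term_nonneg r N q a γ) hq_mem)
            exact single_le_sum (f := fun a : ℤ => localBound q ^ (r / 2) * (6 * N) ^ r *
                (1 + ‖(N : ℝ) ^ 4 * (γ - a / q)‖) ^ (-(r / 4)))
              (fun a _ => majorant_term_nonneg r N q a γ) ha_mem
    nlinarith

end SmoothWeyl

/-! ### Duality and the large values of sums over arbitrary sets. -/

namespace SmoothWeyl
open Finset MeasureTheory
open scoped ENNReal

/-- The duality inequality bounding a linear functional of an exponential sum over a subset by a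
bilinear form with the complete Weyl sum as kernel. -/
lemma norm_sq_integral_mul_le {N : ℕ} {A : Finset ℕ} (hA : A ⊆ Icc 1 N) {h : ℝ → ℂ}
    (hh : Integrable h) :
    ‖∫ α, (∑ x ∈ A, e (α * (x : ℝ) ^ 4)) * h α‖ ^ 2 ≤
      N * ‖∫ p : ℝ × ℝ, weylSum N (p.1 - p.2) * (h p.1 * starRingEnd ℂ (h p.2))‖ := by
  have hint : ∀ x : ℕ, Integrable fun α : ℝ => e (α * (x : ℝ) ^ 4) * h α := fun x =>
    hh.bdd_mul (c := 1) (continuous_e.comp (by fun_prop)).aestronglyMeasurable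
      (Filter.Eventually.of_forall fun α => by simp)
  set c : ℕ → ℂ := fun x => ∫ α : ℝ, e (α * (x : ℝ) ^ 4) * h α with hc
  have h1 : ∫ α, (∑ x ∈ A, e (α * (x : ℝ) ^ 4)) * h α = ∑ x ∈ A, c x := by
    simp only [sum_mul]
    exact integral_finsetSum _ fun x _ => hint x
  have hcard : (A.card : ℝ) ≤ N := by
    have := card_le_card hA
    rw [Nat.card_Icc, Nat.add_sub_cancel] at this
    exact_mod_cast this
  -- After Cauchy–Schwarz, positivity allows all of [1,N] in place of A; the structure of A is
  -- forgotten here.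
  have h2 : ‖∑ x ∈ A, c x‖ ^ 2 ≤ N * ∑ x ∈ Ico 1 (N + 1), ‖c x‖ ^ 2 := by
    calc ‖∑ x ∈ A, c x‖ ^ 2 ≤ (∑ x ∈ A, ‖c x‖) ^ 2 := by gcongr; exact norm_sum_le _ _
      _ ≤ A.card * ∑ x ∈ A, ‖c x‖ ^ 2 := sq_sum_le_card_mul_sum_sq
      _ ≤ N * ∑ x ∈ Ico 1 (N + 1), ‖c x‖ ^ 2 := by
        gcongr
        intro x hx
        have := mem_Icc.1 (hA hx)
        rw [mem_Ico]; omega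
  have h3 : ((∑ x ∈ Ico 1 (N + 1), ‖c x‖ ^ 2 : ℝ) : ℂ) =
      ∫ p : ℝ × ℝ, weylSum N (p.1 - p.2) * (h p.1 * starRingEnd ℂ (h p.2)) := by
    have hconj : ∀ x : ℕ, Integrable fun β : ℝ => starRingEnd ℂ (e (β * (x : ℝ) ^ 4) * h β) :=
      fun x => (hint x).norm.mono ((Complex.continuous_conj.comp_aestronglyMeasurable
        (hint x).aestronglyMeasurable)) (Filter.Eventually.of_forall fun β => by simp)
    have h4 : ∀ x : ℕ, ((‖c x‖ : ℂ)) ^ 2 = ∫ p : ℝ × ℝ,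
        (e (p.1 * (x : ℝ) ^ 4) * h p.1) * starRingEnd ℂ (e (p.2 * (x : ℝ) ^ 4) * h p.2) := by
      intro x
      rw [← Complex.mul_conj', hc, ← integral_conj]
      exact (integral_prod_mul (fun α : ℝ => e (α * (x : ℝ) ^ 4) * h α)
        (fun β : ℝ => starRingEnd ℂ (e (β * (x : ℝ) ^ 4) * h β))).symm
    push_cast
    simp only [h4]
    have h5 := integral_finsetSum (μ := (volume : Measure (ℝ × ℝ))) (Ico 1 (N + 1))
      (f := fun (x : ℕ) (p : ℝ × ℝ) => (e (p.1 * (x : ℝ) ^ 4) * h p.1) *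
        starRingEnd ℂ (e (p.2 * (x : ℝ) ^ 4) * h p.2))
      (fun x _ => (hint x).mul_prod (hconj x))
    rw [← h5]
    congr 1
    funext p
    rw [weylSum, sum_mul]
    refine sum_congr rfl fun x _ => ?_
    rw [sub_mul, e_sub, map_mul]; ring
  rw [h1]
  refine h2.trans ?_
  rw [← h3, Complex.norm_real, Real.norm_of_nonneg (sum_nonneg fun _ _ => sq_nonneg _)]

/-- A convolution inequality of Young type. -/
lemma lintegral_convolution_le {r : ℝ} (hr : 1 < r) {W M : ℝ → ℝ≥0∞} (hW : Measurable W)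
    (hM : Measurable M) :
    ∫⁻ p : ℝ × ℝ, (W p.1 * W p.2) ^ (1 - 1 / (2 * r)) * M (p.1 - p.2) ^ (1 / r) ≤
      (∫⁻ α, W α) ^ (2 - 1 / r) * (∫⁻ γ, M γ) ^ (1 / r) := by
  have hr0 : 0 < r := by linarith
  have hinv : 1 / r < 1 := by rw [div_lt_one hr0]; exact hr
  have hinv0 : 0 < 1 / r := by positivity
  have h2r : 1 / (2 * r) = 1 / r / 2 := by field_simp
  set k := 1 / r with hk
  rw [h2r]
  -- Hölder with weights 1-k, k/2, k/2: each W gets total exponent 1 - k/2 and M gets k. Each of the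
  -- three double integrals factors.
  set F : Fin 3 → ℝ × ℝ → ℝ≥0∞ := ![fun p => W p.1 * W p.2, fun p => W p.1 * M (p.1 - p.2),
    fun p => W p.2 * M (p.1 - p.2)] with hF
  set w : Fin 3 → ℝ := ![1 - k, k / 2, k / 2] with hw
  have hFm : ∀ i ∈ (univ : Finset (Fin 3)), AEMeasurable (F i) (volume : Measure (ℝ × ℝ)) := by
    intro i _
    have m1 : Measurable fun p : ℝ × ℝ => W p.1 := hW.comp measurable_fst
    have m2 : Measurable fun p : ℝ × ℝ => W p.2 := hW.comp measurable_snd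
    have m3 : Measurable fun p : ℝ × ℝ => M (p.1 - p.2) :=
      hM.comp (measurable_fst.sub measurable_snd)
    fin_cases i
    · exact (m1.mul m2).aemeasurable
    · exact (m1.mul m3).aemeasurable
    · exact (m2.mul m3).aemeasurable
  have hholder := ENNReal.lintegral_prod_norm_pow_le (univ : Finset (Fin 3)) hFm (p := w)
    (by simp [hw, Fin.sum_univ_three]; ring) (by
      intro i _
      fin_cases i <;> simp [hw] <;> linarith)
  simp only [Fin.prod_univ_three] at hholder
  have hF0 : F 0 = fun p => W p.1 * W p.2 := rfl
  have hF1 : F 1 = fun p => W p.1 * M (p.1 - p.2) := rfl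
  have hF2 : F 2 = fun p => W p.2 * M (p.1 - p.2) := rfl
  have hw0 : w 0 = 1 - k := rfl
  have hw1 : w 1 = k / 2 := rfl
  have hw2 : w 2 = k / 2 := rfl
  simp only [hF0, hF1, hF2, hw0, hw1, hw2] at hholder
  have i0 : ∫⁻ p : ℝ × ℝ, W p.1 * W p.2 = (∫⁻ α, W α) * ∫⁻ α, W α :=
    lintegral_prod_mul hW.aemeasurable hW.aemeasurable
  have i1 : ∫⁻ p : ℝ × ℝ, W p.1 * M (p.1 - p.2) = (∫⁻ α, W α) * ∫⁻ γ, M γ := by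
    rw [Measure.volume_eq_prod, lintegral_prod _ (by exact hFm 1 (mem_univ _))]
    have : ∀ x : ℝ, ∫⁻ y : ℝ, W x * M (x - y) = W x * ∫⁻ γ, M γ := by
      intro x
      have hm : Measurable fun y => M (x - y) := hM.comp (measurable_const.sub measurable_id)
      rw [lintegral_const_mul _ hm, lintegral_sub_left_eq_self M x]
    simp only [this]
    rw [lintegral_mul_const _ hW]
  have i2 : ∫⁻ p : ℝ × ℝ, W p.2 * M (p.1 - p.2) = (∫⁻ α, W α) * ∫⁻ γ, M γ := by
    rw [Measure.volume_eq_prod, lintegral_prod_symm _ (by exact hFm 2 (mem_univ _))]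
    have : ∀ y : ℝ, ∫⁻ x : ℝ, W y * M (x - y) = W y * ∫⁻ γ, M γ := by
      intro y
      have hm : Measurable fun x => M (x - y) := hM.comp (measurable_id.sub measurable_const)
      rw [lintegral_const_mul _ hm, lintegral_sub_right_eq_self M y]
    simp only [this]
    rw [lintegral_mul_const _ hW]
  rw [i0, i1, i2] at hholder
  have hk1 : 0 ≤ 1 - k := by linarith
  have hk2 : 0 ≤ k / 2 := by linarith
  calc _ = ∫⁻ p : ℝ × ℝ, (W p.1 * W p.2) ^ (1 - k) * (W p.1 * M (p.1 - p.2)) ^ (k / 2) *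
        (W p.2 * M (p.1 - p.2)) ^ (k / 2) := by
        congr 1
        funext p
        rw [show 1 - k / 2 = (1 - k) + k / 2 by ring, ENNReal.rpow_add_of_nonneg _ _ hk1 hk2,
          show k = k / 2 + k / 2 by ring, ENNReal.rpow_add_of_nonneg _ _ hk2 hk2,
          show k / 2 + k / 2 = k by ring, ENNReal.mul_rpow_of_nonneg (W p.1) (W p.2) hk2,
          ENNReal.mul_rpow_of_nonneg (W p.1) _ hk2, ENNReal.mul_rpow_of_nonneg (W p.2) _ hk2]
        ring
    _ ≤ _ := hholder
    _ = _ := by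
        set I := ∫⁻ α, W α
        set J := ∫⁻ γ, M γ
        rw [ENNReal.mul_rpow_of_nonneg _ _ hk1, ENNReal.mul_rpow_of_nonneg _ _ hk2,
          show 2 - k = (1 - k) + (1 - k) + (k / 2 + k / 2) by ring,
          ENNReal.rpow_add_of_nonneg _ _ (by linarith) (by linarith),
          ENNReal.rpow_add_of_nonneg _ _ hk1 hk1, ENNReal.rpow_add_of_nonneg _ _ hk2 hk2]
        conv_rhs => rw [show J ^ k = J ^ (k / 2) * J ^ (k / 2) by
          rw [← ENNReal.rpow_add_of_nonneg _ _ hk2 hk2]; congr 1; ring]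
        ring

lemma le_of_sq_le_half_add {I B k : ℝ} (hI : 0 ≤ I) (hk : 0 < k) (hB : 0 ≤ B)
    (h : I ^ 2 ≤ I ^ 2 / 2 + I ^ (2 - k) * B) : I ≤ (2 * B) ^ (1 / k) := by
  rcases hI.eq_or_lt with h0 | h0
  · rw [← h0]; positivity
  have h1 : I ^ (2 - k) * I ^ k = I ^ 2 := by
    rw [← Real.rpow_add h0]; norm_num
  have h2 : 0 < I ^ (2 - k) := Real.rpow_pos_of_pos h0 _
  have h3 : I ^ k ≤ 2 * B := by
    by_contra hcon
    have := mul_lt_mul_of_pos_left (not_le.1 hcon) h2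
    linarith
  rwa [one_div, Real.le_rpow_inv_iff_of_pos hI (by positivity) hk]

/-- Moments of an exponential sum over an arbitrary subset of `[1, N]`, restricted to the set
where it is larger than about `N ^ (15 / 16)`. -/
theorem exists_large_values_bound {u ε : ℝ} (hu : 10 < u) (hε : 0 < ε) :
    ∃ K : ℝ, 1 ≤ K ∧ ∃ C : ℝ, 0 ≤ C ∧ ∀ (N : ℕ) (A : Finset ℕ), 1 ≤ N → A ⊆ Icc 1 N →
      ∫ α in {α | α ∈ Set.Ioc (0 : ℝ) 1 ∧
          K * (N : ℝ) ^ (15 / 16 + ε / 2) < ‖∑ x ∈ A, e (α * (x : ℝ) ^ 4)‖},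
        ‖∑ x ∈ A, e (α * (x : ℝ) ^ 4)‖ ^ u ≤ C * (N : ℝ) ^ (u - 4) := by
  set r := u / 2 with hr
  have hr5 : 5 < r := by linarith
  have hr0 : 0 < r := by linarith
  obtain ⟨C₁, hC₁, hf⟩ := exists_norm_weylSum_le hr5 hε
  obtain ⟨C₂, hC₂, hmaj⟩ := exists_integral_majorant_le hr5
  refine ⟨2 * C₁, by linarith, 2 ^ r * C₂, by positivity, fun N A hN hA => ?_⟩
  have hN1 : (1 : ℝ) ≤ N := by exact_mod_cast hN
  have hN0 : (0 : ℝ) < N := by linarith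
  set G : ℝ → ℂ := fun α => ∑ x ∈ A, e (α * (x : ℝ) ^ 4) with hG
  have hGc : Continuous G := by
    rw [hG]; exact continuous_finsetSum _ fun x _ => continuous_e.comp (by fun_prop)
  have hGb : ∀ α, ‖G α‖ ≤ N := fun α => by
    refine (norm_sum_e_le_card _ _).trans ?_
    have := card_le_card hA
    rw [Nat.card_Icc, Nat.add_sub_cancel] at this
    exact_mod_cast this
  -- The constant 2C₁ ensures T² ≥ 2ND with D = C₁N^(7/8+ε), so that the flat part of the bound for
  -- f contributes at most I²/2.
  set T : ℝ := 2 * C₁ * (N : ℝ) ^ (15 / 16 + ε / 2) with hT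
  have hT0 : 0 < T := by positivity
  set E : Set ℝ := {α | α ∈ Set.Ioc (0 : ℝ) 1 ∧ T < ‖G α‖} with hE
  have hEm : MeasurableSet E :=
    measurableSet_Ioc.inter (measurableSet_lt measurable_const hGc.norm.measurable)
  have hEfin : volume E < ⊤ :=
    (measure_mono fun α hα => hα.1).trans_lt (by simp : volume (Set.Ioc (0 : ℝ) 1) < ⊤)
  have hGpos : ∀ α ∈ E, 0 < ‖G α‖ := fun α hα => hT0.trans hα.2
  set w : ℝ → ℝ := E.indicator fun α => ‖G α‖ ^ u with hw
  have hw0 : ∀ α, 0 ≤ w α := fun α => Set.indicator_nonneg (fun α _ => by positivity) α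
  have hwint : Integrable w := by
    rw [hw, integrable_indicator_iff hEm]
    refine Measure.integrableOn_of_bounded (M := (N : ℝ) ^ u) hEfin.ne ?_ ?_
    · exact (hGc.norm.rpow_const fun _ => Or.inr (by linarith)).aestronglyMeasurable
    · refine Filter.Eventually.of_forall fun α => ?_
      rw [Real.norm_of_nonneg (by positivity)]
      gcongr; exact hGb α
  set I : ℝ := ∫ α, w α with hI
  have hI0 : 0 ≤ I := integral_nonneg hw0
  have hIeq : ∫ α in E, ‖G α‖ ^ u = I := by rw [hI, hw, integral_indicator hEm]
  rw [hIeq]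
  -- The dual function: Gh = w. It is estimated in two ways, |h| ≤ w/T for the flat part of the
  -- kernel and |h| = w^(1-1/(2r)) for the majorant, the latter because u = 2r.
  set h : ℝ → ℂ := E.indicator fun α => ((‖G α‖ ^ (u - 2) : ℝ) : ℂ) * starRingEnd ℂ (G α) with hh
  have hnorm_in : ∀ α ∈ E, ‖h α‖ = ‖G α‖ ^ (u - 1) := by
    intro α hα
    rw [hh, Set.indicator_of_mem hα, norm_mul, RCLike.norm_conj, Complex.norm_real,
      Real.norm_of_nonneg (by positivity), ← Real.rpow_add_one (hGpos α hα).ne']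
    congr 1; ring
  have hnorm_out : ∀ α ∉ E, h α = 0 := fun α hα => Set.indicator_of_notMem hα _
  have hGh : ∀ α, G α * h α = (w α : ℂ) := by
    intro α
    by_cases hα : α ∈ E
    · rw [hh, hw, Set.indicator_of_mem hα, Set.indicator_of_mem hα]
      have : ‖G α‖ ^ u = ‖G α‖ ^ (u - 2) * ‖G α‖ ^ 2 := by
        rw [← Real.rpow_natCast, ← Real.rpow_add (hGpos α hα)]; congr 1; push_cast; ring
      rw [this]
      push_cast
      rw [← Complex.mul_conj']; ring
    · rw [hnorm_out α hα, hw, Set.indicator_of_notMem hα]; simp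
  have hhT : ∀ α, ‖h α‖ ≤ w α / T := by
    intro α
    by_cases hα : α ∈ E
    · rw [hnorm_in α hα, hw, Set.indicator_of_mem hα, le_div_iff₀ hT0]
      have : ‖G α‖ ^ u = ‖G α‖ ^ (u - 1) * ‖G α‖ := by
        rw [← Real.rpow_add_one (hGpos α hα).ne']; congr 1; ring
      rw [this]
      gcongr
      exact hα.2.le
    · rw [hnorm_out α hα, norm_zero]; exact div_nonneg (hw0 α) hT0.le
  have hhm : Measurable h := by
    refine Measurable.indicator ?_ hEm
    have m1 : Measurable fun α => ‖G α‖ ^ (u - 2) :=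
      (hGc.norm.rpow_const fun _ => Or.inr (by linarith)).measurable
    exact (Complex.measurable_ofReal.comp m1).mul
      (Complex.continuous_conj.comp hGc).measurable
  have hhint : Integrable h := (hwint.div_const T).mono' hhm.aestronglyMeasurable
    (Filter.Eventually.of_forall hhT)
  have hdual := norm_sq_integral_mul_le hA hhint
  have hleft : ‖∫ α, (∑ x ∈ A, e (α * (x : ℝ) ^ 4)) * h α‖ = I := by
    have : (fun α => (∑ x ∈ A, e (α * (x : ℝ) ^ 4)) * h α) = fun α => (w α : ℂ) :=
      funext fun α => hGh α
    rw [this, integral_complex_ofReal, Complex.norm_real, Real.norm_of_nonneg hI0]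
  rw [hleft] at hdual
  set D : ℝ := C₁ * (N : ℝ) ^ (7 / 8 + ε) with hD
  have hD0 : 0 ≤ D := by positivity
  set W : ℝ → ℝ≥0∞ := fun α => ENNReal.ofReal (w α) with hWdef
  set M : ℝ → ℝ≥0∞ := fun γ => ENNReal.ofReal (majorant r N γ) with hMdef
  have hWm : Measurable W := by
    have : Measurable w := Measurable.indicator
      (hGc.norm.rpow_const fun _ => Or.inr (by linarith)).measurable hEm
    exact this.ennreal_ofReal
  have hMm : Measurable M := by
    refine Measurable.ennreal_ofReal ?_
    unfold majorant
    refine Finset.measurable_fun_sum _ fun q _ => Finset.measurable_fun_sum _ fun a _ => ?_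
    refine Measurable.const_mul ?_ _
    exact Measurable.pow_const (by fun_prop) _
  have hWI : ∫⁻ α, W α = ENNReal.ofReal I :=
    (ofReal_integral_eq_lintegral_ofReal hwint (Filter.Eventually.of_forall hw0)).symm
  have hMI : ∫⁻ γ, M γ ≤ ENNReal.ofReal (C₂ * (N : ℝ) ^ (r - 4)) := by
    rw [hMdef, ← ofReal_integral_eq_lintegral_ofReal (integrable_majorant (by linarith) N hN)
      (Filter.Eventually.of_forall fun γ => majorant_nonneg r N γ)]
    exact ENNReal.ofReal_le_ofReal (hmaj N hN)
  have hhW : ∀ α, ‖h α‖ₑ = W α ^ (1 - 1 / (2 * r)) := by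
    intro α
    have hexp : 0 < 1 - 1 / (2 * r) := by
      have : 1 / (2 * r) < 1 := by rw [div_lt_one (by positivity)]; linarith
      linarith
    by_cases hα : α ∈ E
    · rw [← ofReal_norm, hnorm_in α hα, hWdef, hw]
      simp only [Set.indicator_of_mem hα]
      rw [ENNReal.ofReal_rpow_of_nonneg (by positivity) hexp.le, ← Real.rpow_mul (norm_nonneg _)]
      congr 2
      rw [hr]; field_simp
    · rw [hnorm_out α hα, hWdef, hw]
      simp only [Set.indicator_of_notMem hα]
      rw [ENNReal.ofReal_zero, ENNReal.zero_rpow_of_pos hexp, enorm_zero]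
  have hhI : ∫⁻ α, ‖h α‖ₑ ≤ ENNReal.ofReal (I / T) := by
    calc ∫⁻ α, ‖h α‖ₑ ≤ ∫⁻ α, ENNReal.ofReal (w α / T) := by
          refine lintegral_mono fun α => ?_
          rw [← ofReal_norm]
          exact ENNReal.ofReal_le_ofReal (hhT α)
      _ = ENNReal.ofReal (∫ α, w α / T) :=
          (ofReal_integral_eq_lintegral_ofReal (hwint.div_const T)
            (Filter.Eventually.of_forall fun α => div_nonneg (hw0 α) hT0.le)).symm
      _ = _ := by rw [integral_div]
  have hpoint : ∀ p : ℝ × ℝ, ‖weylSum N (p.1 - p.2) * (h p.1 * starRingEnd ℂ (h p.2))‖ₑ ≤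
      ENNReal.ofReal D * (‖h p.1‖ₑ * ‖h p.2‖ₑ) +
        (W p.1 * W p.2) ^ (1 - 1 / (2 * r)) * M (p.1 - p.2) ^ (1 / r) := by
    rintro ⟨α, β⟩
    by_cases hα : α ∈ E
    swap
    · simp [hnorm_out α hα]
    by_cases hβ : β ∈ E
    swap
    · simp [hnorm_out β hβ]
    have hab : |α - β| ≤ 1 := by
      have h1 := hα.1; have h2 := hβ.1
      rw [Set.mem_Ioc] at h1 h2
      rw [abs_le]; constructor <;> linarith [h1.1, h1.2, h2.1, h2.2]
    have h1 := hf N (α - β) hN hab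
    have hexp : 0 ≤ 1 - 1 / (2 * r) := by
      have : 1 / (2 * r) ≤ 1 := by rw [div_le_one (by positivity)]; linarith
      linarith
    have h2 : ‖weylSum N (α - β)‖ₑ ≤ ENNReal.ofReal D + M (α - β) ^ (1 / r) := by
      rw [← ofReal_norm, hMdef]
      simp only
      rw [ENNReal.ofReal_rpow_of_nonneg (majorant_nonneg _ _ _) (by positivity),
        ← ENNReal.ofReal_add hD0 (Real.rpow_nonneg (majorant_nonneg _ _ _) _)]
      exact ENNReal.ofReal_le_ofReal h1
    have h3 : ‖starRingEnd ℂ (h β)‖ₑ = ‖h β‖ₑ := by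
      rw [← ofReal_norm, ← ofReal_norm, RCLike.norm_conj]
    simp only [enorm_mul, h3]
    calc _ ≤ (ENNReal.ofReal D + M (α - β) ^ (1 / r)) * (‖h α‖ₑ * ‖h β‖ₑ) := by gcongr
      _ = ENNReal.ofReal D * (‖h α‖ₑ * ‖h β‖ₑ) + (‖h α‖ₑ * ‖h β‖ₑ) * M (α - β) ^ (1 / r) := by
          ring
      _ = _ := by
          congr 2
          rw [hhW, hhW, ENNReal.mul_rpow_of_nonneg _ _ hexp]
  have hmain : ‖∫ p : ℝ × ℝ, weylSum N (p.1 - p.2) * (h p.1 * starRingEnd ℂ (h p.2))‖ ≤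
      D * (I / T) ^ 2 + I ^ (2 - 1 / r) * (C₂ * (N : ℝ) ^ (r - 4)) ^ (1 / r) := by
    have hexp2 : 0 ≤ 2 - 1 / r := by
      have : 1 / r ≤ 1 := by rw [div_le_one hr0]; linarith
      linarith
    rw [← ENNReal.ofReal_le_ofReal_iff (by positivity), ofReal_norm]
    refine (enorm_integral_le_lintegral_enorm _).trans ?_
    refine (lintegral_mono hpoint).trans ?_
    have hm : Measurable fun p : ℝ × ℝ => ‖h p.1‖ₑ * ‖h p.2‖ₑ :=
      (hhm.comp measurable_fst).enorm.mul (hhm.comp measurable_snd).enorm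
    rw [lintegral_add_left (hm.const_mul _), ENNReal.ofReal_add (by positivity) (by positivity)]
    apply add_le_add
    · have h1 : ∫⁻ p : ℝ × ℝ, ‖h p.1‖ₑ * ‖h p.2‖ₑ = (∫⁻ α, ‖h α‖ₑ) * ∫⁻ α, ‖h α‖ₑ :=
        lintegral_prod_mul hhm.enorm.aemeasurable hhm.enorm.aemeasurable
      rw [lintegral_const_mul _ hm, h1, ENNReal.ofReal_mul hD0, sq]
      gcongr
      rw [ENNReal.ofReal_mul (div_nonneg hI0 hT0.le)]
      gcongr
    · refine (lintegral_convolution_le (by linarith) hWm hMm).trans ?_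
      rw [hWI, ENNReal.ofReal_mul (by positivity), ENNReal.ofReal_rpow_of_nonneg hI0 hexp2,
        ← ENNReal.ofReal_rpow_of_nonneg (p := 1 / r) (by positivity) (by positivity)]
      gcongr
  have hhalf : N * (D * (I / T) ^ 2) ≤ I ^ 2 / 2 := by
    have h1 : T ^ 2 = 4 * C₁ ^ 2 * (N * (N : ℝ) ^ (7 / 8 + ε)) := by
      have e1 : ((N : ℝ) ^ (15 / 16 + ε / 2)) ^ 2 = N * (N : ℝ) ^ (7 / 8 + ε) := by
        rw [← Real.rpow_natCast, ← Real.rpow_mul hN0.le]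
        nth_rewrite 2 [← Real.rpow_one (N : ℝ)]
        rw [← Real.rpow_add hN0]
        congr 1; push_cast; ring
      rw [hT, mul_pow, e1]; ring
    have h2 : N * D * 2 ≤ T ^ 2 := by
      rw [h1, hD]
      have : 0 < (N : ℝ) * (N : ℝ) ^ (7 / 8 + ε) := by positivity
      nlinarith
    rw [div_pow]
    have h3 : N * (D * (I ^ 2 / T ^ 2)) = (N * D * 2) / T ^ 2 * (I ^ 2 / 2) := by
      field_simp
    rw [h3]
    have h4 : (N * D * 2) / T ^ 2 ≤ 1 := (div_le_one (by positivity)).2 h2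
    nlinarith [sq_nonneg I]
  have hfinal : I ^ 2 ≤ I ^ 2 / 2 +
      I ^ (2 - 1 / r) * (N * (C₂ * (N : ℝ) ^ (r - 4)) ^ (1 / r)) := by
    calc I ^ 2 ≤ N * (D * (I / T) ^ 2 + I ^ (2 - 1 / r) * (C₂ * (N : ℝ) ^ (r - 4)) ^ (1 / r)) :=
          hdual.trans (by gcongr)
      _ = N * (D * (I / T) ^ 2) + I ^ (2 - 1 / r) * (N * (C₂ * (N : ℝ) ^ (r - 4)) ^ (1 / r)) := by
          ring
      _ ≤ _ := by gcongr
  refine (le_of_sq_le_half_add hI0 (by positivity) (by positivity) hfinal).trans (le_of_eq ?_)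
  rw [one_div_one_div, Real.mul_rpow (by norm_num) (by positivity),
    Real.mul_rpow (by positivity) (by positivity), ← Real.rpow_mul (by positivity),
    one_div_mul_cancel hr0.ne', Real.rpow_one]
  have : (N : ℝ) ^ (u - 4) = (N : ℝ) ^ r * (N : ℝ) ^ (r - 4) := by
    rw [← Real.rpow_add hN0]; congr 1; rw [hr]; ring
  rw [this]; ring

end SmoothWeyl

/-! ### Smooth numbers and nonnegativity of admissible exponents. -/

namespace SmoothWeyl
open Finset MeasureTheory

lemma smoothSet_subset (P R : ℝ) : smoothSet P R ⊆ Icc 1 ⌊P⌋₊ := by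
  classical
  unfold smoothSet
  exact filter_subset _ _

lemma mem_smoothSet {P R : ℝ} {n : ℕ} :
    n ∈ smoothSet P R ↔ n ∈ Icc 1 ⌊P⌋₊ ∧ ∀ p : ℕ, p.Prime → p ∣ n → (p : ℝ) ≤ R := by
  classical
  unfold smoothSet
  exact mem_filter

lemma continuous_g (P R : ℝ) : Continuous (g P R) := by
  unfold g
  exact continuous_finsetSum _ fun x _ => continuous_e.comp (by fun_prop)

lemma norm_g_le {P R : ℝ} (hP : 0 ≤ P) (α : ℝ) : ‖g P R α‖ ≤ P := by
  refine (norm_sum_e_le_card _ _).trans ?_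
  have h := card_le_card (smoothSet_subset P R)
  rw [Nat.card_Icc, Nat.add_sub_cancel] at h
  exact (Nat.cast_le.2 h).trans (Nat.floor_le hP)

lemma intervalIntegrable_norm_g_rpow (P R a b : ℝ) {t : ℝ} (ht : 0 ≤ t) :
    IntervalIntegrable (fun α => ‖g P R α‖ ^ t) volume a b :=
  ((continuous_g P R).norm.rpow_const fun _ => Or.inr ht).intervalIntegrable a b

/-- The numbers up to `y ^ k` with all prime divisors at most `y` include all products of `k`
factors up to `y`. -/
lemma pow_le_card_smoothSet_mul {y k B : ℕ} (hB : ∀ n ≤ y ^ k, n ≠ 0 → n.divisors.card ^ k ≤ B) :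
    y ^ k ≤ B * (smoothSet ((y ^ k : ℕ) : ℝ) y).card := by
  classical
  have hcard : (Fintype.piFinset fun _ : Fin k => Icc 1 y).card = y ^ k := by
    rw [Fintype.card_piFinset]; simp
  have hprod : ∀ f ∈ Fintype.piFinset fun _ : Fin k => Icc 1 y,
      ∏ i, f i ∈ smoothSet ((y ^ k : ℕ) : ℝ) y := by
    intro f hf
    rw [Fintype.mem_piFinset] at hf
    rw [mem_smoothSet, Nat.floor_natCast, mem_Icc]
    refine ⟨⟨Nat.one_le_iff_ne_zero.2 (prod_ne_zero_iff.2 fun i _ => ?_), ?_⟩, fun p hp hdvd => ?_⟩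
    · have := (mem_Icc.1 (hf i)).1; omega
    · calc ∏ i, f i ≤ ∏ _i : Fin k, y := prod_le_prod' fun i _ => (mem_Icc.1 (hf i)).2
        _ = y ^ k := by simp
    · obtain ⟨i, _, hi⟩ := (Nat.Prime.prime hp).exists_mem_finset_dvd hdvd
      have h1 := mem_Icc.1 (hf i)
      exact_mod_cast (Nat.le_of_dvd (by omega) hi).trans h1.2
  -- Every factor of a product equal to n divides n, so n has at most d(n)^k representations.
  refine hcard.symm.le.trans (card_le_mul_card_image_of_maps_to hprod B ?_)
  intro n hn
  rw [mem_smoothSet, Nat.floor_natCast, mem_Icc] at hn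
  refine le_trans ?_ (hB n hn.1.2 (by omega))
  have : n.divisors.card ^ k = (Fintype.piFinset fun _ : Fin k => n.divisors).card := by
    rw [Fintype.card_piFinset]; simp
  rw [this]
  apply card_le_card
  intro f hf
  rw [Fintype.mem_piFinset]
  intro i
  rw [Nat.mem_divisors]
  refine ⟨?_, by omega⟩
  rw [← (mem_filter.1 hf).2]
  exact dvd_prod_of_mem f (mem_univ i)

/-- So close to 0 all angles 2παx⁴ lie in [0, 1], and every term has real part at least 1/2. -/
lemma half_card_le_norm_g {P R α : ℝ} (hP : 1 ≤ P) (hα0 : 0 ≤ α) (hα : α ≤ 1 / (8 * P ^ 4)) :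
    ((smoothSet P R).card : ℝ) / 2 ≤ ‖g P R α‖ := by
  refine le_trans ?_ (Complex.re_le_norm _)
  rw [g, Complex.re_sum, div_eq_mul_inv, ← nsmul_eq_mul]
  apply card_nsmul_le_sum
  intro x hx
  have hxP : (x : ℝ) ≤ P :=
    (Nat.cast_le.2 (mem_Icc.1 (smoothSet_subset P R hx)).2).trans (Nat.floor_le (by linarith))
  have h1 : α * (x : ℝ) ^ 4 ≤ 1 / 8 := by
    calc α * (x : ℝ) ^ 4 ≤ 1 / (8 * P ^ 4) * P ^ 4 := by gcongr
      _ = 1 / 8 := by field_simp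
  have h0 : 0 ≤ α * (x : ℝ) ^ 4 := by positivity
  rw [e_eq_cos_add_sin]
  simp only [Complex.add_re, Complex.ofReal_re, Complex.mul_re, Complex.I_re, Complex.ofReal_im,
    Complex.I_im, mul_zero, zero_mul, sub_zero, add_zero]
  refine le_trans ?_ Real.one_sub_sq_div_two_le_cos
  have h2 : 2 * Real.pi * (α * (x : ℝ) ^ 4) ≤ 1 := by nlinarith [Real.pi_lt_four, Real.pi_pos]
  have h3 : 0 ≤ 2 * Real.pi * (α * (x : ℝ) ^ 4) := by positivity
  nlinarith

lemma card_rpow_le_integral {P R t : ℝ} (hP : 1 ≤ P) (ht : 0 ≤ t) :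
    1 / (8 * P ^ 4) * (((smoothSet P R).card : ℝ) / 2) ^ t ≤
      ∫ α in (0 : ℝ)..1, ‖g P R α‖ ^ t := by
  have hP4 : 1 ≤ P ^ 4 := one_le_pow₀ hP
  have h0 : 0 ≤ 1 / (8 * P ^ 4) := by positivity
  have h1 : 1 / (8 * P ^ 4) ≤ 1 := by rw [div_le_one (by positivity)]; linarith
  calc 1 / (8 * P ^ 4) * (((smoothSet P R).card : ℝ) / 2) ^ t =
        ∫ _α in (0 : ℝ)..(1 / (8 * P ^ 4)), (((smoothSet P R).card : ℝ) / 2) ^ t := by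
        rw [intervalIntegral.integral_const, smul_eq_mul, sub_zero]
    _ ≤ ∫ α in (0 : ℝ)..(1 / (8 * P ^ 4)), ‖g P R α‖ ^ t := by
        refine intervalIntegral.integral_mono_on h0 (by simp)
          (intervalIntegrable_norm_g_rpow P R _ _ ht) fun α hα => ?_
        gcongr
        exact half_card_le_norm_g hP hα.1 hα.2
    _ ≤ _ := by
        refine intervalIntegral.integral_mono_interval le_rfl h0 h1
          (Filter.Eventually.of_forall fun α => by positivity)
          (intervalIntegrable_norm_g_rpow P R _ _ ht)

/-- Admissible exponents are nonnegative. -/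
lemma Admissible.nonneg {t Δ : ℝ} (h : Admissible t Δ) : 0 ≤ Δ := by
  obtain ⟨ht, η, hη, C, hC⟩ := h
  by_contra! hΔ
  -- With k > 1/η, the choice R = y, P = y^k satisfies R ≤ P^η.
  obtain ⟨k, hk⟩ := exists_nat_gt (1 / η)
  have hk0 : (0 : ℝ) < k := lt_trans (by positivity) hk
  have hkη : 1 ≤ k * η := by rw [div_lt_iff₀ hη] at hk; linarith
  -- The smooth set has at least about P^(1-δ) elements. The resulting loss P^(δt) = P^(-Δ/2) uses
  -- only half of the assumed saving, which leaves a contradiction as y → ∞.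
  set δ : ℝ := -Δ / (2 * t) with hδ
  have hδ0 : 0 < δ := div_pos (neg_pos.2 hΔ) (by positivity)
  obtain ⟨K, hK, hdiv⟩ := exists_card_divisors_le (ε := δ / k) (by positivity)
  have hlower : ∀ y : ℕ, 1 ≤ y →
      (1 / (2 * K ^ k)) ^ t / 8 ≤ |C| * ((y : ℝ) ^ k) ^ (Δ / 2) := by
    intro y hy
    have hy1 : (1 : ℝ) ≤ y := by exact_mod_cast hy
    set P : ℝ := (y : ℝ) ^ k with hP
    have hP1 : 1 ≤ P := one_le_pow₀ hy1
    have hP0 : 0 < P := by linarith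
    have hcast : ((y ^ k : ℕ) : ℝ) = P := by rw [hP]; push_cast; rfl
    set A := (smoothSet P y).card with hA
    have hcard : P ^ (1 - δ) / K ^ k ≤ A := by
      have h1 := pow_le_card_smoothSet_mul (y := y) (k := k) (B := ⌊K ^ k * P ^ δ⌋₊) (by
        intro n hn hn0
        apply Nat.le_floor
        push_cast
        have h2 : (n : ℝ) ≤ P := by rw [← hcast]; exact_mod_cast hn
        calc ((n.divisors.card : ℕ) : ℝ) ^ k ≤ (K * (n : ℝ) ^ (δ / k)) ^ k := by
              gcongr; exact hdiv n hn0
          _ ≤ (K * P ^ (δ / k)) ^ k := by gcongr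
          _ = K ^ k * P ^ δ := by
              rw [mul_pow, ← Real.rpow_natCast (P ^ (δ / k)), ← Real.rpow_mul hP0.le,
                div_mul_cancel₀ _ hk0.ne'])
      rw [hcast] at h1
      have h2 : P ≤ K ^ k * P ^ δ * A := by
        calc P = ((y ^ k : ℕ) : ℝ) := hcast.symm
          _ ≤ ((⌊K ^ k * P ^ δ⌋₊ * A : ℕ) : ℝ) := by exact_mod_cast h1
          _ ≤ _ := by
            push_cast
            gcongr
            exact Nat.floor_le (by positivity)
      rw [div_le_iff₀ (by positivity), Real.rpow_sub hP0, Real.rpow_one,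
        div_le_iff₀ (by positivity)]
      linarith
    have h3 := hC P y hP1 hy1 (by
      rw [hP, ← Real.rpow_natCast, ← Real.rpow_mul (by linarith)]
      exact Real.self_le_rpow_of_one_le hy1 hkη)
    have h4 := (card_rpow_le_integral (R := y) hP1 ht.le).trans h3
    have h5 : (P ^ (1 - δ) / K ^ k / 2) ^ t ≤ ((A : ℝ) / 2) ^ t := by gcongr
    have h6 : (P ^ (1 - δ) / K ^ k / 2) ^ t = P ^ (t + Δ / 2) * (1 / (2 * K ^ k)) ^ t := by
      rw [show P ^ (1 - δ) / K ^ k / 2 = P ^ (1 - δ) * (1 / (2 * K ^ k)) by field_simp,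
        Real.mul_rpow (by positivity) (by positivity), ← Real.rpow_mul hP0.le]
      congr 2
      rw [hδ]; field_simp; ring
    have h7 : 1 / (8 * P ^ 4) * (P ^ (t + Δ / 2) * (1 / (2 * K ^ k)) ^ t) ≤
        |C| * P ^ (t - 4 + Δ) := by
      calc _ ≤ 1 / (8 * P ^ 4) * ((A : ℝ) / 2) ^ t := by rw [← h6]; gcongr
        _ ≤ C * P ^ (t - 4 + Δ) := h4
        _ ≤ _ := by gcongr; exact le_abs_self C
    have h8 : P ^ (t - 4 + Δ) = P ^ (t + Δ / 2) / P ^ 4 * P ^ (Δ / 2) := by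
      rw [← Real.rpow_natCast P 4, ← Real.rpow_sub hP0, ← Real.rpow_add hP0]
      congr 1; push_cast; ring
    rw [h8] at h7
    have hX : 0 < P ^ (t + Δ / 2) / P ^ 4 := by positivity
    rw [← mul_le_mul_iff_right₀ hX]
    calc _ = 1 / (8 * P ^ 4) * (P ^ (t + Δ / 2) * (1 / (2 * K ^ k)) ^ t) := by field_simp
      _ ≤ _ := h7
      _ = _ := by ring
  have hpos : 0 < (1 / (2 * K ^ k)) ^ t / 8 := by positivity
  have hlim : Filter.Tendsto (fun y : ℕ => |C| * ((y : ℝ) ^ k) ^ (Δ / 2)) Filter.atTop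
      (nhds (|C| * 0)) := by
    refine Filter.Tendsto.const_mul _ ?_
    have h1 : Filter.Tendsto (fun x : ℝ => x ^ (-(-(Δ / 2)))) Filter.atTop (nhds 0) :=
      tendsto_rpow_neg_atTop (by linarith)
    rw [neg_neg] at h1
    have hk1 : k ≠ 0 := by rintro rfl; simp at hk0
    exact h1.comp ((Filter.tendsto_pow_atTop hk1).comp tendsto_natCast_atTop_atTop)
  rw [mul_zero] at hlim
  obtain ⟨y, hy1, hy2⟩ := ((hlim.eventually_lt_const hpos).and
    (Filter.eventually_ge_atTop 1)).exists
  exact absurd (hlower y hy2) (not_le.2 hy1)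

/-! ### Deduction of the moment bound. -/

/-- A moment estimate with an admissible exponent implies the expected estimate for a larger
moment. -/
theorem exists_moment_bound {s Δ u : ℝ} (hadm : Admissible s Δ) (hu : s + 16 * Δ < u)
    (hu10 : 10 < u) :
    ∃ η : ℝ, 0 < η ∧ ∃ C : ℝ, ∀ P R : ℝ, 1 ≤ P → 1 ≤ R → R ≤ P ^ η →
      ∫ α in (0 : ℝ)..1, ‖g P R α‖ ^ u ≤ C * P ^ (u - 4) := by
  have hΔ := hadm.nonneg
  obtain ⟨hs, η, hη, C, hC⟩ := hadm
  have hus : 0 < u - s := by linarith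
  -- With this ε the part below the threshold has exponent (15/16+ε/2)(u-s) + s-4+Δ = u-4-ε(u-s)/2.
  set ε : ℝ := ((u - s) / 16 - Δ) / (u - s) with hε
  have hε0 : 0 < ε := div_pos (by linarith) hus
  have hεus : ε * (u - s) = (u - s) / 16 - Δ := by rw [hε]; field_simp
  obtain ⟨K, hK, C', hC', hlarge⟩ := exists_large_values_bound hu10 hε0
  refine ⟨η, hη, C' + K ^ (u - s) * |C|, fun P R hP hR hRP => ?_⟩
  have hP0 : 0 < P := by linarith
  set N := ⌊P⌋₊ with hN
  have hN1 : 1 ≤ N := Nat.one_le_floor_iff P |>.2 hP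
  have hNP : (N : ℝ) ≤ P := Nat.floor_le hP0.le
  set T : ℝ := K * (N : ℝ) ^ (15 / 16 + ε / 2) with hT
  have hT0 : 0 ≤ T := by positivity
  have h1 := hlarge N (smoothSet P R) hN1 (smoothSet_subset P R)
  set E : Set ℝ := {α | α ∈ Set.Ioc (0 : ℝ) 1 ∧ T < ‖g P R α‖} with hE
  have h1' : ∫ α in E, ‖g P R α‖ ^ u ≤ C' * (N : ℝ) ^ (u - 4) := h1
  have hEm : MeasurableSet E :=
    measurableSet_Ioc.inter (measurableSet_lt measurable_const (continuous_g P R).norm.measurable)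
  have hint : ∀ t : ℝ, 0 ≤ t → IntegrableOn (fun α => ‖g P R α‖ ^ t) (Set.Ioc 0 1) := fun t ht =>
    (intervalIntegrable_iff_integrableOn_Ioc_of_le zero_le_one).1
      (intervalIntegrable_norm_g_rpow P R 0 1 ht)
  have hintu := hint u (by linarith)
  have hsub : E ⊆ Set.Ioc 0 1 := fun α hα => hα.1
  have hsplit : ∫ α in (0 : ℝ)..1, ‖g P R α‖ ^ u =
      (∫ α in E, ‖g P R α‖ ^ u) + ∫ α in Set.Ioc 0 1 \ E, ‖g P R α‖ ^ u := by
    rw [intervalIntegral.integral_of_le zero_le_one, setIntegral_sdiff hEm hintu hsub]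
    ring
  have hsmall : ∫ α in Set.Ioc 0 1 \ E, ‖g P R α‖ ^ u ≤
      T ^ (u - s) * ∫ α in (0 : ℝ)..1, ‖g P R α‖ ^ s := by
    rw [intervalIntegral.integral_of_le zero_le_one, ← integral_const_mul]
    calc _ ≤ ∫ α in Set.Ioc 0 1 \ E, T ^ (u - s) * ‖g P R α‖ ^ s := by
          refine setIntegral_mono_on (hintu.mono_set Set.sdiff_subset)
            (IntegrableOn.mono_set (t := Set.Ioc 0 1) ((hint s hs.le).const_mul _)
              Set.sdiff_subset)
            (measurableSet_Ioc.diff hEm) fun α hα => ?_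
          have h2 : ‖g P R α‖ ≤ T := by
            by_contra hcon
            exact hα.2 ⟨hα.1, not_le.1 hcon⟩
          calc ‖g P R α‖ ^ u = ‖g P R α‖ ^ (u - s) * ‖g P R α‖ ^ s := by
                rw [← Real.rpow_add_of_nonneg (norm_nonneg _) hus.le hs.le, sub_add_cancel]
            _ ≤ _ := by gcongr
      _ ≤ _ := by
          refine setIntegral_mono_set ((hint s hs.le).const_mul _)
            (Filter.Eventually.of_forall fun α => ?_)
            (Filter.Eventually.of_forall fun α hα => hα.1)
          have := Real.rpow_nonneg hT0 (u - s)
          positivity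
  have hTP : T ^ (u - s) ≤ K ^ (u - s) * P ^ ((15 / 16 + ε / 2) * (u - s)) := by
    calc T ^ (u - s) ≤ (K * P ^ (15 / 16 + ε / 2)) ^ (u - s) := by
          rw [hT]; gcongr
      _ = _ := by
          rw [Real.mul_rpow (by positivity) (by positivity), ← Real.rpow_mul hP0.le]
  have hs_mom : ∫ α in (0 : ℝ)..1, ‖g P R α‖ ^ s ≤ |C| * P ^ (s - 4 + Δ) :=
    (hC P R hP hR hRP).trans (by gcongr; exact le_abs_self C)
  rw [hsplit]
  calc _ ≤ C' * (N : ℝ) ^ (u - 4) + T ^ (u - s) * ∫ α in (0 : ℝ)..1, ‖g P R α‖ ^ s :=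
        add_le_add h1' hsmall
    _ ≤ C' * P ^ (u - 4) + K ^ (u - s) * P ^ ((15 / 16 + ε / 2) * (u - s)) *
          (|C| * P ^ (s - 4 + Δ)) := by
        have : 0 ≤ u - 4 := by linarith
        have : 0 ≤ ∫ α in (0 : ℝ)..1, ‖g P R α‖ ^ s :=
          intervalIntegral.integral_nonneg zero_le_one fun α _ => by positivity
        gcongr
    _ = C' * P ^ (u - 4) + K ^ (u - s) * |C| *
          P ^ ((15 / 16 + ε / 2) * (u - s) + (s - 4 + Δ)) := by
        rw [Real.rpow_add hP0 ((15 / 16 + ε / 2) * (u - s))]; ring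
    _ ≤ C' * P ^ (u - 4) + K ^ (u - s) * |C| * P ^ (u - 4) := by
        gcongr
        nlinarith
    _ = _ := by ring

lemma integral_norm_g_rpow_le {P R u w : ℝ} (hP : 1 ≤ P) (hu : 0 ≤ u) (huw : u ≤ w) :
    ∫ α in (0 : ℝ)..1, ‖g P R α‖ ^ w ≤ P ^ (w - u) * ∫ α in (0 : ℝ)..1, ‖g P R α‖ ^ u := by
  rw [← intervalIntegral.integral_const_mul]
  refine intervalIntegral.integral_mono_on zero_le_one
    (intervalIntegrable_norm_g_rpow P R _ _ (hu.trans huw))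
    ((intervalIntegrable_norm_g_rpow P R _ _ hu).const_mul _) fun α _ => ?_
  calc ‖g P R α‖ ^ w = ‖g P R α‖ ^ (w - u) * ‖g P R α‖ ^ u := by
        rw [← Real.rpow_add_of_nonneg (norm_nonneg _) (by linarith) hu, sub_add_cancel]
    _ ≤ _ := by
        have : 0 ≤ w - u := by linarith
        gcongr
        exact norm_g_le (by linarith) α

end SmoothWeyl

end

theorem theorem5p1 (s Δ u : ℝ) (hs : 8 ≤ s) (hadm : SmoothWeyl.Admissible s Δ)
    (hΔ : Δ < 1 / 8) (hu : s + 16 * Δ < u) (h10 : 10 < s + 16 * Δ) :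
    (∃ η : ℝ, 0 < η ∧ ∃ C : ℝ, ∀ P R : ℝ, 1 ≤ P → 1 ≤ R → R ≤ P ^ η →
      ∫ α in (0 : ℝ)..1, ‖SmoothWeyl.g P R α‖ ^ u ≤ C * P ^ (u - 4)) ∧
    ∀ w : ℝ, u ≤ w → SmoothWeyl.Admissible w 0 := by
  have hmain := SmoothWeyl.exists_moment_bound hadm hu (h10.trans hu)
  refine ⟨hmain, fun w hw => ⟨by linarith, ?_⟩⟩
  obtain ⟨η, hη, C, hC⟩ := hmain
  refine ⟨η, hη, C, fun P R hP hR hRP => ?_⟩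
  have hP0 : 0 < P := by linarith
  refine (SmoothWeyl.integral_norm_g_rpow_le hP (by linarith) hw).trans ?_
  calc _ ≤ P ^ (w - u) * (C * P ^ (u - 4)) := by gcongr; exact hC P R hP hR hRP
    _ = C * (P ^ (w - u) * P ^ (u - 4)) := by ring
    _ = C * P ^ (w - 4 + 0) := by rw [← Real.rpow_add hP0]; congr 2; ring
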